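/- Let $\mathbb F_q$ be a finite field with $q$ elements, $A=\mathbb F_q[T]$, let $j,k\ge 1$ be coprime integers, $m=j+k$, and let $n\ge 1$. Consider Drinfeld $A$-modules $\phi$ of the form $\phi_T=g_m\tau^m+g_j\tau^j+1$ with $g_m$ invertible, over $\mathbb F_{q^m}$-algebras; $\phi$ is called normalized if $g_m=-1$. For such a $\phi$ over a field $L\supseteq\mathbb F_{q^m}$ let $\mathcal G(T^n;\phi)$ be the set of $A$-submodules $G\subseteq\operatorname{Ker}(\phi_{T^n})\subseteq\bar L$ with $G\cong A/(T^n)$ that are stable under $\operatorname{Aut}(\bar L/L)$; over an $\mathbb F_{q^m}$-algebra $R$, an element of $\mathcal G(T^n;\phi)$ is a closed subscheme $G$ of $\operatorname{Ker}(\phi_{T^n})\subseteq\mathbb G_{a,R}$ defined by a monic polynomial over $R$, whose geometric fibres are $A$-submodules isomorphic to $A/(T^n)$. Let - $\ddot X_{m,j}(T^n)$ be the curve over $\mathbb F_{q^m}$ parametrizing triples $(\phi,G,x)$ with $\phi$ normalized, $G\in\mathcal G(T^n;\phi)$ and $x$ a (nowhere) nonzero rational point of $G\cap\operatorname{Ker}(\phi_T)$;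 - $\dot X_{m,j}(T^n)$ be the curve over $\mathbb F_{q^m}$ parametrizing pairs $(\phi,G)$ with $\phi$ normalized and $G\in\mathcal G(T^n;\phi)$; - $X_{m,j}(T^n)$ be the curve over $\mathbb F_{q^m}$ parametrizing equivalence classes of pairs $(\phi,G)$ with $\phi$ geometrically isomorphic to a normalized Drinfeld module and $G\in\mathcal G(T^n;\phi)$, where $(\phi,G)$ and $(\phi',G')$ are equivalent if, over $\bar L$ (over a faithfully flat extension of $R$, for families over $R$), there is an invertible scalar $\lambda$ with $\lambda\phi_T=\phi'_T\lambda$ and $\lambda G=G'$. These three moduli problems are represented by smooth affine curves over $\mathbb F_{q^m}$ (possibly reducible if the characteristic divides $k$), and the rules $$(\phi,G,x)\mapsto(\phi,\phi_TG,x),\qquad (\phi,G)\mapsto(\phi,\phi_TG),\qquad [(\phi,G)]\mapsto[(\phi,\phi_TG)]$$ define morphisms $$\ddot X_{m,j}(T^{n+1})\to\ddot X_{m,j}(T^n),\qquad \dot X_{m,j}(T^{n+1})\to\dot X_{m,j}(T^n),\qquad X_{m,j}(T^{n+1})\to X_{m,j}(T^n).$$ Each of these three morphisms has degree $q^{m-1}$,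 that is, it is finite locally free of constant rank $q^{m-1}$. (When the curves are irreducible, this is the degree of the extension of function fields.) -/

import Mathlib

open Polynomial

set_option linter.unusedSectionVars false

noncomputable section

universe v u

/-!
Throughout, `Fq` is a finite field with `q` elements, `A = Fq[X]` (the variable `X` of `Fq[X]` is
the indeterminate `T` of the text), and `m = j + k`.  All Drinfeld modules are `A`-modules over
`Fq`-algebras `R` on which `T` acts with constant term `1`, that is, the structure map
`ι : A → R` is the `Fq`-algebra map with `ι T = 1`.
-/

/-- A Drinfeld module of the form `φ_T = g_m τ ^ m + g_j τ ^ j + 1` over the ring `R`, where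
`m = j + k` and `g_m` is invertible (so that the rank is `m` on every fibre).
A Drinfeld `Fq[T]`-module is determined by the twisted polynomial `φ_T`. -/
@[ext]
structure DrinfeldModule (Fq : Type v) (j k : ℕ) (R : Type u) [CommRing R] where
  gm : Rˣ
  gj : R

namespace DrinfeldModule

variable {Fq : Type v} [Field Fq] [Fintype Fq] {j k : ℕ}
variable {R : Type u} [CommRing R] [Algebra Fq R]
variable {S : Type u} [CommRing S] [Algebra Fq S]
variable {S' : Type u} [CommRing S'] [Algebra Fq S']

/-- Base change of a Drinfeld module. -/
def map (φ : DrinfeldModule Fq j k R) (f : R →ₐ[Fq] S) : DrinfeldModule Fq j k S where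
  gm := Units.map (f : R →* S) φ.gm
  gj := f φ.gj

/-- The action `z ↦ g_m z ^ (q ^ m) + g_j z ^ (q ^ j) + z` of `φ_T` on `R`. -/
def phiT (φ : DrinfeldModule Fq j k R) : Module.End Fq R :=
  LinearMap.mulLeft Fq (φ.gm : R) * (FiniteField.frobeniusAlgHom Fq R ^ (j + k)).toLinearMap +
    LinearMap.mulLeft Fq φ.gj * (FiniteField.frobeniusAlgHom Fq R ^ j).toLinearMap + 1

/-- The homomorphism `a ↦ φ_a` of `Fq`-algebras, with `φ_a` viewed through its action on `R`. -/
def act (φ : DrinfeldModule Fq j k R) : Fq[X] →ₐ[Fq] Module.End Fq R := aeval φ.phiT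

/-- `R` as an `A`-module through the Drinfeld module `φ`. -/
abbrev AMod (φ : DrinfeldModule Fq j k R) : Type u := Module.AEval' φ.phiT

/-- The additive polynomial `φ_a(Y) ∈ R[Y]`, obtained by letting `φ_a` act on `Y ∈ R[Y]`. -/
def poly (φ : DrinfeldModule Fq j k R) (a : Fq[X]) : R[X] :=
  (φ.map (CAlgHom (R := Fq) (A := R))).act a X

/-- The scalar `c` is an isomorphism from `φ` to `ψ`: the identity `c φ_T = ψ_T c` of twisted
polynomials, written out in coefficients by means of `τ ^ i c = c ^ (q ^ i) τ ^ i`. -/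
def IsIsom (φ ψ : DrinfeldModule Fq j k R) (c : Rˣ) : Prop :=
  (c : R) * φ.gm = ψ.gm * (c : R) ^ Fintype.card Fq ^ (j + k) ∧
    (c : R) * φ.gj = ψ.gj * (c : R) ^ Fintype.card Fq ^ j

/-- `φ` is normalized: `g_m = -1`. -/
def IsNormalized (φ : DrinfeldModule Fq j k R) : Prop := φ.gm = -1

lemma phiT_apply (φ : DrinfeldModule Fq j k R) (z : R) :
    φ.phiT z = φ.gm * z ^ Fintype.card Fq ^ (j + k) + φ.gj * z ^ Fintype.card Fq ^ j + z := by
  have h : ∀ i : ℕ, (FiniteField.frobeniusAlgHom Fq R ^ i) z = z ^ Fintype.card Fq ^ i := by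
    intro i
    rw [AlgHom.coe_pow, FiniteField.coe_frobeniusAlgHom, pow_iterate]
  simp [phiT, h]

lemma map_phiT (φ : DrinfeldModule Fq j k R) (f : R →ₐ[Fq] S) (z : R) :
    f (φ.phiT z) = (φ.map f).phiT (f z) := by
  simp [phiT_apply, map]

lemma map_act (φ : DrinfeldModule Fq j k R) (f : R →ₐ[Fq] S) (a : Fq[X]) (z : R) :
    f (φ.act a z) = (φ.map f).act a (f z) := by
  induction a using Polynomial.induction_on generalizing z with
  | C c => simp [act]
  | add p r hp hr => simp [hp, hr]
  | monomial n c h =>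
    have e : (C c * X ^ (n + 1) : Fq[X]) = (C c * X ^ n) * X := by ring
    rw [e, map_mul φ.act (C c * X ^ n) X, map_mul (φ.map f).act (C c * X ^ n) X,
      Module.End.mul_apply, Module.End.mul_apply, h]
    simp [act, map_phiT]

lemma map_map (φ : DrinfeldModule Fq j k R) (f : R →ₐ[Fq] S) (g : S →ₐ[Fq] S') :
    (φ.map f).map g = φ.map (g.comp f) := by
  ext <;> simp [map]

lemma map_poly (φ : DrinfeldModule Fq j k R) (f : R →ₐ[Fq] S) (a : Fq[X]) :
    (φ.poly a).map (f : R →+* S) = (φ.map f).poly a := by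
  have h := map_act (φ.map (CAlgHom (R := Fq) (A := R))) (Polynomial.mapAlgHom f) a X
  rw [map_map] at h
  have e : (Polynomial.mapAlgHom f).comp (CAlgHom (R := Fq) (A := R)) =
      (CAlgHom (R := Fq) (A := S)).comp f := by
    ext z; simp
  rw [e, ← map_map] at h
  simpa [poly] using h

/-- `P` cuts out an element `G` of `𝒢(N; φ)` over the ring `R`: `G ⊆ 𝔾_a` is the zero scheme of the
monic polynomial `P`, it is contained in the kernel of `φ_N`, and on every geometric point `s` of
`R` the zero set of `P` is an `A`-submodule isomorphic to `A / (N)`.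
If `R = L` is a field, such `P` are the polynomials `∏ (Y - g)`, `g ∈ G`, for the
`A`-submodules `G ≅ A / (N)` of `Ker φ_N ⊆ L̄` that are stable under `Aut (L̄ / L)` (here `N` is
prime to the characteristic `T - 1`). -/
def IsLevel (φ : DrinfeldModule Fq j k R) (N : Fq[X]) (P : R[X]) : Prop :=
  P.Monic ∧ P ∣ φ.poly N ∧
    ∀ (Ω : Type u) [Field Ω] [IsAlgClosed Ω] [Algebra Fq Ω] (s : R →ₐ[Fq] Ω),
      ∃ G : Submodule Fq[X] (φ.map s).AMod,
        (∀ z : Ω, Module.AEval'.of (φ.map s).phiT z ∈ G ↔ P.eval₂ (s : R →+* Ω) z = 0) ∧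
        Nonempty (G ≃ₗ[Fq[X]] (Fq[X] ⧸ Ideal.span {N}))

lemma IsLevel.map {φ : DrinfeldModule Fq j k R} {N : Fq[X]} {P : R[X]} (h : φ.IsLevel N P)
    (f : R →ₐ[Fq] S) : (φ.map f).IsLevel N (P.map (f : R →+* S)) := by
  refine ⟨h.1.map _, ?_, ?_⟩
  · rw [← map_poly]
    exact Polynomial.map_dvd _ h.2.1
  · intro Ω _ _ _ s
    rw [map_map]
    obtain ⟨G, hG, e⟩ := h.2.2 Ω (s.comp f)
    refine ⟨G, fun z => ?_, e⟩
    rw [hG z, Polynomial.eval₂_map]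
    rfl

/-- `G' = φ_T G`, where `G` and `G'` are the zero schemes of `P` and `P'`: the equality of
zero sets on every geometric point of `R`. -/
def IsImage (φ : DrinfeldModule Fq j k R) (P P' : R[X]) : Prop :=
  ∀ (Ω : Type u) [Field Ω] [IsAlgClosed Ω] [Algebra Fq Ω] (s : R →ₐ[Fq] Ω) (z : Ω),
    P'.eval₂ (s : R →+* Ω) z = 0 ↔
      ∃ w : Ω, P.eval₂ (s : R →+* Ω) w = 0 ∧ (φ.map s).phiT w = z

end DrinfeldModule

/-- A moduli problem on `Fq`-algebras: families over `R`, pull-back of families, and the relation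
of equivalence between families over the same `R`. -/
structure ModuliProblem (Fq : Type v) [Field Fq] where
  Pt : ∀ (R : Type u) [CommRing R] [Algebra Fq R], Type u
  pull : ∀ {R : Type u} [CommRing R] [Algebra Fq R] {S : Type u} [CommRing S] [Algebra Fq S],
    (R →ₐ[Fq] S) → Pt R → Pt S
  equiv : ∀ {R : Type u} [CommRing R] [Algebra Fq R], Pt R → Pt R → Prop

section Families

variable (Fq : Type v) [Field Fq] [Fintype Fq] (j k : ℕ) (N : Fq[X])

/-- Triples `(φ, G, x)` over `R`: `φ` normalized, `G ∈ 𝒢(N; φ)` given by its equation `P`, and `x`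
a nowhere vanishing section of `G ∩ Ker φ_T`. -/
@[ext]
structure PtDDot (R : Type u) [CommRing R] [Algebra Fq R] where
  φ : DrinfeldModule Fq j k R
  P : R[X]
  x : Rˣ
  normalized : φ.IsNormalized
  level : φ.IsLevel N P
  mem : P.eval (x : R) = 0
  torsion : φ.phiT (x : R) = 0

/-- Pairs `(φ, G)` over `R`: `φ` normalized and `G ∈ 𝒢(N; φ)` given by its equation `P`. -/
@[ext]
structure PtDot (R : Type u) [CommRing R] [Algebra Fq R] where
  φ : DrinfeldModule Fq j k R
  P : R[X]
  normalized : φ.IsNormalized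
  level : φ.IsLevel N P

/-- Pairs `(φ, G)` over `R`: `φ` is geometrically isomorphic to a normalized Drinfeld module, and
`G ∈ 𝒢(N; φ)` is given by its equation `P`. -/
@[ext]
structure PtX (R : Type u) [CommRing R] [Algebra Fq R] where
  φ : DrinfeldModule Fq j k R
  P : R[X]
  normalizable : ∀ (Ω : Type u) [Field Ω] [IsAlgClosed Ω] [Algebra Fq Ω] (s : R →ₐ[Fq] Ω),
    ∃ (ψ : DrinfeldModule Fq j k Ω) (c : Ωˣ), ψ.IsNormalized ∧ (φ.map s).IsIsom ψ c
  level : φ.IsLevel N P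

variable {Fq j k N}
variable {R : Type u} [CommRing R] [Algebra Fq R] {S : Type u} [CommRing S] [Algebra Fq S]

/-- Pull-back of a triple `(φ, G, x)`. -/
def PtDDot.pull (f : R →ₐ[Fq] S) (t : PtDDot Fq j k N R) : PtDDot Fq j k N S where
  φ := t.φ.map f
  P := t.P.map (f : R →+* S)
  x := Units.map (f : R →* S) t.x
  normalized := by
    have h := t.normalized
    unfold DrinfeldModule.IsNormalized at h ⊢
    ext
    simp [DrinfeldModule.map, h]
  level := t.level.map f
  mem := by
    have h := congrArg f t.mem
    rw [map_zero] at h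
    rw [← h, Polynomial.eval_map]
    exact Polynomial.eval₂_at_apply (f : R →+* S) (t.x : R)
  torsion := by
    have h := DrinfeldModule.map_phiT t.φ f (t.x : R)
    rw [t.torsion, map_zero] at h
    exact h.symm

/-- Pull-back of a pair `(φ, G)` with `φ` normalized. -/
def PtDot.pull (f : R →ₐ[Fq] S) (t : PtDot Fq j k N R) : PtDot Fq j k N S where
  φ := t.φ.map f
  P := t.P.map (f : R →+* S)
  normalized := by
    have h := t.normalized
    unfold DrinfeldModule.IsNormalized at h ⊢
    ext
    simp [DrinfeldModule.map, h]
  level := t.level.map f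

/-- Pull-back of a pair `(φ, G)`. -/
def PtX.pull (f : R →ₐ[Fq] S) (t : PtX Fq j k N R) : PtX Fq j k N S where
  φ := t.φ.map f
  P := t.P.map (f : R →+* S)
  normalizable := by
    intro Ω _ _ _ s
    rw [DrinfeldModule.map_map]
    exact t.normalizable Ω (s.comp f)
  level := t.level.map f

/-- Equivalence of the pairs `(φ, G)` and `(φ', G')` over `R`: after a faithfully flat base change
`R → S` (for a field `R = L`, one may take `S = L̄`) there is an isomorphism `c` from `φ` to `φ'`
with `c G = G'`. -/
def PtX.Equivalent (t t' : PtX Fq j k N R) : Prop :=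
  ∃ (S : Type u) (_ : CommRing S) (_ : Algebra Fq S) (i : R →ₐ[Fq] S) (c : Sˣ),
    (i : R →+* S).FaithfullyFlat ∧ (t.φ.map i).IsIsom (t'.φ.map i) c ∧
      ∀ (Ω : Type u) [Field Ω] [IsAlgClosed Ω] [Algebra Fq Ω] (s : S →ₐ[Fq] Ω) (z : Ω),
        t.P.eval₂ (s.comp i : R →+* Ω) z = 0 ↔ t'.P.eval₂ (s.comp i : R →+* Ω) (s c * z) = 0

/-- `(φ', G', x') = (φ, φ_T G, x)`. -/
def PtDDot.Covers {N' : Fq[X]} (t : PtDDot Fq j k N' R) (t' : PtDDot Fq j k N R) : Prop :=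
  t'.φ = t.φ ∧ t.φ.IsImage t.P t'.P ∧ t'.x = t.x

/-- `(φ', G') = (φ, φ_T G)`, for normalized `φ`. -/
def PtDot.Covers {N' : Fq[X]} (t : PtDot Fq j k N' R) (t' : PtDot Fq j k N R) : Prop :=
  t'.φ = t.φ ∧ t.φ.IsImage t.P t'.P

/-- `(φ', G') = (φ, φ_T G)`. -/
def PtX.Covers {N' : Fq[X]} (t : PtX Fq j k N' R) (t' : PtX Fq j k N R) : Prop :=
  t'.φ = t.φ ∧ t.φ.IsImage t.P t'.P

end Families

section Problems

variable (Fq : Type v) [Field Fq] [Fintype Fq] (j k : ℕ) (N : Fq[X])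

/-- The moduli problem of `Ẍ_{m,j}(N)`: triples `(φ, G, x)`. -/
def moduliDDot : ModuliProblem.{v, u} Fq where
  Pt R _ _ := PtDDot Fq j k N R
  pull f t := t.pull f
  equiv t t' := t = t'

/-- The moduli problem of `Ẋ_{m,j}(N)`: pairs `(φ, G)` with `φ` normalized. -/
def moduliDot : ModuliProblem.{v, u} Fq where
  Pt R _ _ := PtDot Fq j k N R
  pull f t := t.pull f
  equiv t t' := t = t'

/-- The moduli problem of `X_{m,j}(N)`: equivalence classes of pairs `(φ, G)`. -/
def moduliX : ModuliProblem.{v, u} Fq where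
  Pt R _ _ := PtX Fq j k N R
  pull f t := t.pull f
  equiv t t' := t.Equivalent t'

end Problems

section Curves

variable {Fq : Type v} [Field Fq] (K : Type u) [Field K] [Algebra Fq K]

/-- The `K`-scheme `Spec B` parametrizes the equivalence classes of families of `M`, with universal
family `t₀`. -/
def Parametrizes (M : ModuliProblem.{v, u} Fq) (B : Type u) [CommRing B] [Algebra K B]
    [Algebra Fq B] [IsScalarTower Fq K B] (t₀ : M.Pt B) : Prop :=
  ∀ (R : Type u) [CommRing R] [Algebra K R] [Algebra Fq R] [IsScalarTower Fq K R] (t : M.Pt R),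
    ∃! f : B →ₐ[K] R, M.equiv (M.pull (f.restrictScalars Fq) t₀) t

/-- `Spec B` is a (nonempty) smooth affine curve over `K`. -/
def IsSmoothCurve (B : Type u) [CommRing B] [Algebra K B] : Prop :=
  Nontrivial B ∧ Algebra.Smooth K B ∧ ∀ p : PrimeSpectrum B, Module.rankAtStalk (Ω[B⁄K]) p = 1

/-- The moduli problem `M` is solved by a smooth affine curve over `K`. -/
def HasModuliCurve (M : ModuliProblem.{v, u} Fq) : Prop :=
  ∃ (B : Type u) (_ : CommRing B) (_ : Algebra K B) (_ : Algebra Fq B)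
    (_ : IsScalarTower Fq K B) (t₀ : M.Pt B), IsSmoothCurve K B ∧ Parametrizes K M B t₀

variable {K}

/-- The morphism `Spec B' → Spec B` given by `f` has degree `d`: it is finite locally free of
constant rank `d`.  (If `B` and `B'` are domains, this gives `[Frac B' : Frac B] = d`.) -/
def HasDegree {B B' : Type u} [CommRing B] [Algebra K B] [CommRing B'] [Algebra K B']
    (f : B →ₐ[K] B') (d : ℕ) : Prop :=
  letI : Algebra B B' := f.toRingHom.toAlgebra
  Module.Finite B B' ∧ Module.Projective B B' ∧
    ∀ p : PrimeSpectrum B, Module.rankAtStalk B' p = d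

/-- The morphism `Spec B' → Spec B` given by `f` is the one that is described on families by the
relation `cov` (between a family of `M'` and its image in `M`): it sends the universal family
`t₀'` over `B'` to the class of its image. -/
def IsInduced {M' M : ModuliProblem.{v, u} Fq}
    (cov : ∀ {R : Type u} [CommRing R] [Algebra Fq R], M'.Pt R → M.Pt R → Prop)
    {B B' : Type u} [CommRing B] [Algebra K B] [Algebra Fq B] [IsScalarTower Fq K B]
    [CommRing B'] [Algebra K B'] [Algebra Fq B'] [IsScalarTower Fq K B']
    (t₀ : M.Pt B) (t₀' : M'.Pt B') (f : B →ₐ[K] B') : Prop :=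
  ∃ t : M.Pt B', cov t₀' t ∧ M.equiv (M.pull (f.restrictScalars Fq) t₀) t

variable (K)

/-- The relation `cov` induces a morphism of degree `d` from the moduli curve of `M'` to that of
`M`: for every choice of the two curves and their universal families there is exactly one induced
morphism, and it has degree `d`. -/
def InducesDegree (M' M : ModuliProblem.{v, u} Fq)
    (cov : ∀ {R : Type u} [CommRing R] [Algebra Fq R], M'.Pt R → M.Pt R → Prop)
    (d : ℕ) : Prop :=
  ∀ (B B' : Type u) [CommRing B] [Algebra K B] [Algebra Fq B] [IsScalarTower Fq K B]
    [CommRing B'] [Algebra K B'] [Algebra Fq B'] [IsScalarTower Fq K B']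
    (t₀ : M.Pt B) (t₀' : M'.Pt B'), Parametrizes K M B t₀ → Parametrizes K M' B' t₀' →
    ∃ f : B →ₐ[K] B', IsInduced cov t₀ t₀' f ∧
      (∀ g : B →ₐ[K] B', IsInduced cov t₀ t₀' g → g = f) ∧ HasDegree f d

end Curves

end

/-! Read additive polynomials as twisted polynomials in τ. A cyclic G ≅ A/(T^(n+1)) is the kernel of
a monic P, its image φ_T G is the kernel of a monic P₀, and P = (τ - v) P₀ with v a unit. Since φ_T
carries ker P into ker P₀, there is a twisted polynomial H of degree m - 1 with H P = P₀ φ_T. A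
`Stage` is such a factorization over an arbitrary ring; its field `fibre` expresses that points of G
killed by T^n already lie in φ_T G, which makes G cyclic.

A prolongation G' of G with φ_T G' = G is the kernel of (τ - c) P, and it requires H' (τ - c) P = P
φ_T = (τ - v) H P, so τ - c must divide (τ - v) H on the right. With H(w) = w η(w^(q-1)), the
remainder of this division is η(c) (c η(c)^(q-1) - v). Zeros of the first factor give groups killed
by T^(n+1), which are not cyclic of the right order; the second factor is `Stage.extPoly`. Its
degree in c is 1 + (q-1)(1 + q + ⋯ + q^(m-2)) = q^(m-1), its leading coefficient is a unit
(`Stage.exists_monic_extPoly`), and it is separable because H(w) · extPoly(w^(q-1)) = H^q - v H has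
a unit constant as derivative (`Stage.isCoprime_extPoly`). Adjoining a root is thus étale and free
of rank q^(m-1); this is one storey of `Tower`.

The tower starts from a line Y^q - μ Y in Ker φ_T. Its presence determines g_j from g_m = γ and μ,
so the three problems have the base K[s, 1/s] in common, with (γ, μ) equal to (-1, s^(q-1)), (-1, s)
and (s, 1). In the last case the torsion point is scaled to 1.

Universality is checked locally for faithfully flat covers. After adjoining a zero y of P and
inverting φ_{T^n}(y), a level structure over T^(n+1) is generated by y and comes from a map out of
the tower; the map then descends (`Lawful.parametrizes`). Nilpotents do no harm: P divides a
polynomial with derivative 1, so it is determined by its geometric zeros (`eq_of_geometric`). -/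

noncomputable section

universe v u

/-! ### Powers of the Frobenius -/

section Frobenius

variable (Fq : Type v) [Field Fq] [Fintype Fq]

/-- The iterated Frobenius `z ↦ z ^ (q ^ i)`. -/
def frob (R : Type*) [CommRing R] [Algebra Fq R] (i : ℕ) : R →ₐ[Fq] R :=
  FiniteField.frobeniusAlgHom Fq R ^ i

lemma frob_apply {R : Type*} [CommRing R] [Algebra Fq R] (i : ℕ) (z : R) :
    frob Fq R i z = z ^ Fintype.card Fq ^ i := by
  rw [frob, AlgHom.coe_pow, FiniteField.coe_frobeniusAlgHom, pow_iterate]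

lemma add_pow_card_pow {R : Type*} [CommRing R] [Algebra Fq R] (i : ℕ) (a b : R) :
    (a + b) ^ Fintype.card Fq ^ i = a ^ Fintype.card Fq ^ i + b ^ Fintype.card Fq ^ i := by
  simpa [frob_apply] using map_add (frob Fq R i) a b

lemma sub_pow_card_pow {R : Type*} [CommRing R] [Algebra Fq R] (i : ℕ) (a b : R) :
    (a - b) ^ Fintype.card Fq ^ i = a ^ Fintype.card Fq ^ i - b ^ Fintype.card Fq ^ i := by
  simpa [frob_apply] using map_sub (frob Fq R i) a b

lemma add_pow_card {R : Type*} [CommRing R] [Algebra Fq R] (a b : R) :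
    (a + b) ^ Fintype.card Fq = a ^ Fintype.card Fq + b ^ Fintype.card Fq := by
  simpa using add_pow_card_pow Fq 1 a b

lemma sum_pow_card {R : Type*} [CommRing R] [Algebra Fq R] {ι : Type*} (s : Finset ι) (a : ι → R) :
    (∑ i ∈ s, a i) ^ Fintype.card Fq = ∑ i ∈ s, a i ^ Fintype.card Fq := by
  have h := map_sum (frob Fq R 1) a s
  simp only [frob_apply, pow_one] at h
  exact h

lemma pow_card_pow_of_pow_card {R : Type*} [CommRing R] {c : R} (hc : c ^ Fintype.card Fq = c)
    (i : ℕ) : c ^ Fintype.card Fq ^ i = c := by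
  induction i with
  | zero => simp
  | succ i ih => rw [pow_succ, pow_mul, ih, hc]

lemma card_cast_eq_zero (R : Type*) [CommRing R] [Algebra Fq R] :
    ((Fintype.card Fq : ℕ) : R) = 0 := by
  rw [← map_natCast (algebraMap Fq R), Nat.cast_card_eq_zero, map_zero]

/-- The sum `1 + q + ⋯ + q ^ (i - 1)`. -/
def geomExp (i : ℕ) : ℕ := ∑ l ∈ Finset.range i, Fintype.card Fq ^ l

@[simp] lemma geomExp_zero : geomExp Fq 0 = 0 := rfl

lemma geomExp_succ (i : ℕ) : geomExp Fq (i + 1) = geomExp Fq i + Fintype.card Fq ^ i :=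
  Finset.sum_range_succ _ _

lemma geomExp_succ' (i : ℕ) : geomExp Fq (i + 1) = Fintype.card Fq * geomExp Fq i + 1 := by
  simp [geomExp, Finset.sum_range_succ', Finset.mul_sum, pow_succ']

lemma card_sub_one_mul_geomExp (i : ℕ) :
    (Fintype.card Fq - 1) * geomExp Fq i + 1 = Fintype.card Fq ^ i := by
  obtain ⟨r, hr⟩ : ∃ r, Fintype.card Fq = r + 1 := ⟨_, (Nat.succ_pred Fintype.card_ne_zero).symm⟩
  induction i with
  | zero => simp
  | succ i ih =>
    rw [geomExp_succ, mul_add, add_right_comm, ih, hr, pow_succ]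
    simp; ring

/-- This is what turns an additive polynomial in z into z times a polynomial in z^(q-1), and it
explains the exponents `geomExp`. -/
lemma mul_pow_geomExp {R : Type*} [CommRing R] (z : R) (i : ℕ) :
    z * (z ^ (Fintype.card Fq - 1)) ^ geomExp Fq i = z ^ Fintype.card Fq ^ i := by
  rw [← pow_mul, ← pow_succ', card_sub_one_mul_geomExp]

lemma geomExp_strictMono : StrictMono (geomExp Fq) :=
  strictMono_nat_of_lt_succ fun i => by
    rw [geomExp_succ]; exact Nat.lt_add_of_pos_right (pow_pos Fintype.card_pos i)

lemma one_lt_card : 1 < Fintype.card Fq := Fintype.one_lt_card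

lemma mul_pow_card_sub_one {R : Type*} [CommRing R] (z : R) :
    z * z ^ (Fintype.card Fq - 1) = z ^ Fintype.card Fq := by
  rw [← pow_succ', Nat.sub_add_cancel Fintype.card_pos]

/-- Right division of the twisted polynomial `∑ d i τ ^ i` by `τ - v`. -/
lemma exists_right_quotient {R : Type u} [CommRing R] [Algebra Fq R] (v : R) (d : ℕ → R) (N : ℕ) :
    ∃ c : ℕ → R, c N = d (N + 1) ∧ ∀ (S : Type u) [CommRing S] [Algebra Fq S] (s : R →ₐ[Fq] S)
      (z : S), ∑ i ∈ Finset.range (N + 2), s (d i) * z ^ Fintype.card Fq ^ i =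
        (∑ i ∈ Finset.range (N + 1),
          s (c i) * (z ^ Fintype.card Fq - s v * z) ^ Fintype.card Fq ^ i) +
        s (∑ i ∈ Finset.range (N + 2), d i * v ^ geomExp Fq i) * z := by
  induction N generalizing d with
  | zero =>
    refine ⟨fun _ => d 1, rfl, fun S _ _ s z => ?_⟩
    simp [Finset.sum_range_succ, geomExp]
    ring
  | succ N ih =>
    -- From τ^(N+2) = τ^(N+1) (τ - v) + v^(q^(N+1)) τ^(N+1): the top term contributes d (N+2) to the
    -- quotient, and what is left is absorbed into the coefficient of index N+1.
    obtain ⟨c, -, h⟩ := ih (fun i => if i = N + 1 then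
      d i + d (N + 2) * v ^ Fintype.card Fq ^ (N + 1) else d i)
    refine ⟨fun i => if i = N + 1 then d (N + 2) else c i, by simp, fun S _ _ s z => ?_⟩
    have h' := h S s z
    have e : ∀ {T : Type u} [CommRing T] (g g' : ℕ → R) (F : R → ℕ → T),
        ∑ i ∈ Finset.range (N + 1), F (if i = N + 1 then g i else g' i) i =
          ∑ i ∈ Finset.range (N + 1), F (g' i) i := fun g g' F =>
      Finset.sum_congr rfl fun i hi => by rw [if_neg (Finset.mem_range.mp hi).ne]
    rw [Finset.sum_range_succ _ (N + 1), Finset.sum_range_succ (fun i => _ * v ^ _) (N + 1),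
      e _ _ (fun a i => s a * z ^ Fintype.card Fq ^ i),
      e _ _ (fun a i => a * v ^ geomExp Fq i)] at h'
    rw [Finset.sum_range_succ _ (N + 2), Finset.sum_range_succ _ (N + 1),
      Finset.sum_range_succ _ (N + 1), Finset.sum_range_succ (fun i => _ * v ^ _) (N + 2),
      Finset.sum_range_succ (fun i => _ * v ^ _) (N + 1),
      e (fun _ => d (N + 2)) c
        (fun a i => s a * (z ^ Fintype.card Fq - s v * z) ^ Fintype.card Fq ^ i)]
    simp only [if_true, map_add, map_mul, map_pow, map_sum] at h' ⊢
    rw [sub_pow_card_pow Fq, mul_pow, ← pow_mul, ← pow_succ', geomExp_succ Fq (N + 1), pow_add]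
    linear_combination h'

end Frobenius

/-! ### Geometric points -/

section Geometric

variable (Fq : Type v) [Field Fq] {R : Type u} [CommRing R] [Algebra Fq R]

/-- The algebraic closure of the residue field at a maximal ideal above I. All conditions imposed on
geometric points are converted into statements over the ring through this. -/
lemma exists_geometric_point (I : Ideal R) (hI : I ≠ ⊤) :
    ∃ (Ω : Type u) (_ : Field Ω) (_ : IsAlgClosed Ω) (_ : Algebra Fq Ω) (s : R →ₐ[Fq] Ω),
      ∀ r ∈ I, s r = 0 := by
  obtain ⟨M, hM, hIM⟩ := I.exists_le_maximal hI
  let _ : Field (R ⧸ M) := Ideal.Quotient.field M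
  refine ⟨AlgebraicClosure (R ⧸ M), inferInstance, inferInstance, inferInstance,
    (IsScalarTower.toAlgHom Fq (R ⧸ M) (AlgebraicClosure (R ⧸ M))).comp (Ideal.Quotient.mkₐ Fq M),
    fun r hr => ?_⟩
  have : Ideal.Quotient.mk M r = 0 := Ideal.Quotient.eq_zero_iff_mem.mpr (hIM hr)
  simp [this]

variable {Fq}

lemma algHom_eval₂ {S : Type*} [CommRing S] [Algebra Fq S] (s : R[X] →ₐ[Fq] S) (P : R[X]) :
    s P = P.eval₂ ((s.comp (CAlgHom (R := Fq) (A := R)) : R →ₐ[Fq] S) : R →+* S) (s X) := by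
  have : (s : R[X] →+* S) = eval₂RingHom
      ((s.comp (CAlgHom (R := Fq) (A := R)) : R →ₐ[Fq] S) : R →+* S) (s X) := by
    ext <;> simp
  exact congrArg (fun f : R[X] →+* S => f P) this

/-- Evaluation of polynomials as a homomorphism of `Fq`-algebras. -/
def evHom {S : Type*} [CommRing S] [Algebra Fq S] (s : R →ₐ[Fq] S) (z : S) : R[X] →ₐ[Fq] S where
  toRingHom := eval₂RingHom (s : R →+* S) z
  commutes' r := by
    change eval₂ _ _ _ = _
    rw [Polynomial.algebraMap_apply, eval₂_C]
    simp

@[simp] lemma evHom_apply {S : Type*} [CommRing S] [Algebra Fq S] (s : R →ₐ[Fq] S) (z : S)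
    (P : R[X]) : evHom s z P = P.eval₂ (s : R →+* S) z := rfl

lemma evHom_comp_C {S : Type*} [CommRing S] [Algebra Fq S] (s : R →ₐ[Fq] S) (z : S) :
    (evHom s z).comp (CAlgHom (R := Fq) (A := R)) = s := by
  ext r; simp

/-- If P and Q generated a proper ideal, some geometric point of R[X], that is, a geometric point s
of R with a value z for the variable, would kill both. -/
lemma isCoprime_of_geometric {P Q : R[X]}
    (h : ∀ (Ω : Type u) [Field Ω] [IsAlgClosed Ω] [Algebra Fq Ω] (s : R →ₐ[Fq] Ω) (z : Ω),
      P.eval₂ (s : R →+* Ω) z = 0 → Q.eval₂ (s : R →+* Ω) z ≠ 0) : IsCoprime P Q := by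
  rw [← Ideal.isCoprime_span_singleton_iff, Ideal.isCoprime_iff_sup_eq]
  by_contra hr
  obtain ⟨Ω, _, _, _, s, hs⟩ := exists_geometric_point Fq _ hr
  have hP := hs P (Ideal.mem_sup_left (Ideal.mem_span_singleton_self P))
  have hQ := hs Q (Ideal.mem_sup_right (Ideal.mem_span_singleton_self Q))
  rw [algHom_eval₂] at hP hQ
  exact h Ω _ _ hP hQ

lemma isCoprime_of_derivative_mul_eq_one {P Q : R[X]} (h : derivative (P * Q) = 1) :
    IsCoprime P Q := by
  rw [derivative_mul] at h
  exact ⟨derivative Q, derivative P, by linear_combination h⟩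

/-- Write F = Q Q₁. As F' = 1, Q and Q₁ have no common zero, so P, whose zeros are zeros of Q, is
coprime to Q₁ and must divide Q. No reducedness of R enters. -/
lemma dvd_of_geometric {F P Q : R[X]} (hF : derivative F = 1) (hP : P ∣ F) (hQ : Q ∣ F)
    (h : ∀ (Ω : Type u) [Field Ω] [IsAlgClosed Ω] [Algebra Fq Ω] (s : R →ₐ[Fq] Ω) (z : Ω),
      P.eval₂ (s : R →+* Ω) z = 0 → Q.eval₂ (s : R →+* Ω) z = 0) : P ∣ Q := by
  obtain ⟨Q₁, rfl⟩ := hQ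
  have hco := isCoprime_of_derivative_mul_eq_one hF
  have : IsCoprime P Q₁ := isCoprime_of_geometric (Fq := Fq) fun Ω _ _ _ s z hz h1 => by
    obtain ⟨a, b, hab⟩ := hco
    have := congrArg (eval₂ (s : R →+* Ω) z) hab
    simp [h Ω s z hz, h1, eval₂_add, eval₂_mul] at this
  exact this.dvd_of_dvd_mul_right hP

lemma eq_of_monic_of_dvd_dvd {P Q : R[X]} (hP : P.Monic) (hQ : Q.Monic) (h : P ∣ Q) (h' : Q ∣ P) :
    P = Q := by
  nontriviality R
  have hd : P.natDegree = Q.natDegree := by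
    obtain ⟨A, rfl⟩ := h
    obtain ⟨B, hB⟩ := h'
    have hA : A.Monic := hP.of_mul_monic_left hQ
    have hB' : B.Monic := hQ.of_mul_monic_left (hB ▸ hP)
    have := congrArg natDegree hB
    rw [hQ.natDegree_mul hB'] at this
    rw [hP.natDegree_mul hA] at this ⊢
    omega
  obtain ⟨A, rfl⟩ := h
  have hA : A.Monic := hP.of_mul_monic_left hQ
  rw [hP.natDegree_mul hA] at hd
  rw [hA.natDegree_eq_zero.mp (by omega), mul_one]

/-- Monic divisors of a separable polynomial are determined by their geometric zeros. -/
lemma eq_of_geometric {F P Q : R[X]} (hF : derivative F = 1) (hP : P ∣ F) (hQ : Q ∣ F)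
    (mP : P.Monic) (mQ : Q.Monic)
    (h : ∀ (Ω : Type u) [Field Ω] [IsAlgClosed Ω] [Algebra Fq Ω] (s : R →ₐ[Fq] Ω) (z : Ω),
      P.eval₂ (s : R →+* Ω) z = 0 ↔ Q.eval₂ (s : R →+* Ω) z = 0) : P = Q :=
  eq_of_monic_of_dvd_dvd mP mQ (dvd_of_geometric (Fq := Fq) hF hP hQ fun Ω _ _ _ s z => (h Ω s z).1)
    (dvd_of_geometric (Fq := Fq) hF hQ hP fun Ω _ _ _ s z => (h Ω s z).2)

end Geometric

/-! ### The polynomials of a Drinfeld module -/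

namespace DrinfeldModule

variable {Fq : Type v} [Field Fq] [Fintype Fq] {j k : ℕ}
variable {R : Type u} [CommRing R] [Algebra Fq R]
variable {S : Type u} [CommRing S] [Algebra Fq S]

lemma eval₂_poly (φ : DrinfeldModule Fq j k R) (a : Fq[X]) (s : R →ₐ[Fq] S) (z : S) :
    (φ.poly a).eval₂ (s : R →+* S) z = (φ.map s).act a z := by
  rw [← evHom_apply, poly, map_act, map_map, evHom_comp_C]
  simp

lemma eval_poly (φ : DrinfeldModule Fq j k R) (a : Fq[X]) (z : R) :
    (φ.poly a).eval z = φ.act a z := by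
  have := eval₂_poly φ a (AlgHom.id Fq R) z
  exact this

@[simp] lemma act_X (φ : DrinfeldModule Fq j k R) (z : R) : φ.act X z = φ.phiT z := by
  simp [act]

lemma act_mul (φ : DrinfeldModule Fq j k R) (a b : Fq[X]) (z : R) :
    φ.act (a * b) z = φ.act a (φ.act b z) := by
  rw [map_mul, Module.End.mul_apply]

lemma act_X_pow_succ (φ : DrinfeldModule Fq j k R) (n : ℕ) (z : R) :
    φ.act (X ^ (n + 1)) z = φ.act (X ^ n) (φ.phiT z) := by
  rw [pow_succ, act_mul, act_X]

lemma act_X_pow_succ' (φ : DrinfeldModule Fq j k R) (n : ℕ) (z : R) :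
    φ.act (X ^ (n + 1)) z = φ.phiT (φ.act (X ^ n) z) := by
  rw [pow_succ', act_mul, act_X]

@[simp] lemma act_one (φ : DrinfeldModule Fq j k R) (z : R) : φ.act 1 z = z := by
  simp [act]

lemma poly_X (φ : DrinfeldModule Fq j k R) :
    φ.poly X = C (φ.gm : R) * X ^ Fintype.card Fq ^ (j + k) +
      C φ.gj * X ^ Fintype.card Fq ^ j + X := by
  rw [poly, act_X, phiT_apply]
  simp [map]

lemma poly_X_pow_succ (φ : DrinfeldModule Fq j k R) (n : ℕ) :
    φ.poly (X ^ (n + 1)) = (φ.poly (X ^ n)).comp (φ.poly X) := by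
  have h := eval₂_poly φ (X ^ n) (CAlgHom (R := Fq) (A := R)) (φ.poly X)
  rw [poly, act_X_pow_succ, ← act_X, ← poly, ← h]
  rfl

lemma derivative_poly_X (φ : DrinfeldModule Fq j k R) (hj : 1 ≤ j) :
    derivative (φ.poly X) = 1 := by
  have h0 : (Fintype.card Fq : R[X]) = 0 := card_cast_eq_zero Fq R[X]
  rw [poly_X]
  simp [derivative_X_pow, h0, zero_pow (by omega : j ≠ 0), zero_pow (by omega : j + k ≠ 0)]

/-- The constant term of φ_T is 1 and q = 0 in R, so φ_{T^n} is separable over every base; this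
underlies all the étaleness and uniqueness statements. -/
lemma derivative_poly (φ : DrinfeldModule Fq j k R) (hj : 1 ≤ j) (n : ℕ) :
    derivative (φ.poly (X ^ n)) = 1 := by
  induction n with
  | zero => simp [poly]
  | succ n ih => rw [poly_X_pow_succ, derivative_comp, ih, derivative_poly_X φ hj]; simp

end DrinfeldModule

/-! ### Cyclic modules of the form `A / (X ^ N)` -/

section Cyclic

variable {F : Type*} [Field F] {M : Type*} [AddCommGroup M] [Module F[X] M] {n : ℕ}

/-- A representative p of y is prime to X, since otherwise X^n p would vanish modulo X^(n+1); a
Bézout relation then inverts p. -/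
lemma exists_smul_eq_of_equiv (e : M ≃ₗ[F[X]] (F[X] ⧸ Ideal.span {(X ^ (n + 1) : F[X])})) {y : M}
    (hy : (X ^ n : F[X]) • y ≠ 0) (z : M) : ∃ a : F[X], a • y = z := by
  obtain ⟨p, hp⟩ := Ideal.Quotient.mk_surjective (e y)
  obtain ⟨r, hr⟩ := Ideal.Quotient.mk_surjective (e z)
  have hco : IsCoprime p (X ^ (n + 1) : F[X]) := by
    refine IsCoprime.pow_right ?_
    rw [isCoprime_comm, (prime_X (R := F)).irreducible.coprime_iff_not_dvd]
    rintro ⟨p', rfl⟩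
    refine hy (e.injective ?_)
    rw [map_smul, ← hp, map_zero, ← Ideal.Quotient.mk_eq_mk, ← Submodule.Quotient.mk_smul,
      Submodule.Quotient.mk_eq_zero]
    exact Ideal.mem_span_singleton.mpr ⟨p', by simp only [smul_eq_mul]; ring⟩
  obtain ⟨a, b, hab⟩ := hco
  refine ⟨r * a, e.injective ?_⟩
  rw [map_smul, ← hp, ← hr, ← Ideal.Quotient.mk_eq_mk, ← Submodule.Quotient.mk_smul,
    ← Ideal.Quotient.mk_eq_mk, Submodule.Quotient.eq]
  refine Ideal.mem_span_singleton.mpr ⟨-(r * b), ?_⟩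
  simp only [smul_eq_mul]
  linear_combination r * hab

lemma exists_X_smul_eq_of_equiv (e : M ≃ₗ[F[X]] (F[X] ⧸ Ideal.span {(X ^ (n + 1) : F[X])})) {z : M}
    (hz : (X ^ n : F[X]) • z = 0) : ∃ w : M, (X : F[X]) • w = z := by
  obtain ⟨p, hp⟩ := Ideal.Quotient.mk_surjective (e z)
  have h := congrArg e hz
  rw [map_smul, ← hp, map_zero, ← Ideal.Quotient.mk_eq_mk, ← Submodule.Quotient.mk_smul,
    Submodule.Quotient.mk_eq_zero, Ideal.mem_span_singleton, smul_eq_mul, pow_succ,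
    mul_dvd_mul_iff_left (pow_ne_zero n X_ne_zero)] at h
  obtain ⟨p', rfl⟩ := h
  refine ⟨e.symm (Ideal.Quotient.mk _ p'), e.injective ?_⟩
  rw [map_smul, e.apply_symm_apply, ← hp]
  rfl

lemma exists_X_pow_smul_ne_zero_of_equiv
    (e : M ≃ₗ[F[X]] (F[X] ⧸ Ideal.span {(X ^ (n + 1) : F[X])})) :
    ∃ y : M, (X ^ n : F[X]) • y ≠ 0 := by
  refine ⟨e.symm (Ideal.Quotient.mk _ 1), fun h => ?_⟩
  have h := congrArg e h
  rw [map_smul, map_zero, e.apply_symm_apply, ← Ideal.Quotient.mk_eq_mk,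
    ← Submodule.Quotient.mk_smul, Submodule.Quotient.mk_eq_zero, Ideal.mem_span_singleton,
    smul_eq_mul, mul_one, pow_dvd_pow_iff X_ne_zero not_isUnit_X] at h
  omega

/-- The X-torsion of F[X]/(X^(n+1)) is the F-line spanned by X^n, so any nonzero element of it spans
it. -/
lemma exists_C_smul_eq_of_equiv (e : M ≃ₗ[F[X]] (F[X] ⧸ Ideal.span {(X ^ (n + 1) : F[X])}))
    {x x₀ : M} (hx : (X : F[X]) • x = 0) (hx₀ : (X : F[X]) • x₀ = 0) (h₀ : x₀ ≠ 0) :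
    ∃ c : F, (C c : F[X]) • x₀ = x := by
  have key : ∀ z : M, (X : F[X]) • z = 0 →
      ∃ c : F, z = (C c * X ^ n : F[X]) • e.symm (Ideal.Quotient.mk _ 1) := by
    intro z hz
    obtain ⟨p, hp⟩ := Ideal.Quotient.mk_surjective (e z)
    have h := congrArg e hz
    rw [map_smul, ← hp, map_zero, ← Ideal.Quotient.mk_eq_mk, ← Submodule.Quotient.mk_smul,
      Submodule.Quotient.mk_eq_zero, Ideal.mem_span_singleton, smul_eq_mul, pow_succ',
      mul_dvd_mul_iff_left X_ne_zero] at h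
    obtain ⟨p', rfl⟩ := h
    refine ⟨p'.coeff 0, e.injective ?_⟩
    rw [map_smul, e.apply_symm_apply, ← hp, ← Ideal.Quotient.mk_eq_mk, ← Ideal.Quotient.mk_eq_mk,
      ← Submodule.Quotient.mk_smul, Submodule.Quotient.eq, Ideal.mem_span_singleton]
    obtain ⟨r, hr⟩ := X_dvd_sub_C (p := p')
    refine ⟨r, ?_⟩
    simp only [smul_eq_mul, mul_one]
    linear_combination X ^ n * hr
  obtain ⟨c, rfl⟩ := key x hx
  obtain ⟨c₀, rfl⟩ := key x₀ hx₀
  have hc : c₀ ≠ 0 := by rintro rfl; simp at h₀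
  refine ⟨c / c₀, ?_⟩
  rw [smul_smul, ← mul_assoc, ← C_mul, div_mul_cancel₀ _ hc]

/-- The annihilator of y contains X^(n+1) but not X^n, hence is (X^(n+1)). So the quotient embeds in
M by a ↦ a y, and equality of cardinalities makes this a bijection. -/
lemma nonempty_equiv_of_card [Fintype F] {y : M} (hy : (X ^ n : F[X]) • y ≠ 0)
    (hy' : (X ^ (n + 1) : F[X]) • y = 0) (hM : Nat.card M = Fintype.card F ^ (n + 1)) :
    Nonempty (M ≃ₗ[F[X]] (F[X] ⧸ Ideal.span {(X ^ (n + 1) : F[X])})) := by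
  have hker : LinearMap.ker (LinearMap.toSpanSingleton F[X] M y) = Ideal.span {X ^ (n + 1)} := by
    refine le_antisymm ?_ ?_
    · obtain ⟨g, hg⟩ := IsPrincipalIdealRing.principal
        (LinearMap.ker (LinearMap.toSpanSingleton F[X] M y))
      have h1 : g ∣ X ^ (n + 1) := by
        rw [← Ideal.mem_span_singleton, Ideal.span, ← hg]
        simpa using hy'
      obtain ⟨i, hi, h2⟩ := (dvd_prime_pow prime_X _).mp h1
      rw [hg]
      change Ideal.span {g} ≤ _
      rw [Ideal.span_singleton_le_span_singleton]
      rcases Nat.lt_or_ge i (n + 1) with h | h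
      · exfalso
        have : (X ^ n : F[X]) ∈ LinearMap.ker (LinearMap.toSpanSingleton F[X] M y) := by
          rw [hg]
          exact Ideal.mem_span_singleton.mpr (h2.dvd.trans (pow_dvd_pow X (by omega)))
        exact hy (by simpa using this)
      · obtain rfl : i = n + 1 := by omega
        exact h2.symm.dvd
    · rw [Ideal.span_le, Set.singleton_subset_iff]
      simpa using hy'
  have hinj : Function.Injective
      ((Ideal.span {(X ^ (n + 1) : F[X])}).liftQ (LinearMap.toSpanSingleton F[X] M y) hker.ge) := by
    rw [← LinearMap.ker_eq_bot]
    exact Submodule.ker_liftQ_eq_bot _ _ _ hker.le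
  have : Finite M := Nat.finite_of_card_ne_zero (by
    rw [hM]; exact pow_ne_zero _ Fintype.card_ne_zero)
  have hcard : Nat.card (F[X] ⧸ Ideal.span {(X ^ (n + 1) : F[X])}) = Nat.card M := by
    have : Module.Finite F (F[X] ⧸ Ideal.span {(X ^ (n + 1) : F[X])}) :=
      (monic_X_pow (n + 1)).finite_quotient
    rw [hM, Module.natCard_eq_pow_finrank (K := F), finrank_quotient_span_eq_natDegree,
      natDegree_X_pow, Nat.card_eq_fintype_card]
  exact ⟨(LinearEquiv.ofBijective _ ⟨hinj, ((Nat.bijective_iff_injective_and_card _).mpr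
    ⟨hinj, hcard⟩).2⟩).symm⟩

end Cyclic

namespace DrinfeldModule

variable {Fq : Type v} [Field Fq] [Fintype Fq] {j k : ℕ}
variable {R : Type u} [CommRing R] [Algebra Fq R]
variable {S : Type u} [CommRing S] [Algebra Fq S]

/-! ### Level structures on geometric fibres -/

section Fibre

variable {Ω : Type u} [Field Ω] [IsAlgClosed Ω] [Algebra Fq Ω]

lemma smul_of (φ : DrinfeldModule Fq j k R) (a : Fq[X]) (z : R) :
    a • Module.AEval'.of φ.phiT z = Module.AEval'.of φ.phiT (φ.act a z) := rfl

/-- A geometric fibre of a level structure, as a submodule with the explicit action. -/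
lemma IsLevel.exists_act_eq_iff {φ : DrinfeldModule Fq j k R} {n : ℕ} {P : R[X]}
    (h : φ.IsLevel (X ^ (n + 1)) P) (s : R →ₐ[Fq] Ω) {y : Ω}
    (hy : P.eval₂ (s : R →+* Ω) y = 0) (hy' : (φ.map s).act (X ^ n) y ≠ 0) (z : Ω) :
    P.eval₂ (s : R →+* Ω) z = 0 ↔ ∃ a : Fq[X], (φ.map s).act a y = z := by
  obtain ⟨G, hG, ⟨e⟩⟩ := h.2.2 Ω s
  constructor
  · intro hz
    obtain ⟨a, ha⟩ := exists_smul_eq_of_equiv (F := Fq) (M := G) e (y := ⟨_, (hG y).2 hy⟩)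
      (fun h0 => hy' ((Module.AEval'.of (φ.map s).phiT).injective (by
        rw [map_zero, ← smul_of]; exact congrArg Subtype.val h0))) ⟨_, (hG z).2 hz⟩
    refine ⟨a, (Module.AEval'.of (φ.map s).phiT).injective ?_⟩
    rw [← smul_of]
    exact congrArg Subtype.val ha
  · rintro ⟨a, rfl⟩
    rw [← hG, ← smul_of]
    exact G.smul_mem a ((hG y).2 hy)

lemma IsLevel.exists_generator {φ : DrinfeldModule Fq j k R} {n : ℕ} {P : R[X]}
    (h : φ.IsLevel (X ^ (n + 1)) P) (s : R →ₐ[Fq] Ω) :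
    ∃ y : Ω, P.eval₂ (s : R →+* Ω) y = 0 ∧ (φ.map s).act (X ^ n) y ≠ 0 := by
  obtain ⟨G, hG, ⟨e⟩⟩ := h.2.2 Ω s
  obtain ⟨⟨y, hy⟩, hy'⟩ := exists_X_pow_smul_ne_zero_of_equiv (F := Fq) (M := G) e
  obtain ⟨y, rfl⟩ := (Module.AEval'.of (φ.map s).phiT).surjective y
  refine ⟨y, (hG y).1 hy, fun h0 => hy' (Subtype.ext ?_)⟩
  change (X ^ n : Fq[X]) • Module.AEval'.of (φ.map s).phiT y = 0
  rw [smul_of, h0, map_zero]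

lemma IsLevel.act_mem {φ : DrinfeldModule Fq j k R} {N : Fq[X]} {P : R[X]}
    (h : φ.IsLevel N P) (s : R →ₐ[Fq] Ω) {y : Ω}
    (hy : P.eval₂ (s : R →+* Ω) y = 0) (a : Fq[X]) :
    P.eval₂ (s : R →+* Ω) ((φ.map s).act a y) = 0 := by
  obtain ⟨G, hG, -⟩ := h.2.2 Ω s
  rw [← hG, ← smul_of]
  exact G.smul_mem a ((hG y).2 hy)

lemma IsLevel.exists_phiT_eq {φ : DrinfeldModule Fq j k R} {n : ℕ} {P : R[X]}
    (h : φ.IsLevel (X ^ (n + 1)) P) (s : R →ₐ[Fq] Ω) {z : Ω}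
    (hz : P.eval₂ (s : R →+* Ω) z = 0) (hz' : (φ.map s).act (X ^ n) z = 0) :
    ∃ w : Ω, P.eval₂ (s : R →+* Ω) w = 0 ∧ (φ.map s).phiT w = z := by
  obtain ⟨y, hy, hy'⟩ := h.exists_generator s
  obtain ⟨G, hG, ⟨e⟩⟩ := h.2.2 Ω s
  obtain ⟨⟨w, hw⟩, hw'⟩ := exists_X_smul_eq_of_equiv (F := Fq) (M := G) e
    (z := ⟨_, (hG z).2 hz⟩) (Subtype.ext (by
    change (X ^ n : Fq[X]) • Module.AEval'.of (φ.map s).phiT z = 0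
    rw [smul_of, hz', map_zero]))
  obtain ⟨w, rfl⟩ := (Module.AEval'.of (φ.map s).phiT).surjective w
  refine ⟨w, (hG w).1 hw, (Module.AEval'.of (φ.map s).phiT).injective ?_⟩
  rw [← act_X, ← smul_of]
  exact congrArg Subtype.val hw'

lemma IsLevel.exists_algebraMap_mul_eq {φ : DrinfeldModule Fq j k R} {n : ℕ} {P : R[X]}
    (h : φ.IsLevel (X ^ (n + 1)) P) (s : R →ₐ[Fq] Ω) {x x₀ : Ω}
    (hx : P.eval₂ (s : R →+* Ω) x = 0) (hx' : (φ.map s).phiT x = 0)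
    (hx₀ : P.eval₂ (s : R →+* Ω) x₀ = 0) (hx₀' : (φ.map s).phiT x₀ = 0) (h₀ : x₀ ≠ 0) :
    ∃ c : Fq, algebraMap Fq Ω c * x₀ = x := by
  obtain ⟨G, hG, ⟨e⟩⟩ := h.2.2 Ω s
  have key : ∀ (z : Ω) (hz : P.eval₂ (s : R →+* Ω) z = 0), (φ.map s).phiT z = 0 →
      (X : Fq[X]) • (⟨_, (hG z).2 hz⟩ : G) = 0 := fun z hz hz' => Subtype.ext (by
    change (X : Fq[X]) • Module.AEval'.of (φ.map s).phiT z = 0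
    rw [smul_of, act_X, hz', map_zero])
  obtain ⟨c, hc⟩ := exists_C_smul_eq_of_equiv (F := Fq) (M := G) e
    (key x hx hx') (key x₀ hx₀ hx₀') (fun h0 => h₀ (by
    have h1 := congrArg Subtype.val h0
    exact (Module.AEval'.of (φ.map s).phiT).injective (by rw [map_zero]; exact h1)))
  refine ⟨c, (Module.AEval'.of (φ.map s).phiT).injective ?_⟩
  have h1 : (C c : Fq[X]) • Module.AEval'.of (φ.map s).phiT x₀ =
    Module.AEval'.of (φ.map s).phiT x := congrArg Subtype.val hc
  rw [← h1, smul_of, act, aeval_C, Module.algebraMap_end_apply, Algebra.smul_def]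

end Fibre

/-! ### Explicit level structures -/

variable (Fq) in
/-- An explicit `T ^ (n + 1)`-level structure `P = (τ - v) P₀` of `φ` with image `P₀` under `φ_T`.
The coefficients `h` are those of the twisted polynomial `H` with `H P = P₀ φ_T`. -/
structure Stage (φ : DrinfeldModule Fq j k R) (n : ℕ) where
  v : Rˣ
  P₀ : R[X]
  P : R[X]
  h : ℕ → R
  isUnit_h : IsUnit (h (j + k - 1))
  monic₀ : P₀.Monic
  natDegree₀ : Nontrivial R → P₀.natDegree = Fintype.card Fq ^ n
  P_eq : P = P₀ ^ Fintype.card Fq - C (v : R) * P₀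
  add₀ : ∀ (S : Type u) [CommRing S] [Algebra Fq S] (s : R →ₐ[Fq] S) (z w : S),
    P₀.eval₂ (s : R →+* S) (z + w) = P₀.eval₂ (s : R →+* S) z + P₀.eval₂ (s : R →+* S) w
  mul₀ : ∀ (S : Type u) [CommRing S] [Algebra Fq S] (s : R →ₐ[Fq] S) (c z : S),
    c ^ Fintype.card Fq = c → P₀.eval₂ (s : R →+* S) (c * z) = c * P₀.eval₂ (s : R →+* S) z
  comp_eq : ∀ (S : Type u) [CommRing S] [Algebra Fq S] (s : R →ₐ[Fq] S) (z : S),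
    ∑ i ∈ Finset.range (j + k), s (h i) * (P.eval₂ (s : R →+* S) z) ^ Fintype.card Fq ^ i =
      P₀.eval₂ (s : R →+* S) ((φ.map s).phiT z)
  dvd₀ : P₀ ∣ φ.poly (X ^ n)
  fibre : ∀ (Ω : Type u) [Field Ω] [IsAlgClosed Ω] [Algebra Fq Ω] (s : R →ₐ[Fq] Ω) (z : Ω),
    P.eval₂ (s : R →+* Ω) z = 0 → (φ.map s).act (X ^ n) z = 0 → P₀.eval₂ (s : R →+* Ω) z = 0

namespace Stage

variable {φ : DrinfeldModule Fq j k R} {n : ℕ} (st : Stage Fq φ n)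
include st

lemma eval_P (s : R →ₐ[Fq] S) (z : S) : st.P.eval₂ (s : R →+* S) z =
    st.P₀.eval₂ (s : R →+* S) z ^ Fintype.card Fq - s st.v * st.P₀.eval₂ (s : R →+* S) z := by
  rw [st.P_eq, eval₂_sub, eval₂_pow, eval₂_mul, eval₂_C]; rfl

lemma add (s : R →ₐ[Fq] S) (z w : S) : st.P.eval₂ (s : R →+* S) (z + w) =
    st.P.eval₂ (s : R →+* S) z + st.P.eval₂ (s : R →+* S) w := by
  rw [eval_P, eval_P, eval_P, st.add₀, add_pow_card Fq]; ring

lemma mul (s : R →ₐ[Fq] S) (c z : S) (hc : c ^ Fintype.card Fq = c) :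
    st.P.eval₂ (s : R →+* S) (c * z) = c * st.P.eval₂ (s : R →+* S) z := by
  rw [eval_P, eval_P, st.mul₀ S s c z hc, mul_pow, hc]; ring

lemma zero₀ (s : R →ₐ[Fq] S) : st.P₀.eval₂ (s : R →+* S) 0 = 0 := by
  simpa using st.add₀ S s 0 0

lemma eval_P_eq_zero (s : R →ₐ[Fq] S) {z : S} (hz : st.P₀.eval₂ (s : R →+* S) z = 0) :
    st.P.eval₂ (s : R →+* S) z = 0 := by
  rw [eval_P, hz, mul_zero, sub_zero, zero_pow Fintype.card_ne_zero]

lemma eval_P₀_phiT (s : R →ₐ[Fq] S) {z : S} (hz : st.P.eval₂ (s : R →+* S) z = 0) :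
    st.P₀.eval₂ (s : R →+* S) ((φ.map s).phiT z) = 0 := by
  rw [← st.comp_eq, hz]
  exact Finset.sum_eq_zero fun i _ => by
    rw [zero_pow (pow_ne_zero _ Fintype.card_ne_zero), mul_zero]

lemma monic : st.P.Monic := by
  nontriviality R
  rw [st.P_eq]
  refine (st.monic₀.pow _).sub_of_left ?_
  rw [degree_eq_natDegree (st.monic₀.pow _).ne_zero, st.monic₀.natDegree_pow]
  refine lt_of_le_of_lt (degree_le_natDegree.trans (Nat.cast_le.mpr (natDegree_C_mul_le _ _))) ?_
  rw [Nat.cast_lt]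
  have h0 : 0 < st.P₀.natDegree := by rw [st.natDegree₀ ‹_›]; exact pow_pos Fintype.card_pos n
  nlinarith [one_lt_card Fq]

lemma natDegree [Nontrivial R] : st.P.natDegree = Fintype.card Fq ^ (n + 1) := by
  rw [st.P_eq, natDegree_sub_eq_left_of_natDegree_lt]
  · rw [st.monic₀.natDegree_pow, st.natDegree₀ ‹_›, pow_succ, mul_comm]
  · refine lt_of_le_of_lt (natDegree_C_mul_le _ _) ?_
    rw [st.monic₀.natDegree_pow]
    have h0 : 0 < st.P₀.natDegree := by rw [st.natDegree₀ ‹_›]; exact pow_pos Fintype.card_pos n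
    nlinarith [one_lt_card Fq]

lemma dvd_comp : st.P ∣ st.P₀.comp (φ.poly X) := by
  have h := st.comp_eq R[X] (CAlgHom (R := Fq) (A := R)) X
  have e : st.P₀.comp (φ.poly X) =
      st.P₀.eval₂ ((CAlgHom (R := Fq) (A := R) : R →ₐ[Fq] R[X]) : R →+* R[X])
        ((φ.map (CAlgHom (R := Fq) (A := R))).phiT X) := by
    rw [poly, act_X]; rfl
  rw [e, ← h]
  refine Finset.dvd_sum fun i _ => Dvd.dvd.mul_left ?_ _
  have : st.P.eval₂ ((CAlgHom (R := Fq) (A := R) : R →ₐ[Fq] R[X]) : R →+* R[X]) X = st.P :=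
    eval₂_C_X
  rw [this]
  exact dvd_pow_self _ (pow_ne_zero _ Fintype.card_ne_zero)

lemma dvd : st.P ∣ φ.poly (X ^ (n + 1)) := by
  rw [poly_X_pow_succ]
  exact st.dvd_comp.trans (map_dvd (compRingHom (φ.poly X)) st.dvd₀)

/-- Base change of explicit level structures. -/
def map (f : R →ₐ[Fq] S) : Stage Fq (φ.map f) n where
  v := Units.map (f : R →* S) st.v
  P₀ := st.P₀.map (f : R →+* S)
  P := st.P.map (f : R →+* S)
  h i := f (st.h i)
  isUnit_h := st.isUnit_h.map f
  monic₀ := st.monic₀.map _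
  natDegree₀ _ := by
    have : Nontrivial R := (f : R →+* S).domain_nontrivial
    rw [st.monic₀.natDegree_map, st.natDegree₀ this]
  P_eq := by rw [st.P_eq]; simp
  add₀ S' _ _ s z w := by
    simp only [eval₂_map]
    exact st.add₀ S' (s.comp f) z w
  mul₀ S' _ _ s c z := by
    simp only [eval₂_map]
    exact st.mul₀ S' (s.comp f) c z
  comp_eq S' _ _ s z := by
    rw [map_map]
    simp only [eval₂_map]
    exact st.comp_eq S' (s.comp f) z
  dvd₀ := by rw [← map_poly]; exact Polynomial.map_dvd _ st.dvd₀
  fibre Ω _ _ _ s z := by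
    rw [map_map]
    simp only [eval₂_map]
    exact st.fibre Ω (s.comp f) z

/-! The level structure of a stage. -/

section Fibre

variable {Ω : Type u} [Field Ω] [IsAlgClosed Ω] [Algebra Fq Ω]

-- A divisor of F is separable because F' = 1, so over an algebraically closed field it has as many
-- zeros as its degree.
omit st in
lemma card_roots {P F : R[X]} (s : R →ₐ[Fq] Ω) (hP : P.Monic) (hF : derivative F = 1)
    (h : P ∣ F) : Nat.card {z : Ω | P.eval₂ (s : R →+* Ω) z = 0} = P.natDegree := by
  classical
  have : Nontrivial R := (s : R →+* Ω).domain_nontrivial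
  have hm := hP.map (s : R →+* Ω)
  have hsep : (P.map (s : R →+* Ω)).Separable := by
    refine Separable.of_dvd ?_ (Polynomial.map_dvd (s : R →+* Ω) h)
    rw [Separable, derivative_map, hF, Polynomial.map_one]
    exact isCoprime_one_right
  have e : {z : Ω | P.eval₂ (s : R →+* Ω) z = 0} =
      ((P.map (s : R →+* Ω)).roots.toFinset : Set Ω) := by
    ext z
    simp [hm.ne_zero, eval_map]
  rw [e, Nat.card_coe_set_eq, Set.ncard_coe_finset, Multiset.toFinset_card_of_nodup
    (nodup_roots hsep), ← (IsAlgClosed.splits _).natDegree_eq_card_roots, hP.natDegree_map]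

/-- Otherwise `fibre` would place the q^(n+1) zeros of P among the q^n zeros of P₀. -/
lemma exists_act_ne_zero (hj : 1 ≤ j) (s : R →ₐ[Fq] Ω) :
    ∃ y : Ω, st.P.eval₂ (s : R →+* Ω) y = 0 ∧ (φ.map s).act (X ^ n) y ≠ 0 := by
  have : Nontrivial R := (s : R →+* Ω).domain_nontrivial
  by_contra! hcon
  have hsub : {z : Ω | st.P.eval₂ (s : R →+* Ω) z = 0} ⊆ {z | st.P₀.eval₂ (s : R →+* Ω) z = 0} :=
    fun z hz => st.fibre Ω s z hz (hcon z hz)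
  have h1 := card_roots s st.monic (derivative_poly φ hj (n + 1)) st.dvd
  have h2 := card_roots s st.monic₀ (derivative_poly φ hj n) st.dvd₀
  have hfin : Finite {z : Ω | st.P₀.eval₂ (s : R →+* Ω) z = 0} := by
    refine Nat.finite_of_card_ne_zero ?_
    rw [h2, st.natDegree₀ this]
    exact pow_ne_zero _ Fintype.card_ne_zero
  have h3 := Nat.card_mono hfin hsub
  rw [h1, h2, st.natDegree, st.natDegree₀ this] at h3
  exact absurd h3 (not_le.mpr (Nat.pow_lt_pow_right (one_lt_card Fq) (Nat.lt_succ_self n)))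

end Fibre

/-- The zeros of P form an Fq-space by additivity, and it is stable under φ_T because H P = P₀ φ_T
sends zeros of P to zeros of P₀, which are zeros of P. It has q^(n+1) elements, one of which is not
killed by T^n, so it is cyclic. -/
theorem isLevel (hj : 1 ≤ j) : φ.IsLevel (X ^ (n + 1)) st.P := by
  refine ⟨st.monic, st.dvd, fun Ω _ _ _ s => ?_⟩
  have : Nontrivial R := (s : R →+* Ω).domain_nontrivial
  let V : Submodule Fq Ω :=
    { carrier := {z | st.P.eval₂ (s : R →+* Ω) z = 0}
      add_mem' := fun {a b} ha hb => by
        rw [Set.mem_ofPred_eq] at *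
        rw [st.add, ha, hb, add_zero]
      zero_mem' := by simpa using st.add s 0 0
      smul_mem' := fun c z hz => by
        rw [Set.mem_ofPred_eq] at *
        rw [Algebra.smul_def, st.mul s _ _ (by rw [← map_pow, FiniteField.pow_card]), hz, mul_zero] }
  have hV : ∀ z ∈ V, (φ.map s).phiT z ∈ V := fun z hz =>
    st.eval_P_eq_zero s (st.eval_P₀_phiT s hz)
  have hA : ∀ (a : Fq[X]), ∀ z ∈ V, (φ.map s).act a z ∈ V := by
    intro a
    induction a using Polynomial.induction_on with
    | C c => intro z hz; simpa [act] using V.smul_mem c hz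
    | add p r hp hr => intro z hz; simpa using V.add_mem (hp z hz) (hr z hz)
    | monomial i c h =>
      intro z hz
      rw [pow_succ, ← mul_assoc, act_mul, act_X]
      exact h _ (hV z hz)
  let G : Submodule Fq[X] (φ.map s).AMod :=
    { carrier := {z | (Module.AEval'.of (φ.map s).phiT).symm z ∈ V}
      add_mem' := fun ha hb => V.add_mem ha hb
      zero_mem' := V.zero_mem
      smul_mem' := fun a z hz => hA a _ hz }
  have hG : ∀ z : Ω, Module.AEval'.of (φ.map s).phiT z ∈ G ↔ st.P.eval₂ (s : R →+* Ω) z = 0 :=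
    fun z => Iff.rfl
  refine ⟨G, hG, ?_⟩
  obtain ⟨y, hy, hy'⟩ := st.exists_act_ne_zero hj s
  refine nonempty_equiv_of_card (F := Fq) (M := G) (y := ⟨_, (hG y).2 hy⟩) ?_ ?_ ?_
  · intro h0
    have h1 := congrArg Subtype.val h0
    exact hy' ((Module.AEval'.of (φ.map s).phiT).injective (by
      rw [map_zero, ← smul_of]; exact h1))
  · refine Subtype.ext ?_
    change (X ^ (n + 1) : Fq[X]) • Module.AEval'.of (φ.map s).phiT y = 0
    rw [smul_of, ← eval₂_poly]
    obtain ⟨Q, hQ⟩ := st.dvd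
    rw [hQ, eval₂_mul, hy, zero_mul, map_zero]
  · rw [← st.natDegree, ← card_roots s st.monic (derivative_poly φ hj (n + 1)) st.dvd]
    exact Nat.card_congr ((Module.AEval'.of (φ.map s).phiT).symm.toEquiv.subtypeEquiv
      fun z => Iff.rfl)

/-- A zero of P₀ is a zero of P killed by T^n, and in A/(T^(n+1)) such elements are divisible by T.
The other inclusion is H P = P₀ φ_T. -/
theorem isImage (hj : 1 ≤ j) : φ.IsImage st.P st.P₀ := by
  intro Ω _ _ _ s z
  constructor
  · intro hz
    refine (st.isLevel hj).exists_phiT_eq s (st.eval_P_eq_zero s hz) ?_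
    rw [← eval₂_poly]
    obtain ⟨Q, hQ⟩ := st.dvd₀
    rw [hQ, eval₂_mul, hz, zero_mul]
  · rintro ⟨w, hw, rfl⟩
    exact st.eval_P₀_phiT s hw

end Stage

end DrinfeldModule

/-! ### Right division by τ - c, lines in the T-torsion, and prolongation of stages -/

namespace DrinfeldModule

variable {Fq : Type v} [Field Fq] [Fintype Fq] {j k : ℕ}
variable {R : Type u} [CommRing R] [Algebra Fq R]
variable {S : Type u} [CommRing S] [Algebra Fq S]

/-- The coefficients of the twisted polynomial `φ_T`. -/
def coeffT (φ : DrinfeldModule Fq j k R) (i : ℕ) : R :=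
  (if i = 0 then 1 else 0) + (if i = j then φ.gj else 0) + (if i = j + k then (φ.gm : R) else 0)

lemma sum_coeffT (φ : DrinfeldModule Fq j k R) (e : ℕ → R) :
    ∑ i ∈ Finset.range (j + k + 1), φ.coeffT i * e i = e 0 + φ.gj * e j + φ.gm * e (j + k) := by
  simp [coeffT, add_mul, Finset.sum_add_distrib, Finset.sum_ite_eq',
    (by omega : j < j + k + 1)]

lemma coeffT_map (φ : DrinfeldModule Fq j k R) (s : R →ₐ[Fq] S) (i : ℕ) :
    (φ.map s).coeffT i = s (φ.coeffT i) := by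
  simp [coeffT, map, apply_ite s]

/-- The value at `u = w ^ (q - 1)` of `φ_T (w) / w`. -/
def lineValue (φ : DrinfeldModule Fq j k R) (u : R) : R :=
  φ.gm * u ^ geomExp Fq (j + k) + φ.gj * u ^ geomExp Fq j + 1

lemma mul_lineValue (φ : DrinfeldModule Fq j k R) (w : R) :
    w * φ.lineValue (w ^ (Fintype.card Fq - 1)) = φ.phiT w := by
  rw [lineValue, phiT_apply, ← mul_pow_geomExp Fq w j, ← mul_pow_geomExp Fq w (j + k)]
  ring

/-- Right division of φ_T by τ - u, with remainder `lineValue u`; the quotient is the twisted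
polynomial H of the first stage. -/
lemma exists_phiT_eq_sum (φ : DrinfeldModule Fq j k R) (hj : 1 ≤ j) (hk : 1 ≤ k) (u : R) :
    ∃ c : ℕ → R, c (j + k - 1) = φ.gm ∧ ∀ (S : Type u) [CommRing S] [Algebra Fq S]
      (s : R →ₐ[Fq] S) (z : S), (φ.map s).phiT z = (∑ i ∈ Finset.range (j + k),
          s (c i) * (z ^ Fintype.card Fq - s u * z) ^ Fintype.card Fq ^ i) +
        s (φ.lineValue u) * z := by
  obtain ⟨c, hc, h⟩ := exists_right_quotient Fq u φ.coeffT (j + k - 1)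
  rw [(by omega : j + k - 1 + 2 = j + k + 1), (by omega : j + k - 1 + 1 = j + k)] at h
  refine ⟨c, ?_, fun S _ _ s z => ?_⟩
  · rw [hc, (by omega : j + k - 1 + 1 = j + k), coeffT, if_neg (by omega), if_neg (by omega),
      if_pos rfl, zero_add, zero_add]
  · have h' := h S s z
    have e : ∀ i, s (φ.coeffT i) = (φ.map s).coeffT i := fun i => (coeffT_map φ s i).symm
    simp only [e] at h'
    rw [sum_coeffT, sum_coeffT] at h'
    rw [pow_zero, pow_one, geomExp_zero, pow_zero] at h'
    rw [phiT_apply, lineValue, add_comm _ (1 : R), add_comm (φ.gm * u ^ _ : R), ← add_assoc]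
    linear_combination h'

/-- A nowhere vanishing element of `Ker φ_T` spans a line `Y ^ q - u Y` in `Ker φ_T`. -/
lemma lineValue_eq_zero (φ : DrinfeldModule Fq j k R) {x : R} (hx : IsUnit x)
    (h : φ.phiT x = 0) : φ.lineValue (x ^ (Fintype.card Fq - 1)) = 0 := by
  rw [← mul_lineValue] at h
  exact hx.mul_right_eq_zero.mp h

lemma map_lineValue (φ : DrinfeldModule Fq j k R) (s : R →ₐ[Fq] S) (u : R) :
    (φ.map s).lineValue (s u) = s (φ.lineValue u) := by
  simp [lineValue, map]

namespace Stage

/-- The first stage: the line `Y ^ q - u Y` in `Ker φ_T`. -/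
theorem exists_line (φ : DrinfeldModule Fq j k R) (hj : 1 ≤ j) (hk : 1 ≤ k) (u : Rˣ)
    (hu : φ.lineValue (u : R) = 0) :
    ∃ st : Stage Fq φ 0, st.P = X ^ Fintype.card Fq - C (u : R) * X := by
  obtain ⟨c, hc, h⟩ := exists_phiT_eq_sum φ hj hk (u : R)
  refine ⟨{ v := u, P₀ := X, P := _, h := c, isUnit_h := by rw [hc]; exact φ.gm.isUnit,
            monic₀ := monic_X, natDegree₀ := fun _ => by simp, P_eq := rfl,
            add₀ := by simp, mul₀ := by simp
            comp_eq := fun S _ _ s z => ?_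
            dvd₀ := by simp [poly]
            fibre := fun Ω _ _ _ s z _ h => by simpa using h }, rfl⟩
  rw [eval₂_X, h S s z, hu]
  simp

variable {φ : DrinfeldModule Fq j k R} {n : ℕ} (st : Stage Fq φ n)

/-- The polynomial `η` with `w η(w ^ (q - 1)) = H(w)`. -/
def eta : R[X] := ∑ i ∈ Finset.range (j + k), C (st.h i) * X ^ geomExp Fq i

/-- The equation for the coordinates of the cyclic extensions of a level structure. -/
def extPoly : R[X] := X * st.eta ^ (Fintype.card Fq - 1) - C (st.v : R)

lemma mul_eval_eta (s : R →ₐ[Fq] S) (w : S) :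
    w * st.eta.eval₂ (s : R →+* S) (w ^ (Fintype.card Fq - 1)) =
      ∑ i ∈ Finset.range (j + k), s (st.h i) * w ^ Fintype.card Fq ^ i := by
  rw [eta, eval₂_finsetSum, Finset.mul_sum]
  refine Finset.sum_congr rfl fun i _ => ?_
  rw [eval₂_mul, eval₂_C, eval₂_pow, eval₂_X, ← mul_pow_geomExp Fq w i]
  change w * (s (st.h i) * _) = _
  ring

lemma eval_extPoly (s : R →ₐ[Fq] S) (c : S) : st.extPoly.eval₂ (s : R →+* S) c =
    c * st.eta.eval₂ (s : R →+* S) c ^ (Fintype.card Fq - 1) - s st.v := by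
  rw [extPoly, eval₂_sub, eval₂_mul, eval₂_pow, eval₂_X, eval₂_C]; rfl

lemma eval_extPoly_pow (s : R →ₐ[Fq] S) (w : S) :
    st.extPoly.eval₂ (s : R →+* S) (w ^ (Fintype.card Fq - 1)) =
      (∑ i ∈ Finset.range (j + k), s (st.h i) * w ^ Fintype.card Fq ^ i) ^ (Fintype.card Fq - 1) -
        s st.v := by
  rw [eval_extPoly, ← mul_eval_eta, mul_pow]

/-- The left side carries the coefficients of (τ - v) H: since τ h = h^q τ, multiplication by τ
raises the coefficients to the power q and shifts them by one. -/
lemma sum_shift (h : ℕ → R) (v : R) (m : ℕ) (e : ℕ → R) :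
    ∑ i ∈ Finset.range (m + 1), ((if i = 0 then 0 else h (i - 1) ^ Fintype.card Fq) -
        (if i = m then 0 else v * h i)) * e i =
      (∑ i ∈ Finset.range m, h i ^ Fintype.card Fq * e (i + 1)) -
        v * ∑ i ∈ Finset.range m, h i * e i := by
  simp only [sub_mul, Finset.sum_sub_distrib]
  congr 1
  · rw [Finset.sum_range_succ']; simp
  · rw [Finset.sum_range_succ, Finset.mul_sum]
    simp only [if_true, zero_mul, add_zero]
    exact Finset.sum_congr rfl fun i hi => by rw [if_neg (Finset.mem_range.mp hi).ne, mul_assoc]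

/-- A root of `st.extPoly` gives a cyclic extension of the level structure. -/
theorem exists_next (hj : 1 ≤ j) (c : R) (hc : st.extPoly.eval c = 0) :
    ∃ st' : Stage Fq φ (n + 1), st'.P₀ = st.P ∧ (st'.v : R) = c := by
  have hc' : c * st.eta.eval c ^ (Fintype.card Fq - 1) = st.v := by
    have := st.eval_extPoly (AlgHom.id Fq R) c
    exact (sub_eq_zero.mp (this.symm.trans hc))
  have hu : IsUnit c := isUnit_of_mul_isUnit_left (hc'.symm ▸ st.v.isUnit)
  -- The coefficients of (τ - v) H, of degree j + k, to be divided on the right by τ - c.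
  set d : ℕ → R := fun i => (if i = 0 then 0 else st.h (i - 1) ^ Fintype.card Fq) -
        (if i = j + k then 0 else (st.v : R) * st.h i) with hd
  obtain ⟨h, hh, hq⟩ := exists_right_quotient Fq c d (j + k - 1)
  rw [(by omega : j + k - 1 + 2 = j + k + 1), (by omega : j + k - 1 + 1 = j + k)] at hq
  -- The remainder is c η(c)^q - v η(c), which vanishes because v = c η(c)^(q-1).
  have hrem : ∑ i ∈ Finset.range (j + k + 1), d i * c ^ geomExp Fq i = 0 := by
    rw [hd, sum_shift]
    have h1 : ∑ i ∈ Finset.range (j + k), st.h i * c ^ geomExp Fq i = st.eta.eval c := by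
      simp [eta, eval_finsetSum]
    have h2 : ∑ i ∈ Finset.range (j + k), st.h i ^ Fintype.card Fq * c ^ geomExp Fq (i + 1) =
        c * st.eta.eval c ^ Fintype.card Fq := by
      rw [← h1, sum_pow_card Fq, Finset.mul_sum]
      exact Finset.sum_congr rfl fun i _ => by rw [geomExp_succ', mul_pow, ← pow_mul]; ring
    rw [h1, h2, ← hc', ← mul_pow_card_sub_one Fq]
    ring
  have hS : ∀ (S : Type u) [CommRing S] [Algebra Fq S] (s : R →ₐ[Fq] S) (w : S),
      ∑ i ∈ Finset.range (j + k),
          s (h i) * (w ^ Fintype.card Fq - s c * w) ^ Fintype.card Fq ^ i =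
        (∑ i ∈ Finset.range (j + k), s (st.h i) * w ^ Fintype.card Fq ^ i) ^ Fintype.card Fq -
          s st.v * ∑ i ∈ Finset.range (j + k), s (st.h i) * w ^ Fintype.card Fq ^ i := by
    intro S _ _ s w
    have := hq S s w
    rw [hrem, map_zero, zero_mul, add_zero] at this
    rw [← this, sum_pow_card Fq]
    have e : ∀ i, s (d i) = (if i = 0 then 0 else s (st.h (i - 1)) ^ Fintype.card Fq) -
        (if i = j + k then 0 else s (st.v : R) * s (st.h i)) := fun i => by
      simp [hd, apply_ite s]
    simp only [e]
    rw [sum_shift (fun i => s (st.h i)) (s st.v) (j + k) (fun i => w ^ Fintype.card Fq ^ i)]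
    congr 1
    exact Finset.sum_congr rfl fun i _ => by rw [mul_pow, ← pow_mul, pow_succ]
  have hP : ∀ (S : Type u) [CommRing S] [Algebra Fq S] (s : R →ₐ[Fq] S) (z : S),
      (st.P ^ Fintype.card Fq - C c * st.P).eval₂ (s : R →+* S) z =
        st.P.eval₂ (s : R →+* S) z ^ Fintype.card Fq - s c * st.P.eval₂ (s : R →+* S) z := by
    intro S _ _ s z
    rw [eval₂_sub, eval₂_pow, eval₂_mul, eval₂_C]; rfl
  have hcomp : ∀ (S : Type u) [CommRing S] [Algebra Fq S] (s : R →ₐ[Fq] S) (z : S),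
      ∑ i ∈ Finset.range (j + k), s (h i) * ((st.P ^ Fintype.card Fq - C c * st.P).eval₂
        (s : R →+* S) z) ^ Fintype.card Fq ^ i = st.P.eval₂ (s : R →+* S) ((φ.map s).phiT z) := by
    intro S _ _ s z
    rw [hP, hS, st.comp_eq, ← st.eval_P]
  refine ⟨{ v := hu.unit, P₀ := st.P, P := _, h := h,
            isUnit_h := ?_, monic₀ := st.monic, natDegree₀ := fun _ => st.natDegree,
            P_eq := rfl, add₀ := fun S _ _ s => st.add s, mul₀ := fun S _ _ s => st.mul s
            comp_eq := hcomp, dvd₀ := st.dvd, fibre := fun Ω _ _ _ s z hz hz' => ?_ }, rfl, rfl⟩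
  -- The leading coefficient of the new H is that of τ H, namely the q-th power of the old one.
  · rw [hh, hd]
    simp only [(by omega : j + k - 1 + 1 = j + k), if_true, sub_zero]
    rw [if_neg (by omega)]
    exact st.isUnit_h.pow _
  -- Put w = P(z) ≠ 0, so that w^(q-1) = c. By the previous stage H(w) = P₀(φ_T z) = 0, hence
  -- extPoly(c) = H(w)^(q-1) - v = -v, which is not zero.
  · by_contra hw
    rw [IsUnit.unit_spec] at hz
    have h1 : st.P.eval₂ (s : R →+* Ω) ((φ.map s).phiT z) = 0 := by
      rw [← hcomp, hz]
      exact Finset.sum_eq_zero fun i _ => by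
        rw [zero_pow (pow_ne_zero _ Fintype.card_ne_zero), mul_zero]
    rw [act_X_pow_succ] at hz'
    have h2 := st.fibre Ω s _ h1 hz'
    rw [hP, ← mul_pow_card_sub_one Fq, mul_comm (s c), ← mul_sub, mul_eq_zero,
      or_iff_right hw, sub_eq_zero] at hz
    have h3 := st.eval_extPoly_pow s (st.P.eval₂ (s : R →+* Ω) z)
    rw [st.comp_eq, h2, zero_pow (by have := one_lt_card Fq; omega), hz] at h3
    have h4 : st.extPoly.eval₂ (s : R →+* Ω) (s c) = s (st.extPoly.eval c) :=
      Polynomial.eval₂_at_apply (s : R →+* Ω) c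
    rw [h4, hc, map_zero, zero_sub, eq_comm, neg_eq_zero] at h3
    exact (st.v.isUnit.map s).ne_zero h3

end Stage

end DrinfeldModule

/-! ### Free algebras of finite rank and étale extensions by a root -/

/-- The ring `B` is free of rank `d` over `A` through `f`. -/
def IsFreeOfRank {A B : Type*} [CommRing A] [CommRing B] (f : A →+* B) (d : ℕ) : Prop :=
  ∃ e : Fin d → B, ∀ x : B, ∃! c : Fin d → A, x = ∑ i, f (c i) * e i

lemma IsFreeOfRank.nontrivial {A B : Type*} [CommRing A] [CommRing B] {f : A →+* B} {d : ℕ}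
    (h : IsFreeOfRank f d) (hd : 0 < d) [Nontrivial A] : Nontrivial B := by
  by_contra hB
  rw [not_nontrivial_iff_subsingleton] at hB
  obtain ⟨e, he⟩ := h
  have := (he 0).unique (y₁ := fun _ => 0) (y₂ := fun _ => 1) (Subsingleton.elim _ _)
    (Subsingleton.elim _ _)
  exact zero_ne_one (congrFun this ⟨0, hd⟩)

lemma IsFreeOfRank.equiv {A B A' B' : Type*} [CommRing A] [CommRing B] [CommRing A'] [CommRing B']
    {f : A →+* B} {d : ℕ} (h : IsFreeOfRank f d) (e : A ≃+* A') (e' : B ≃+* B') {f' : A' →+* B'}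
    (hf : ∀ a, f' (e a) = e' (f a)) : IsFreeOfRank f' d := by
  obtain ⟨b, hb⟩ := h
  refine ⟨fun i => e' (b i), fun x => ?_⟩
  obtain ⟨c, hc, hc'⟩ := hb (e'.symm x)
  have key : ∀ c : Fin d → A, x = ∑ i, f' (e (c i)) * e' (b i) ↔
      e'.symm x = ∑ i, f (c i) * b i := by
    intro c
    rw [RingEquiv.symm_apply_eq, map_sum]
    simp only [hf, map_mul]
  refine ⟨fun i => e (c i), (key c).2 hc, fun c₁ hc₁ => ?_⟩
  have := hc' (fun i => e.symm (c₁ i)) ((key _).1 (by simpa using hc₁))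
  funext i
  rw [← this, e.apply_symm_apply]

lemma IsFreeOfRank.hasDegree {K : Type u} [Field K] {A B : Type u} [CommRing A] [Algebra K A]
    [CommRing B] [Algebra K B] {f : A →ₐ[K] B} {d : ℕ} (h : IsFreeOfRank (f : A →+* B) d) :
    HasDegree f d := by
  obtain ⟨e, he⟩ := h
  let _ : Algebra A B := f.toRingHom.toAlgebra
  have hs : ∀ (a : A) (b : B), a • b = f a * b := fun a b => rfl
  let L : (Fin d → A) →ₗ[A] B := Fintype.linearCombination A e
  have hL : ∀ c, L c = ∑ i, f (c i) * e i := fun c => by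
    simp [L, Fintype.linearCombination_apply, hs]
  have hbij : Function.Bijective L := by
    rw [Function.bijective_iff_existsUnique]
    intro x
    obtain ⟨c, hc, hc'⟩ := he x
    exact ⟨c, (hL c).trans hc.symm, fun c₁ h₁ => hc' c₁ (h₁.symm.trans (hL c₁))⟩
  let E := LinearEquiv.ofBijective L hbij
  have hfree : Module.Free A B := Module.Free.of_equiv E
  have hfin : Module.Finite A B := Module.Finite.equiv E
  refine ⟨hfin, inferInstance, fun p => ?_⟩
  have : Nontrivial A := p.nontrivial
  rw [Module.rankAtStalk_eq_finrank_of_free]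
  simp [← E.finrank_eq]

lemma isFreeOfRank_adjoinRoot {A : Type*} [CommRing A] [Nontrivial A] {g : A[X]} (hg : g.Monic) :
    IsFreeOfRank (AdjoinRoot.of g) g.natDegree := by
  refine ⟨(AdjoinRoot.powerBasis' hg).basis, fun x => ?_⟩
  refine ⟨(AdjoinRoot.powerBasis' hg).basis.repr x, ?_, fun c hc => ?_⟩
  · have := (AdjoinRoot.powerBasis' hg).basis.sum_repr x
    simp only [Algebra.smul_def] at this
    exact this.symm
  · have : x = ∑ i, c i • (AdjoinRoot.powerBasis' hg).basis i := by
      simp only [Algebra.smul_def]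
      exact hc
    rw [this]
    exact ((AdjoinRoot.powerBasis' hg).basis.repr_sum_self c).symm

lemma etale_adjoinRoot {A : Type u} [CommRing A] {g : A[X]} (hg : g.Monic)
    (h : IsCoprime g (derivative g)) : Algebra.Etale A (AdjoinRoot g) := by
  obtain ⟨a, b, hab⟩ := h
  -- The polynomial to be inverted is taken to be 1, so the standard étale algebra is `AdjoinRoot g`
  -- itself.
  let P : StandardEtalePair A := ⟨g, hg, 1, b, a, 0, by rw [pow_zero, ← hab]; ring⟩
  have hu : IsUnit (AdjoinRoot.mk g (1 : A[X])) := by rw [map_one]; exact isUnit_one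
  let e := (IsLocalization.atUnit (AdjoinRoot g) (Localization.Away (AdjoinRoot.mk g (1 : A[X])))
    _ hu).restrictScalars A
  exact .of_equiv (P.equivAwayAdjoinRoot.trans e.symm)

/-! ### Uniqueness of images, and separability and degree of the prolongation equation -/

namespace DrinfeldModule

variable {Fq : Type v} [Field Fq] [Fintype Fq] {j k : ℕ}
variable {R : Type u} [CommRing R] [Algebra Fq R]
variable {S : Type u} [CommRing S] [Algebra Fq S]

lemma IsImage.unique {φ : DrinfeldModule Fq j k R} (hj : 1 ≤ j) {n : ℕ} {P Q Q' : R[X]}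
    (hQ : Q.Monic) (hQ' : Q'.Monic) (dQ : Q ∣ φ.poly (X ^ n)) (dQ' : Q' ∣ φ.poly (X ^ n))
    (h : φ.IsImage P Q) (h' : φ.IsImage P Q') : Q = Q' :=
  eq_of_geometric (Fq := Fq) (derivative_poly φ hj n) dQ dQ' hQ hQ' fun Ω _ _ _ s z =>
    (h Ω s z).trans (h' Ω s z).symm

lemma IsImage.map {φ : DrinfeldModule Fq j k R} {P Q : R[X]} (h : φ.IsImage P Q)
    (f : R →ₐ[Fq] S) : (φ.map f).IsImage (P.map (f : R →+* S)) (Q.map (f : R →+* S)) := by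
  intro Ω _ _ _ s z
  rw [map_map]
  simp only [eval₂_map]
  exact h Ω (s.comp f) z

namespace Stage

lemma derivative_sum (h : ℕ → R) (m : ℕ) (Q : R[X]) :
    derivative (∑ i ∈ Finset.range (m + 1), C (h i) * Q ^ Fintype.card Fq ^ i) =
      C (h 0) * derivative Q := by
  have h0 : (Fintype.card Fq : R[X]) = 0 := card_cast_eq_zero Fq R[X]
  rw [Finset.sum_range_succ', derivative_add, Polynomial.derivative_sum,
    Finset.sum_eq_zero, zero_add]
  · simp
  · intro i _
    rw [derivative_C_mul, derivative_pow]
    simp [h0]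

variable {φ : DrinfeldModule Fq j k R} {n : ℕ} (st : Stage Fq φ n)
include st

/-- Differentiating H(P) = P₀(φ_T) at 0 gives h₀ P'(0) = P₀'(0). The right side is a unit, because
P₀(0) = 0 and P₀ divides φ_{T^n}, whose derivative is 1. -/
lemma isUnit_h_zero (hj : 1 ≤ j) : IsUnit (st.h 0) := by
  have e := st.comp_eq R[X] (CAlgHom (R := Fq) (A := R)) X
  have e1 : st.P₀.comp (φ.poly X) =
      st.P₀.eval₂ ((CAlgHom (R := Fq) (A := R) : R →ₐ[Fq] R[X]) : R →+* R[X])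
        ((φ.map (CAlgHom (R := Fq) (A := R))).phiT X) := by
    rw [poly, act_X]; rfl
  have e2 : st.P.eval₂ ((CAlgHom (R := Fq) (A := R) : R →ₐ[Fq] R[X]) : R →+* R[X]) X = st.P :=
    eval₂_C_X
  rw [← e1, e2] at e
  have h := congrArg (fun p => eval 0 (derivative p)) e
  simp only [CAlgHom_apply] at h
  rw [(by omega : j + k = (j + k - 1) + 1), derivative_sum, derivative_comp,
    derivative_poly_X φ hj, one_mul, eval_comp] at h
  have h0 : (φ.poly X).eval 0 = 0 := by rw [eval_poly, map_zero]
  rw [h0, eval_mul, eval_C] at h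
  refine isUnit_of_mul_isUnit_left (y := eval 0 (derivative st.P)) ?_
  rw [h]
  obtain ⟨Q, hQ⟩ := st.dvd₀
  have h1 := derivative_poly φ hj n
  rw [hQ, derivative_mul] at h1
  have h2 := congrArg (eval 0) h1
  have h3 : st.P₀.eval 0 = 0 := st.zero₀ (AlgHom.id Fq R)
  simp only [eval_add, eval_mul, h3, zero_mul, add_zero, eval_one] at h2
  exact IsUnit.of_mul_eq_one _ h2

/-- The twisted polynomial `H` as an additive polynomial. -/
def polyH : R[X] := ∑ i ∈ Finset.range (j + k), C (st.h i) * X ^ Fintype.card Fq ^ i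

lemma extPoly_comp : st.extPoly.comp (X ^ (Fintype.card Fq - 1)) =
    st.polyH ^ (Fintype.card Fq - 1) - C (st.v : R) :=
  st.eval_extPoly_pow (CAlgHom (R := Fq) (A := R)) X

/-- Pull back along c = w^(q-1) and multiply by H: the result is H^q - v H, with derivative -v h₀. A
common zero c of extPoly and its derivative would make this unit vanish at w. -/
lemma isCoprime_extPoly (hj : 1 ≤ j) : IsCoprime st.extPoly (derivative st.extPoly) := by
  refine isCoprime_of_geometric (Fq := Fq) fun Ω _ _ _ s c h1 h2 => ?_
  have hq := one_lt_card Fq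
  obtain ⟨w, hw⟩ := IsAlgClosed.exists_pow_nat_eq c (by omega : 0 < Fintype.card Fq - 1)
  have key : derivative (st.polyH * st.extPoly.comp (X ^ (Fintype.card Fq - 1))) =
      - C ((st.v : R) * st.h 0) := by
    have h0 : (Fintype.card Fq : R[X]) = 0 := card_cast_eq_zero Fq R[X]
    have hd : derivative st.polyH = C (st.h 0) := by
      rw [polyH, (by omega : j + k = (j + k - 1) + 1), derivative_sum, derivative_X, mul_one]
    rw [extPoly_comp, mul_sub, mul_pow_card_sub_one Fq, derivative_sub, derivative_pow,
      derivative_mul, derivative_C, hd]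
    simp [h0, mul_comm]
  have h := congrArg (eval₂ (s : R →+* Ω) w) key
  rw [derivative_mul, derivative_comp, eval₂_add, eval₂_mul, eval₂_mul, eval₂_mul, eval₂_comp,
    eval₂_comp, eval₂_pow, eval₂_X, hw, h1, h2, mul_zero, mul_zero, mul_zero, zero_add, eval₂_neg,
    eval₂_C, eq_comm, neg_eq_zero] at h
  exact ((st.v.isUnit.mul (st.isUnit_h_zero hj)).map (s : R →+* Ω)).ne_zero h

/-- P₀ cuts out the image of the zero scheme of P under φ_T, so φ and P determine it. It follows
below that P also determines v, and this gives both uniqueness of maps out of the tower and descent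
of P₀. -/
lemma map_P₀_eq (hj : 1 ≤ j) {f g : R →ₐ[Fq] S} (hφ : φ.map f = φ.map g)
    (hP : st.P.map (f : R →+* S) = st.P.map (g : R →+* S)) :
    st.P₀.map (f : R →+* S) = st.P₀.map (g : R →+* S) := by
  refine IsImage.unique hj (n := n) (φ := φ.map f) (st.map f).monic₀ (st.map g).monic₀
    (st.map f).dvd₀ ?_ ((st.map f).isImage hj) ?_
  · rw [hφ]; exact (st.map g).dvd₀
  · change (φ.map f).IsImage (st.P.map (f : R →+* S)) (st.P₀.map (g : R →+* S))
    rw [hφ, hP]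
    exact (st.map g).isImage hj

lemma map_v_eq (hj : 1 ≤ j) {f g : R →ₐ[Fq] S} (hφ : φ.map f = φ.map g)
    (hP : st.P.map (f : R →+* S) = st.P.map (g : R →+* S)) : f st.v = g st.v := by
  have h₀ := st.map_P₀_eq hj hφ hP
  have h1 := (st.map f).P_eq
  have h2 := (st.map g).P_eq
  change st.P.map (f : R →+* S) = (st.P₀.map (f : R →+* S)) ^ _ -
    C (f st.v) * st.P₀.map (f : R →+* S) at h1
  change st.P.map (g : R →+* S) = (st.P₀.map (g : R →+* S)) ^ _ -
    C (g st.v) * st.P₀.map (g : R →+* S) at h2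
  rw [hP, h2, h₀, sub_right_inj] at h1
  -- P₀ is monic, hence cancellable in v P₀ = P₀^q - P.
  have h3 := (st.monic₀.map (g : R →+* S)).isRegular.right h1
  exact (C_injective h3).symm

lemma exists_next_map (hj : 1 ≤ j) (f : R →ₐ[Fq] S) {ψ : DrinfeldModule Fq j k S}
    (hψ : φ.map f = ψ) {c : S} (hc : st.extPoly.eval₂ (f : R →+* S) c = 0) :
    ∃ st' : Stage Fq ψ (n + 1), st'.P₀ = st.P.map (f : R →+* S) ∧ (st'.v : S) = c := by
  subst hψ
  refine (st.map f).exists_next hj c ?_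
  have h1 : (st.map f).extPoly = st.extPoly.map (f : R →+* S) := by
    simp [extPoly, eta, map, Polynomial.map_sum]
  rw [h1, eval_map, hc]

/-- The source of the degree q^(m-1): after division by the (q-1)-st power of the leading
coefficient of H, extPoly is X (X^e + ⋯)^(q-1) minus a constant, where e = 1 + q + ⋯ + q^(m-2) and
(q-1) e + 1 = q^(m-1). -/
lemma exists_monic_extPoly (hj : 1 ≤ j) (hk : 1 ≤ k) : ∃ (g : R[X]) (w : Rˣ), g.Monic ∧
    g = C (w : R) * st.extPoly ∧
    (Nontrivial R → g.natDegree = Fintype.card Fq ^ (j + k - 1)) := by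
  obtain ⟨a, ha⟩ := st.isUnit_h
  have hq := one_lt_card Fq
  set M := j + k - 1 with hM
  have hM1 : j + k = M + 1 := by omega
  set p : R[X] := ∑ i ∈ Finset.range M, C (((a⁻¹ : Rˣ) : R) * st.h i) * X ^ geomExp Fq i with hp
  have hdeg : p.degree < geomExp Fq M := by
    refine lt_of_le_of_lt (degree_sum_le _ _) ?_
    rw [Finset.sup_lt_iff (by exact_mod_cast WithBot.bot_lt_coe _)]
    intro i hi
    refine lt_of_le_of_lt (degree_C_mul_X_pow_le _ _) ?_
    exact_mod_cast geomExp_strictMono Fq (Finset.mem_range.mp hi)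
  have heta : C (((a⁻¹ : Rˣ) : R)) * st.eta = X ^ geomExp Fq M + p := by
    rw [eta, hM1, Finset.sum_range_succ, mul_add, Finset.mul_sum, add_comm, ← mul_assoc, ← C_mul,
      ← ha, Units.inv_mul, C_1, one_mul, hp]
    congr 1
    exact Finset.sum_congr rfl fun i _ => by rw [C_mul, mul_assoc]
  have hmon : (X ^ geomExp Fq M + p).Monic := monic_X_pow_add hdeg
  have hmon' : (X * (X ^ geomExp Fq M + p) ^ (Fintype.card Fq - 1)).Monic :=
    monic_X.mul (hmon.pow _)
  have hnd : Nontrivial R → (X * (X ^ geomExp Fq M + p) ^ (Fintype.card Fq - 1)).natDegree =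
      Fintype.card Fq ^ M := fun _ => by
    have h1 : (X ^ geomExp Fq M + p).natDegree = geomExp Fq M := by
      rw [natDegree_add_eq_left_of_degree_lt, natDegree_X_pow]
      rwa [degree_X_pow]
    rw [monic_X.natDegree_mul (hmon.pow _), hmon.natDegree_pow, h1, natDegree_X,
      ← card_sub_one_mul_geomExp, add_comm]
  have hg : C (((a⁻¹ ^ (Fintype.card Fq - 1) : Rˣ) : R)) * st.extPoly =
      X * (X ^ geomExp Fq M + p) ^ (Fintype.card Fq - 1) -
        C (((a⁻¹ ^ (Fintype.card Fq - 1) : Rˣ) : R) * st.v) := by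
    rw [extPoly, ← heta, mul_pow, C_mul, Units.val_pow_eq_pow_val, C_pow]
    ring
  refine ⟨_, a⁻¹ ^ (Fintype.card Fq - 1), ?_, rfl, fun _ => ?_⟩
  · rw [hg]
    nontriviality R
    refine hmon'.sub_of_left (lt_of_le_of_lt degree_C_le ?_)
    rw [degree_eq_natDegree hmon'.ne_zero, hnd ‹_›]
    exact_mod_cast pow_pos Fintype.card_pos _
  · rw [hg, natDegree_sub_C, hnd ‹_›]

end Stage

/-! ### The tower of level structures -/

variable (Fq) in
/-- The étale algebra over `A₁` that parametrizes the `T ^ (n + 1)`-level structures of `φ₁` whose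
`T`-torsion is the line `Y ^ q - u Y`. -/
structure Tower {A₁ : Type u} [CommRing A₁] [Algebra Fq A₁] (φ₁ : DrinfeldModule Fq j k A₁)
    (u : A₁ˣ) (n : ℕ) where
  A : Type u
  [ring : CommRing A]
  [algebra₁ : Algebra A₁ A]
  [algebra : Algebra Fq A]
  [tower : IsScalarTower Fq A₁ A]
  st : Stage Fq (φ₁.map (IsScalarTower.toAlgHom Fq A₁ A)) n
  etale : Algebra.Etale A₁ A
  hom_ext : ∀ (R : Type u) [CommRing R] [Algebra Fq R] (f g : A →ₐ[Fq] R),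
    (∀ a, f (algebraMap A₁ A a) = g (algebraMap A₁ A a)) →
    st.P.map (f : A →+* R) = st.P.map (g : A →+* R) → f = g
  exists_lift : ∀ (S : Type u) [CommRing S] [Algebra Fq S] (f₁ : A₁ →ₐ[Fq] S) (y x : S),
    IsUnit x → (φ₁.map f₁).act (X ^ n) y = x → x ^ (Fintype.card Fq - 1) = f₁ u →
    ∃ f : A →ₐ[Fq] S, (∀ a, f (algebraMap A₁ A a) = f₁ a) ∧ st.P.eval₂ (f : A →+* S) y = 0
  act_pow : ∀ (S : Type u) [CommRing S] [Algebra Fq S] (f : A →ₐ[Fq] S) (y : S),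
    st.P.eval₂ (f : A →+* S) y = 0 →
    ((φ₁.map (IsScalarTower.toAlgHom Fq A₁ A)).map f).act (X ^ n) y ^ Fintype.card Fq =
      f (algebraMap A₁ A u) * ((φ₁.map (IsScalarTower.toAlgHom Fq A₁ A)).map f).act (X ^ n) y
  line_mem : ∀ (S : Type u) [CommRing S] [Algebra Fq S] (f : A →ₐ[Fq] S) (z : S),
    z ^ Fintype.card Fq = f (algebraMap A₁ A u) * z → st.P.eval₂ (f : A →+* S) z = 0

attribute [instance] Tower.ring Tower.algebra₁ Tower.algebra Tower.tower

namespace Tower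

variable {A₁ : Type u} [CommRing A₁] [Algebra Fq A₁] {φ₁ : DrinfeldModule Fq j k A₁} {u : A₁ˣ}

theorem exists_zero (hj : 1 ≤ j) (hk : 1 ≤ k) (hu : φ₁.lineValue (u : A₁) = 0) :
    ∃ t : Tower Fq φ₁ u 0, Nontrivial A₁ → Nontrivial t.A := by
  obtain ⟨st, hst⟩ := Stage.exists_line (φ₁.map (IsScalarTower.toAlgHom Fq A₁ A₁)) hj hk u hu
  refine ⟨{ A := A₁, st := st, etale := inferInstance
            hom_ext := fun R _ _ f g h _ => AlgHom.ext h
            exists_lift := fun S _ _ f₁ y x _ hy hx => ⟨f₁, fun _ => rfl, ?_⟩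
            act_pow := fun S _ _ f y hy => ?_
            line_mem := fun S _ _ f z hz => ?_ }, fun h => h⟩
  all_goals rw [hst, eval₂_sub, eval₂_pow, eval₂_mul, eval₂_X, eval₂_C] at *
  · rw [pow_zero, act_one] at hy
    subst hy
    change y ^ _ - f₁ u * y = 0
    rw [← hx, mul_comm, mul_pow_card_sub_one Fq, sub_self]
  · rw [pow_zero, act_one]
    exact sub_eq_zero.mp hy
  · exact sub_eq_zero.mpr hz

/-- The new storey adjoins a root c of extPoly. Conversely the pair (φ, P) of the new stage recovers
P₀, which is the old P, and v = c, so nothing is parametrized twice. -/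
theorem exists_next (hj : 1 ≤ j) (hk : 1 ≤ k) {n : ℕ} (t : Tower Fq φ₁ u n) :
    ∃ (t' : Tower Fq φ₁ u (n + 1)) (i : t.A →ₐ[Fq] t'.A),
      (∀ a, i (algebraMap A₁ t.A a) = algebraMap A₁ t'.A a) ∧
      t'.st.P₀ = t.st.P.map (i : t.A →+* t'.A) ∧
      (Nontrivial t.A → IsFreeOfRank (i : t.A →+* t'.A) (Fintype.card Fq ^ (j + k - 1))) := by
  obtain ⟨g, w, hg, hgw, hdeg⟩ := t.st.exists_monic_extPoly hj hk
  let i : t.A →ₐ[Fq] AdjoinRoot g := IsScalarTower.toAlgHom Fq t.A (AdjoinRoot g)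
  have hi : ∀ a, i a = AdjoinRoot.of g a := fun a => rfl
  have hφ : (φ₁.map (IsScalarTower.toAlgHom Fq A₁ t.A)).map i =
      φ₁.map (IsScalarTower.toAlgHom Fq A₁ (AdjoinRoot g)) := by
    rw [map_map]; rfl
  have hroot : ∀ {S : Type u} [CommRing S] (f : t.A →+* S) (c : S), g.eval₂ f c = 0 ↔
      t.st.extPoly.eval₂ f c = 0 := fun f c => by
    rw [hgw, eval₂_mul, eval₂_C]
    exact (w.isUnit.map f).mul_right_eq_zero
  obtain ⟨st', hst', hv⟩ := t.st.exists_next_map hj i hφ (c := AdjoinRoot.root g)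
    ((hroot _ _).1 (AdjoinRoot.eval₂_root g))
  have hact : ∀ (S : Type u) [CommRing S] [Algebra Fq S] (f : AdjoinRoot g →ₐ[Fq] S) (y : S),
      st'.P.eval₂ (f : AdjoinRoot g →+* S) y = 0 →
      ((φ₁.map (IsScalarTower.toAlgHom Fq A₁ (AdjoinRoot g))).map f).act (X ^ (n + 1)) y ^
        Fintype.card Fq = f (algebraMap A₁ (AdjoinRoot g) u) *
        ((φ₁.map (IsScalarTower.toAlgHom Fq A₁ (AdjoinRoot g))).map f).act (X ^ (n + 1)) y := by
    intro S _ _ f y hy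
    have h1 := st'.eval_P₀_phiT f hy
    rw [hst', eval₂_map] at h1
    have h2 := t.act_pow S (f.comp i) _ h1
    rw [← map_map, hφ] at h2
    rw [act_X_pow_succ]
    exact h2
  have hline : ∀ (S : Type u) [CommRing S] [Algebra Fq S] (f : AdjoinRoot g →ₐ[Fq] S) (z : S),
      z ^ Fintype.card Fq = f (algebraMap A₁ (AdjoinRoot g) u) * z →
      st'.P.eval₂ (f : AdjoinRoot g →+* S) z = 0 := by
    intro S _ _ f z hz
    refine st'.eval_P_eq_zero f ?_
    rw [hst', eval₂_map]
    exact t.line_mem S (f.comp i) z hz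
  refine ⟨{ A := AdjoinRoot g, st := st', etale := ?_
            hom_ext := fun R _ _ f₁ f₂ h hP => ?_
            exists_lift := fun S _ _ f₁ y x hx hy hxu => ?_
            act_pow := hact
            line_mem := hline }, i, fun a => rfl, hst', fun _ => ?_⟩
  · have := t.etale
    have hco : IsCoprime g (derivative g) := by
      rw [hgw, derivative_C_mul]
      have hw : IsUnit (C (w : t.A)) := w.isUnit.map C
      exact (isCoprime_mul_unit_left hw _ _).2 (t.st.isCoprime_extPoly hj)
    have := etale_adjoinRoot hg hco
    exact Algebra.Etale.comp A₁ t.A (AdjoinRoot g)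
  · have hφ' : (φ₁.map (IsScalarTower.toAlgHom Fq A₁ (AdjoinRoot g))).map f₁ =
        (φ₁.map (IsScalarTower.toAlgHom Fq A₁ (AdjoinRoot g))).map f₂ := by
      rw [map_map, map_map]
      exact congrArg φ₁.map (AlgHom.ext h)
    have h0 := st'.map_P₀_eq hj hφ' hP
    have h1 := st'.map_v_eq hj hφ' hP
    rw [hst', Polynomial.map_map, Polynomial.map_map] at h0
    have h2 := t.hom_ext R (f₁.comp i) (f₂.comp i) h h0
    have h3 : (f₁ : AdjoinRoot g →+* R) = f₂ :=
      AdjoinRoot.ringHom_ext (congrArg (fun f : t.A →ₐ[Fq] R => (f : t.A →+* R)) h2)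
        (by rw [hv] at h1; exact h1)
    exact AlgHom.coe_ringHom_injective h3
  -- Induction is applied to z = φ_T y, a generator one level below. There P(z) = 0, and P₀(z) is a
  -- unit since it divides φ_{T^n}(z) = x, so P₀(z)^(q-1) = v. As H(P(y)) = P₀(z), the element
  -- P(y)^(q-1) is a root of extPoly.
  · rw [act_X_pow_succ] at hy
    obtain ⟨f, hf, hf'⟩ := t.exists_lift S f₁ ((φ₁.map f₁).phiT y) x hx hy hxu
    have hφf : (φ₁.map (IsScalarTower.toAlgHom Fq A₁ t.A)).map f = φ₁.map f₁ := by
      rw [map_map]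
      exact congrArg φ₁.map (AlgHom.ext hf)
    have hw := t.st.comp_eq S f y
    rw [hφf] at hw
    set z := (φ₁.map f₁).phiT y with hz
    have hunit : IsUnit (t.st.P₀.eval₂ (f : t.A →+* S) z) := by
      have h1 := eval₂_poly (φ₁.map (IsScalarTower.toAlgHom Fq A₁ t.A)) (X ^ n) f z
      obtain ⟨Q, hQ⟩ := t.st.dvd₀
      rw [hφf, hy, hQ, eval₂_mul] at h1
      exact isUnit_of_mul_isUnit_left (h1.symm ▸ hx)
    have hv' : t.st.P₀.eval₂ (f : t.A →+* S) z ^ (Fintype.card Fq - 1) = f t.st.v := by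
      rw [t.st.eval_P, ← mul_pow_card_sub_one Fq, mul_comm (f _), ← mul_sub] at hf'
      exact sub_eq_zero.mp (hunit.mul_right_eq_zero.mp hf')
    have hext : g.eval₂ (f : t.A →+* S)
        (t.st.P.eval₂ (f : t.A →+* S) y ^ (Fintype.card Fq - 1)) = 0 := by
      rw [hroot, t.st.eval_extPoly_pow, hw, hv', sub_self]
    let F : AdjoinRoot g →ₐ[Fq] S := AdjoinRoot.liftAlgHom g f _ hext
    have hF : ∀ a, F (i a) = f a := fun a => AdjoinRoot.liftAlgHom_of g f _ hext a
    refine ⟨F, fun a => ?_, ?_⟩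
    · rw [← hf a, ← hF]; rfl
    · have h1 : st'.P₀.eval₂ (F : AdjoinRoot g →+* S) y = t.st.P.eval₂ (f : t.A →+* S) y := by
        rw [hst', eval₂_map]
        congr 1
        exact RingHom.ext hF
      rw [st'.eval_P, h1, hv, AdjoinRoot.liftAlgHom_root, ← mul_pow_card_sub_one Fq]
      ring
  · rw [← hdeg ‹_›]
    exact isFreeOfRank_adjoinRoot hg

theorem exists_nontrivial (hj : 1 ≤ j) (hk : 1 ≤ k) (hu : φ₁.lineValue (u : A₁) = 0) (n : ℕ) :
    ∃ t : Tower Fq φ₁ u n, Nontrivial A₁ → Nontrivial t.A := by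
  induction n with
  | zero => exact exists_zero hj hk hu
  | succ n ih =>
    obtain ⟨t, ht⟩ := ih
    obtain ⟨t', i, -, -, hi⟩ := t.exists_next hj hk
    refine ⟨t', fun h => ?_⟩
    have := ht h
    exact (hi this).nontrivial (Nat.pow_pos Fintype.card_pos)

end Tower

end DrinfeldModule

/-! ### Faithfully flat descent -/

section Descent

variable {Fq : Type v} [Field Fq]
variable {R : Type u} [CommRing R] [Algebra Fq R] {S : Type u} [CommRing S] [Algebra Fq S]

open TensorProduct in
-- Only the two inclusions of S into S ⊗_R S need testing: R is their equalizer.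
lemma exists_eq_of_faithfullyFlat {i : R →ₐ[Fq] S} (hi : (i : R →+* S).FaithfullyFlat) (x : S)
    (h : ∀ (T : Type u) [CommRing T] [Algebra Fq T] (g₁ g₂ : S →ₐ[Fq] T),
      g₁.comp i = g₂.comp i → g₁ x = g₂ x) : ∃ r : R, i r = x := by
  let _ : Algebra R S := (i : R →+* S).toAlgebra
  have : Module.FaithfullyFlat R S := hi
  have : IsScalarTower Fq R S := .of_algebraMap_eq fun r => (i.commutes r).symm
  let g₁ : S →ₐ[R] S ⊗[R] S := Algebra.TensorProduct.includeLeft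
  let g₂ : S →ₐ[R] S ⊗[R] S := Algebra.TensorProduct.includeRight
  have key := h (S ⊗[R] S) (g₁.restrictScalars Fq) (g₂.restrictScalars Fq)
    (AlgHom.ext fun r => (g₁.commutes r).trans (g₂.commutes r).symm)
  obtain ⟨r, hr⟩ := (Algebra.IsEffective.of_faithfullyFlat R S x).1 (by
    rw [Algebra.TensorProduct.includeLeftSubRight_apply, sub_eq_zero]
    exact key)
  exact ⟨r, hr⟩

/-- If m S = S for a maximal ideal m, then 1 would vanish at a geometric point of S lying over a
geometric point of R that kills m. -/
lemma faithfullyFlat_of_geometric {i : R →ₐ[Fq] S} (hi : (i : R →+* S).Flat)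
    (h : ∀ (Ω : Type u) [Field Ω] [IsAlgClosed Ω] [Algebra Fq Ω] (s : R →ₐ[Fq] Ω),
      ∃ s' : S →ₐ[Fq] Ω, s'.comp i = s) : (i : R →+* S).FaithfullyFlat := by
  let _ : Algebra R S := (i : R →+* S).toAlgebra
  change Module.FaithfullyFlat R S
  refine { toFlat := hi, submodule_ne_top := fun {m} hm htop => ?_ }
  obtain ⟨Ω, _, _, _, s, hs⟩ := exists_geometric_point Fq m hm.ne_top
  obtain ⟨s', rfl⟩ := h Ω s
  have key : ∀ z ∈ m • (⊤ : Submodule R S), s' z = 0 := by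
    intro z hz
    induction hz using Submodule.smul_induction_on' with
    | smul r hr z _ =>
      have h1 : r • z = i r * z := Algebra.smul_def r z
      have h2 := hs r hr
      rw [AlgHom.comp_apply] at h2
      rw [h1, map_mul, h2, zero_mul]
    | add z _ w _ hz hw => rw [map_add, hz, hw, add_zero]
  have := key 1 (by rw [htop]; exact Submodule.mem_top)
  rw [map_one] at this
  exact one_ne_zero this

lemma exists_algHom_of_faithfullyFlat {i : R →ₐ[Fq] S} (hi : (i : R →+* S).FaithfullyFlat)
    {B : Type*} [CommRing B] [Algebra Fq B] (f : B →ₐ[Fq] S)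
    (h : ∀ (T : Type u) [CommRing T] [Algebra Fq T] (g₁ g₂ : S →ₐ[Fq] T),
      g₁.comp i = g₂.comp i → g₁.comp f = g₂.comp f) : ∃ f' : B →ₐ[Fq] R, i.comp f' = f := by
  have h1 : ∀ b, ∃ r : R, i r = f b := fun b =>
    exists_eq_of_faithfullyFlat hi (f b) fun T _ _ g₁ g₂ hg => DFunLike.congr_fun (h T g₁ g₂ hg) b
  choose f' hf' using h1
  have hinj : Function.Injective i := hi.injective
  refine ⟨{ toFun := f'
            map_one' := hinj (by rw [hf', map_one, map_one])
            map_mul' := fun a b => hinj (by rw [hf', map_mul, map_mul, hf', hf'])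
            map_zero' := hinj (by rw [hf', map_zero, map_zero])
            map_add' := fun a b => hinj (by rw [hf', map_add, map_add, hf', hf'])
            commutes' := fun r => hinj (by rw [hf', f.commutes, i.commutes]) }, AlgHom.ext hf'⟩

lemma exists_polynomial_of_faithfullyFlat {i : R →ₐ[Fq] S} (hi : (i : R →+* S).FaithfullyFlat)
    (P : S[X]) (h : ∀ (T : Type u) [CommRing T] [Algebra Fq T] (g₁ g₂ : S →ₐ[Fq] T),
      g₁.comp i = g₂.comp i → P.map (g₁ : S →+* T) = P.map (g₂ : S →+* T)) :
    ∃ Q : R[X], Q.map (i : R →+* S) = P := by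
  rw [← mem_lifts, lifts_iff_coeff_lifts]
  intro m
  refine exists_eq_of_faithfullyFlat hi (P.coeff m) fun T _ _ g₁ g₂ hg => ?_
  simpa using congrArg (fun Q : T[X] => Q.coeff m) (h T g₁ g₂ hg)

end Descent

/-! ### Generators after a flat cover, and images of level structures -/

namespace DrinfeldModule

variable {Fq : Type v} [Field Fq] [Fintype Fq] {j k : ℕ}
variable {R : Type u} [CommRing R] [Algebra Fq R]
variable {S : Type u} [CommRing S] [Algebra Fq S]

lemma IsLevel.phiT_act {φ : DrinfeldModule Fq j k R} {n : ℕ} {P : R[X]}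
    (h : φ.IsLevel (X ^ (n + 1)) P) {y : R} (hy : P.eval y = 0) :
    φ.phiT (φ.act (X ^ n) y) = 0 := by
  rw [← act_X_pow_succ', ← eval_poly]
  obtain ⟨Q, hQ⟩ := h.2.1
  rw [hQ, eval_mul, hy, zero_mul]

/-- After a faithfully flat base change, a level structure has a generator. -/
theorem IsLevel.exists_cover {φ : DrinfeldModule Fq j k R} {n : ℕ} {P : R[X]}
    (h : φ.IsLevel (X ^ (n + 1)) P) :
    ∃ (S : Type u) (_ : CommRing S) (_ : Algebra Fq S) (i : R →ₐ[Fq] S) (y : S),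
      (i : R →+* S).FaithfullyFlat ∧ (P.map (i : R →+* S)).eval y = 0 ∧
      IsUnit ((φ.map i).act (X ^ n) y) ∧
      ∀ (Ω : Type u) [Field Ω] [IsAlgClosed Ω] [Algebra Fq Ω] (s : R →ₐ[Fq] Ω),
        ∃ s' : S →ₐ[Fq] Ω, s'.comp i = s := by
  -- The cover adjoins a zero y of P and inverts φ_{T^n}(y). It is flat as a localization of a free
  -- algebra, and its geometric points are the geometric points of R with a generator of the fibre
  -- of G.
  let i₀ : R →ₐ[Fq] AdjoinRoot P := IsScalarTower.toAlgHom Fq R (AdjoinRoot P)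
  set x := (φ.map i₀).act (X ^ n) (AdjoinRoot.root P) with hx
  let S := Localization.Away x
  let i₁ : AdjoinRoot P →ₐ[Fq] S := IsScalarTower.toAlgHom Fq (AdjoinRoot P) S
  let i := i₁.comp i₀
  have hlift : ∀ (Ω : Type u) [Field Ω] [IsAlgClosed Ω] [Algebra Fq Ω] (s : R →ₐ[Fq] Ω),
      ∃ s' : S →ₐ[Fq] Ω, s'.comp i = s := by
    intro Ω _ _ _ s
    obtain ⟨y, hy, hy'⟩ := h.exists_generator s
    let s₀ : AdjoinRoot P →ₐ[Fq] Ω := AdjoinRoot.liftAlgHom P s y hy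
    have hs₀ : s₀.comp i₀ = s := AlgHom.ext fun a => AdjoinRoot.liftAlgHom_of P s y hy a
    have hs₀' : IsUnit (s₀ x) := by
      rw [hx, map_act, map_map, hs₀, AdjoinRoot.liftAlgHom_root]
      exact hy'.isUnit
    refine ⟨IsLocalization.Away.liftAlgHom x hs₀', ?_⟩
    rw [← hs₀]
    ext a
    exact IsLocalization.Away.lift_eq x (g := (s₀ : AdjoinRoot P →+* Ω)) hs₀' (i₀ a)
  refine ⟨S, inferInstance, inferInstance, i, i₁ (AdjoinRoot.root P), ?_, ?_, ?_, hlift⟩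
  · have hfree := h.1.free_adjoinRoot
    have : Module.Flat (AdjoinRoot P) S := IsLocalization.flat S (Submonoid.powers x)
    have hflat : (i : R →+* S).Flat :=
      RingHom.Flat.comp (f := algebraMap R (AdjoinRoot P)) (g := algebraMap (AdjoinRoot P) S)
        (RingHom.flat_algebraMap_iff.2 inferInstance) (RingHom.flat_algebraMap_iff.2 this)
    exact faithfullyFlat_of_geometric hflat hlift
  · have e : P.map (i : R →+* S) =
        (P.map (i₀ : R →+* AdjoinRoot P)).map (i₁ : AdjoinRoot P →+* S) := by
      rw [Polynomial.map_map]; rfl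
    rw [e, eval_map]
    have := eval₂_at_apply (p := P.map (i₀ : R →+* AdjoinRoot P)) (i₁ : AdjoinRoot P →+* S)
      (AdjoinRoot.root P)
    refine this.trans ?_
    have e : (P.map (i₀ : R →+* AdjoinRoot P)).eval (AdjoinRoot.root P) = 0 := by
      rw [eval_map]; exact AdjoinRoot.eval₂_root P
    rw [e, map_zero]
  · have e : (φ.map i).act (X ^ n) (i₁ (AdjoinRoot.root P)) = i₁ x := by
      have e' : φ.map i = (φ.map i₀).map i₁ := (map_map _ _ _).symm
      rw [e', ← map_act]
    rw [e]
    exact IsLocalization.Away.algebraMap_isUnit x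

/-- On each geometric fibre both groups are A · y, and monic divisors of φ_{T^(n+1)} with equal
geometric zeros are equal. -/
lemma IsLevel.eq_of_generator {φ : DrinfeldModule Fq j k R} (hj : 1 ≤ j) {n : ℕ} {P Q : R[X]}
    (hP : φ.IsLevel (X ^ (n + 1)) P) (hQ : φ.IsLevel (X ^ (n + 1)) Q) {y : R}
    (hy : P.eval y = 0) (hy' : Q.eval y = 0) (hu : IsUnit (φ.act (X ^ n) y)) : P = Q := by
  refine eq_of_geometric (Fq := Fq) (derivative_poly φ hj (n + 1)) hP.2.1 hQ.2.1 hP.1 hQ.1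
    fun Ω _ _ _ s z => ?_
  have h0 : (φ.map s).act (X ^ n) (s y) ≠ 0 := by
    rw [← map_act]
    exact (hu.map s).ne_zero
  have h1 : ∀ T : R[X], T.eval y = 0 → T.eval₂ (s : R →+* Ω) (s y) = 0 := fun T hT =>
    (eval₂_at_apply (s : R →+* Ω) y).trans (by rw [hT, map_zero])
  rw [hP.exists_act_eq_iff s (h1 P hy) h0, hQ.exists_act_eq_iff s (h1 Q hy') h0]

/-- Fibrewise x and x₀ span the same Fq-line, so their ratio lies in Fq^×. To obtain equality in a
possibly nonreduced R, the lines Y^q - x^(q-1) Y and Y^q - x₀^(q-1) Y are compared as monic divisors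
of the separable φ_T, and the coefficient of Y is read off. -/
lemma IsLevel.pow_eq_pow {φ : DrinfeldModule Fq j k R} (hj : 1 ≤ j) (hk : 1 ≤ k) {n : ℕ}
    {P : R[X]} (h : φ.IsLevel (X ^ (n + 1)) P) {x x₀ : R} (hx : IsUnit x) (hx₀ : IsUnit x₀)
    (hP : ∀ (Ω : Type u) [Field Ω] [IsAlgClosed Ω] [Algebra Fq Ω] (s : R →ₐ[Fq] Ω),
      P.eval₂ (s : R →+* Ω) (s x) = 0 ∧ P.eval₂ (s : R →+* Ω) (s x₀) = 0)
    (hT : φ.phiT x = 0) (hT₀ : φ.phiT x₀ = 0) :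
    x ^ (Fintype.card Fq - 1) = x₀ ^ (Fintype.card Fq - 1) := by
  obtain ⟨st, hst⟩ := Stage.exists_line φ hj hk (hx.pow (Fintype.card Fq - 1)).unit
    (lineValue_eq_zero φ hx hT)
  obtain ⟨st₀, hst₀⟩ := Stage.exists_line φ hj hk (hx₀.pow (Fintype.card Fq - 1)).unit
    (lineValue_eq_zero φ hx₀ hT₀)
  have key : st.P = st₀.P := by
    refine eq_of_geometric (Fq := Fq) (derivative_poly φ hj (0 + 1)) st.dvd st₀.dvd st.monic
      st₀.monic fun Ω _ _ _ s z => ?_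
    have h2 : ∀ a : R, φ.phiT a = 0 → (φ.map s).phiT (s a) = 0 := fun a ha => by
      rw [← map_phiT, ha, map_zero]
    obtain ⟨c, hc⟩ := h.exists_algebraMap_mul_eq s (hP Ω s).1 (h2 x hT) (hP Ω s).2 (h2 x₀ hT₀)
      (hx₀.map s).ne_zero
    have hc0 : c ≠ 0 := by
      rintro rfl
      rw [map_zero, zero_mul] at hc
      exact (hx.map s).ne_zero hc.symm
    have e : s (x ^ (Fintype.card Fq - 1)) = s (x₀ ^ (Fintype.card Fq - 1)) := by
      rw [map_pow, map_pow, ← hc, mul_pow, ← map_pow, FiniteField.pow_card_sub_one_eq_one c hc0,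
        map_one, one_mul]
    rw [hst, hst₀]
    simp only [eval₂_sub, eval₂_pow, eval₂_mul, eval₂_X, eval₂_C, IsUnit.unit_spec]
    change _ - s _ * z = 0 ↔ _ - s _ * z = 0
    rw [e]
  rw [hst, hst₀, sub_right_inj] at key
  have h1 := congrArg (fun p : R[X] => p.coeff 1) key
  simpa only [coeff_C_mul, coeff_X_one, mul_one, IsUnit.unit_spec] using h1

/-- A level structure with a generator comes from a stage. -/
theorem exists_stage {φ : DrinfeldModule Fq j k R} (hj : 1 ≤ j) (hk : 1 ≤ k) {n : ℕ} {y : R}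
    (hu : IsUnit (φ.act (X ^ (n + 1)) y)) (hT : φ.act (X ^ (n + 2)) y = 0) :
    ∃ st : Stage Fq φ (n + 1), st.P.eval y = 0 ∧ φ.IsLevel (X ^ (n + 1)) st.P₀ ∧
      ∀ z, z ^ Fintype.card Fq = φ.act (X ^ (n + 1)) y ^ (Fintype.card Fq - 1) * z →
        st.P₀.eval z = 0 := by
  have hl := lineValue_eq_zero φ hu (by rw [← act_X_pow_succ']; exact hT)
  -- The tower is taken over R itself, above the line spanned by φ_{T^(n+1)}(y); the generator y
  -- then yields a section of it.
  obtain ⟨t, -⟩ := Tower.exists_nontrivial (u := (hu.pow (Fintype.card Fq - 1)).unit) hj hk hl n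
  obtain ⟨t', i, hi, hi', -⟩ := t.exists_next hj hk
  obtain ⟨f, hf, hf'⟩ := t'.exists_lift R (AlgHom.id Fq R) y _ hu rfl rfl
  have hφ : (φ.map (IsScalarTower.toAlgHom Fq R t'.A)).map f = φ := by
    rw [map_map]
    exact congrArg φ.map (AlgHom.ext hf : _ = AlgHom.id Fq R)
  have hφ' : (φ.map (IsScalarTower.toAlgHom Fq R t.A)).map (f.comp i) = φ := by
    rw [map_map]
    exact congrArg φ.map (AlgHom.ext fun a => (congrArg f (hi a)).trans (hf a) :
      _ = AlgHom.id Fq R)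
  have key : ∀ {ψ : DrinfeldModule Fq j k R} (st : Stage Fq ψ (n + 1)), ψ = φ →
      ∃ st' : Stage Fq φ (n + 1), st'.P = st.P ∧ st'.P₀ = st.P₀ := by
    rintro _ st rfl
    exact ⟨st, rfl, rfl⟩
  obtain ⟨st, h1, h2⟩ := key (t'.st.map f) hφ
  have hP₀ : st.P₀ = t.st.P.map ((f.comp i : t.A →ₐ[Fq] R) : t.A →+* R) := by
    rw [h2]
    change t'.st.P₀.map (f : t'.A →+* R) = _
    rw [hi', Polynomial.map_map]
    rfl
  refine ⟨st, ?_, ?_, fun z hz => ?_⟩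
  · rw [h1]
    exact (eval_map _ _).trans hf'
  · have h3 := (t.st.isLevel hj).map (f.comp i)
    rwa [hφ', ← hP₀] at h3
  · rw [hP₀, eval_map]
    refine t.line_mem R (f.comp i) z ?_
    rw [AlgHom.comp_apply, hi, hf]
    exact hz

/-- The image of a level structure under `φ_T`. -/
theorem IsLevel.exists_image {φ : DrinfeldModule Fq j k R} (hj : 1 ≤ j) (hk : 1 ≤ k) {n : ℕ}
    {P : R[X]} (h : φ.IsLevel (X ^ (n + 2)) P) :
    ∃ Q : R[X], φ.IsLevel (X ^ (n + 1)) Q ∧ φ.IsImage P Q ∧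
      ∀ x, IsUnit x → P.eval x = 0 → φ.phiT x = 0 → Q.eval x = 0 := by
  obtain ⟨S, _, _, i, y, hi, hy, hu, hΩ⟩ := h.exists_cover
  have hS := h.map i
  obtain ⟨st, hst, hlev, hline⟩ := exists_stage hj hk hu
    (by rw [act_X_pow_succ']; exact hS.phiT_act hy)
  have hP : st.P = P.map (i : R →+* S) :=
    IsLevel.eq_of_generator hj (st.isLevel hj) hS hst hy hu
  -- P₀ is determined by φ and P, which are both defined over R, so its two pull-backs agree and it
  -- descends.
  obtain ⟨Q, hQ⟩ := exists_polynomial_of_faithfullyFlat hi st.P₀ fun T _ _ g₁ g₂ hg =>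
    st.map_P₀_eq hj (by rw [map_map, map_map, hg]) (by
      rw [hP, Polynomial.map_map, Polynomial.map_map]
      exact congrArg (fun f : R →ₐ[Fq] T => P.map (f : R →+* T)) hg)
  have hinj : Function.Injective (i : R →+* S) := hi.injective
  have hev : ∀ {Ω : Type u} [Field Ω] [Algebra Fq Ω] (s' : S →ₐ[Fq] Ω) (z : Ω),
      Q.eval₂ ((s'.comp i : R →ₐ[Fq] Ω) : R →+* Ω) z = st.P₀.eval₂ (s' : S →+* Ω) z := by
    intro Ω _ _ s' z
    rw [← hQ, eval₂_map]; rfl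
  refine ⟨Q, ⟨?_, ?_, ?_⟩, ?_, fun x hx hPx hTx => hinj ?_⟩
  · exact hinj.monic_map_iff.2 (hQ.symm ▸ hlev.1)
  · rw [← map_dvd_map _ hinj (hinj.monic_map_iff.2 (hQ.symm ▸ hlev.1)), hQ, map_poly]
    exact hlev.2.1
  · intro Ω _ _ _ s
    obtain ⟨s', rfl⟩ := hΩ Ω s
    obtain ⟨G, hG, e⟩ := hlev.2.2 Ω s'
    rw [← map_map]
    exact ⟨G, fun z => by rw [hG z, hev], e⟩
  · intro Ω _ _ _ s z
    obtain ⟨s', rfl⟩ := hΩ Ω s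
    rw [hev, ← map_map, st.isImage hj Ω s' z, hP]
    simp only [eval₂_map]
    rfl
  · have hx' : (P.map (i : R →+* S)).eval (i x) = 0 := by
      rw [eval_map]
      exact (eval₂_at_apply (i : R →+* S) x).trans (by rw [hPx, map_zero])
    -- The torsion point x and φ_{T^(n+1)}(y) have the same (q-1)-st power, which places x on the
    -- line contained in the zeros of P₀.
    have h1 := hS.pow_eq_pow hj hk (hx.map i) hu (fun Ω _ _ _ s => ⟨?_, ?_⟩)
      (by rw [← map_phiT, hTx, map_zero]) (hS.phiT_act hy)
    · have h2 := hline (i x) (by rw [← h1, mul_comm, mul_pow_card_sub_one Fq])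
      rw [← hQ, eval_map] at h2
      rw [map_zero]
      exact (eval₂_at_apply (i : R →+* S) x).symm.trans h2
    · exact (eval₂_at_apply (s : S →+* Ω) (i x)).trans (by rw [hx', map_zero])
    · rw [map_act]
      exact hS.act_mem s ((eval₂_at_apply (s : S →+* Ω) y).trans (by rw [hy, map_zero])) _

end DrinfeldModule

/-! ### Moduli problems -/

namespace ModuliProblem

variable {Fq : Type v} [Field Fq]

/-- Families are functorial, and equivalence of families is an equivalence relation that is stable
under base change and descends along faithfully flat base change. -/
structure Lawful (M : ModuliProblem.{v, u} Fq) : Prop where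
  refl : ∀ {R : Type u} [CommRing R] [Algebra Fq R] (t : M.Pt R), M.equiv t t
  symm : ∀ {R : Type u} [CommRing R] [Algebra Fq R] {t t' : M.Pt R}, M.equiv t t' → M.equiv t' t
  trans : ∀ {R : Type u} [CommRing R] [Algebra Fq R] {t t' t'' : M.Pt R},
    M.equiv t t' → M.equiv t' t'' → M.equiv t t''
  pull_id : ∀ {R : Type u} [CommRing R] [Algebra Fq R] (t : M.Pt R), M.pull (AlgHom.id Fq R) t = t
  pull_pull : ∀ {R : Type u} [CommRing R] [Algebra Fq R] {S : Type u} [CommRing S] [Algebra Fq S]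
    {T : Type u} [CommRing T] [Algebra Fq T] (f : R →ₐ[Fq] S) (g : S →ₐ[Fq] T) (t : M.Pt R),
    M.pull g (M.pull f t) = M.pull (g.comp f) t
  pull_equiv : ∀ {R : Type u} [CommRing R] [Algebra Fq R] {S : Type u} [CommRing S] [Algebra Fq S]
    (f : R →ₐ[Fq] S) {t t' : M.Pt R}, M.equiv t t' → M.equiv (M.pull f t) (M.pull f t')
  descend : ∀ {R : Type u} [CommRing R] [Algebra Fq R] {S : Type u} [CommRing S] [Algebra Fq S]
    (i : R →ₐ[Fq] S) {t t' : M.Pt R}, (i : R →+* S).FaithfullyFlat →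
    M.equiv (M.pull i t) (M.pull i t') → M.equiv t t'

variable {K : Type u} [Field K] [Algebra Fq K] {M : ModuliProblem.{v, u} Fq}

/-- A family that induces all families faithfully flat locally, and uniquely so, is universal. -/
theorem Lawful.parametrizes (hM : M.Lawful) (B : Type u) [CommRing B] [Algebra K B] [Algebra Fq B]
    [IsScalarTower Fq K B] (t₀ : M.Pt B)
    (mono : ∀ (R : Type u) [CommRing R] [Algebra Fq R] (f g : B →ₐ[Fq] R),
      (∀ a, f (algebraMap K B a) = g (algebraMap K B a)) →
      M.equiv (M.pull f t₀) (M.pull g t₀) → f = g)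
    (loc : ∀ (R : Type u) [CommRing R] [Algebra K R] [Algebra Fq R] [IsScalarTower Fq K R]
      (t : M.Pt R), ∃ (S : Type u) (_ : CommRing S) (_ : Algebra Fq S) (i : R →ₐ[Fq] S)
        (f : B →ₐ[Fq] S), (i : R →+* S).FaithfullyFlat ∧
        (∀ a, f (algebraMap K B a) = i (algebraMap K R a)) ∧
        M.equiv (M.pull f t₀) (M.pull i t)) : Parametrizes K M B t₀ := by
  intro R _ _ _ _ t
  obtain ⟨S, _, _, i, f, hi, hf, he⟩ := loc R t
  -- The two pull-backs of f induce equivalent families, since both are equivalent to the same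
  -- pull-back of t; by `mono` they coincide, so f descends to R.
  obtain ⟨f', hf'⟩ := exists_algHom_of_faithfullyFlat hi f fun T _ _ g₁ g₂ hg => by
    refine mono T _ _ (fun a => ?_) ?_
    · rw [AlgHom.comp_apply, AlgHom.comp_apply, hf]
      exact DFunLike.congr_fun hg _
    · rw [← hM.pull_pull, ← hM.pull_pull]
      refine hM.trans (hM.pull_equiv g₁ he) (hM.trans ?_ (hM.symm (hM.pull_equiv g₂ he)))
      rw [hM.pull_pull, hM.pull_pull, hg]
      exact hM.refl _
  have hK : ∀ a, f' (algebraMap K B a) = algebraMap K R a := fun a => hi.injective (by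
    change i (f' _) = i _
    rw [← hf, ← hf']; rfl)
  refine ⟨{ f' with commutes' := hK }, ?_, fun g hg => ?_⟩
  · refine hM.descend i hi ?_
    rw [hM.pull_pull]
    have : i.comp (AlgHom.restrictScalars Fq ({ f' with commutes' := hK } : B →ₐ[K] R)) = f := by
      rw [← hf']; rfl
    rw [this]
    exact he
  · have h1 : g.restrictScalars Fq = f' := by
      refine mono R _ _ (fun a => ?_) (hM.trans hg (hM.symm (hM.descend i hi ?_)))
      · rw [hK]; exact g.commutes a
      · rw [hM.pull_pull, hf']; exact he
    ext b
    exact DFunLike.congr_fun h1 b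

section Parametrizes

variable {B B₁ : Type u} [CommRing B] [Algebra K B] [Algebra Fq B] [IsScalarTower Fq K B]
  [CommRing B₁] [Algebra K B₁] [Algebra Fq B₁] [IsScalarTower Fq K B₁] {t₀ : M.Pt B} {t₁ : M.Pt B₁}

lemma Lawful.comp_eq_id (hM : M.Lawful) (h : Parametrizes K M B t₀)
    {f : B →ₐ[K] B₁} {g : B₁ →ₐ[K] B} (hf : M.equiv (M.pull (f.restrictScalars Fq) t₀) t₁)
    (hg : M.equiv (M.pull (g.restrictScalars Fq) t₁) t₀) : g.comp f = AlgHom.id K B := by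
  refine (h B t₀).unique ?_ ?_
  · have : (g.comp f).restrictScalars Fq = (g.restrictScalars Fq).comp (f.restrictScalars Fq) := rfl
    rw [this, ← hM.pull_pull]
    exact hM.trans (hM.pull_equiv _ hf) hg
  · have : (AlgHom.id K B).restrictScalars Fq = AlgHom.id Fq B := rfl
    rw [this, hM.pull_id]
    exact hM.refl _

lemma Lawful.exists_algEquiv (hM : M.Lawful) (h : Parametrizes K M B t₀)
    (h₁ : Parametrizes K M B₁ t₁) :
    ∃ e : B ≃ₐ[K] B₁, M.equiv (M.pull ((e : B →ₐ[K] B₁).restrictScalars Fq) t₀) t₁ := by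
  obtain ⟨f, hf, -⟩ := h B₁ t₁
  obtain ⟨g, hg, -⟩ := h₁ B t₀
  exact ⟨AlgEquiv.ofAlgHom f g (hM.comp_eq_id h₁ hg hf) (hM.comp_eq_id h hf hg), hf⟩

end Parametrizes

/-- The degree of an induced morphism may be computed for one choice of the curves. -/
theorem Lawful.inducesDegree {M' : ModuliProblem.{v, u} Fq} (hM : M.Lawful) (hM' : M'.Lawful)
    (cov : ∀ {R : Type u} [CommRing R] [Algebra Fq R], M'.Pt R → M.Pt R → Prop)
    (exists_cov : ∀ {R : Type u} [CommRing R] [Algebra Fq R] (t' : M'.Pt R), ∃ t, cov t' t)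
    (cov_pull : ∀ {R : Type u} [CommRing R] [Algebra Fq R] {S : Type u} [CommRing S] [Algebra Fq S]
      (f : R →ₐ[Fq] S) {t' : M'.Pt R} {t : M.Pt R}, cov t' t → cov (M'.pull f t') (M.pull f t))
    (cov_equiv : ∀ {R : Type u} [CommRing R] [Algebra Fq R] {t' s' : M'.Pt R} {t s : M.Pt R},
      M'.equiv t' s' → cov t' t → cov s' s → M.equiv t s)
    {B B' : Type u} [CommRing B] [Algebra K B] [Algebra Fq B] [IsScalarTower Fq K B]
    [CommRing B'] [Algebra K B'] [Algebra Fq B'] [IsScalarTower Fq K B']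
    {τ : M.Pt B} {τ' : M'.Pt B'} (h : Parametrizes K M B τ) (h' : Parametrizes K M' B' τ')
    (ι : B →ₐ[K] B') (hι : IsInduced (K := K) cov τ τ' ι) {d : ℕ}
    (hd : IsFreeOfRank (ι : B →+* B') d) : InducesDegree K M' M cov d := by
  intro B₁ B₁' _ _ _ _ _ _ _ _ t₀ t₀' h₁ h₁'
  obtain ⟨t, ht⟩ := exists_cov t₀'
  obtain ⟨f, hf, hf'⟩ := h₁ B₁' t
  refine ⟨f, ⟨t, ht, hf⟩, fun g => ?_, ?_⟩
  · rintro ⟨s, hs, hg⟩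
    exact hf' g (hM.trans hg (cov_equiv (hM'.refl _) hs ht))
  · obtain ⟨e, he⟩ := hM.exists_algEquiv h h₁
    obtain ⟨e', he'⟩ := hM'.exists_algEquiv h' h₁'
    obtain ⟨τ₁, hτ₁, hτ⟩ := hι
    -- Both composites classify the family t, the image of t₀', so they are equal by uniqueness of
    -- classifying maps.
    have hcomm : f.comp (e : B →ₐ[K] B₁) = (e' : B' →ₐ[K] B₁').comp ι := by
      refine (h B₁' t).unique ?_ ?_
      · have : (f.comp (e : B →ₐ[K] B₁)).restrictScalars Fq =
          (f.restrictScalars Fq).comp ((e : B →ₐ[K] B₁).restrictScalars Fq) := rfl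
        rw [this, ← hM.pull_pull]
        exact hM.trans (hM.pull_equiv _ he) hf
      · have : ((e' : B' →ₐ[K] B₁').comp ι).restrictScalars Fq =
          ((e' : B' →ₐ[K] B₁').restrictScalars Fq).comp (ι.restrictScalars Fq) := rfl
        rw [this, ← hM.pull_pull]
        exact hM.trans (hM.pull_equiv _ hτ) (cov_equiv he' (cov_pull _ hτ₁) ht)
    have hfree : IsFreeOfRank (f : B₁ →+* B₁') d :=
      hd.equiv e.toRingEquiv e'.toRingEquiv fun a => DFunLike.congr_fun hcomm a
    exact hfree.hasDegree

end ModuliProblem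

/-! ### The base curve -/

section Base

/-- Étale algebras over `K[X]` are smooth curves over `K`. -/
lemma isSmoothCurve_of_etale {K : Type u} [Field K] {A : Type u} [CommRing A] [Nontrivial A]
    [Algebra K A] [Algebra K[X] A] [IsScalarTower K K[X] A] [Algebra.Etale K[X] A] :
    IsSmoothCurve K A := by
  have : Algebra.Smooth K[X] A := inferInstance
  have hX : Algebra.Smooth K K[X] :=
    { formallySmooth := inferInstance, finitePresentation := inferInstance }
  refine ⟨inferInstance, Algebra.Smooth.comp K K[X] A, fun p => ?_⟩
  have e := KaehlerDifferential.tensorKaehlerEquivOfFormallyEtale K K[X] A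
  have e' : TensorProduct K[X] A Ω[K[X]⁄K] ≃ₗ[A] A :=
    (TensorProduct.AlgebraTensorModule.congr (LinearEquiv.refl A A)
      (KaehlerDifferential.polynomialEquiv K)).trans
      (TensorProduct.AlgebraTensorModule.rid K[X] A A)
  rw [Module.rankAtStalk_eq_of_equiv (e.symm.trans e'), Module.rankAtStalk_self]
  rfl

/-- The ring `K[s, s⁻¹]`. -/
abbrev BaseRing (K : Type u) [Field K] : Type u := Localization.Away (X : K[X])

namespace BaseRing

variable (K : Type u) [Field K]

/-- The coordinate `s` of `K[s, s⁻¹]`. -/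
def s : (BaseRing K)ˣ := (IsLocalization.Away.algebraMap_isUnit (S := BaseRing K) (X : K[X])).unit

instance : Nontrivial (BaseRing K) :=
  (IsLocalization.injective (BaseRing K) (powers_le_nonZeroDivisors_of_noZeroDivisors
    (X_ne_zero (R := K)))).nontrivial

variable {K}
variable {Fq : Type v} [Field Fq] [Algebra Fq K]

lemma hom_ext {R : Type*} [CommRing R] [Algebra Fq R] {f g : BaseRing K →ₐ[Fq] R}
    (h : ∀ a, f (algebraMap K (BaseRing K) a) = g (algebraMap K (BaseRing K) a))
    (hs : f (s K) = g (s K)) : f = g := by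
  have h1 : (f : BaseRing K →+* R) = g := by
    refine IsLocalization.ringHom_ext (Submonoid.powers (X : K[X])) ?_
    refine Polynomial.ringHom_ext (fun a => ?_) hs
    simpa [IsScalarTower.algebraMap_apply K K[X] (BaseRing K)] using h a
  exact AlgHom.coe_ringHom_injective h1

lemma exists_lift {R : Type*} [CommRing R] [Algebra Fq R] (κ : K →ₐ[Fq] R) {x : R}
    (hx : IsUnit x) : ∃ f : BaseRing K →ₐ[Fq] R,
      (∀ a, f (algebraMap K (BaseRing K) a) = κ a) ∧ f (s K) = x := by
  have hx' : IsUnit (evHom κ x X) := by simpa using hx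
  have hl : ∀ p : K[X], IsLocalization.Away.lift (S := BaseRing K) X
      (g := (evHom κ x : K[X] →+* R)) hx' (algebraMap K[X] (BaseRing K) p) = evHom κ x p :=
    fun p => IsLocalization.Away.lift_eq _ _ _
  have hK : ∀ a, IsLocalization.Away.lift (S := BaseRing K) X
      (g := (evHom κ x : K[X] →+* R)) hx' (algebraMap K (BaseRing K) a) = κ a := fun a => by
    rw [IsScalarTower.algebraMap_apply K K[X] (BaseRing K), hl]
    simp
  refine ⟨{ IsLocalization.Away.lift (S := BaseRing K) X
      (g := (evHom κ x : K[X] →+* R)) hx' with commutes' := fun r => ?_ }, hK, ?_⟩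
  · rw [IsScalarTower.algebraMap_apply Fq K (BaseRing K)]
    exact (hK _).trans (κ.commutes r)
  · exact (hl X).trans (by simp)

end BaseRing

end Base

/-! ### Lawfulness of the three moduli problems -/

section CommonCover

variable {Fq : Type v} [Field Fq] {R : Type u} [CommRing R] [Algebra Fq R]
  {S : Type u} [CommRing S] [Algebra Fq S] {S' : Type u} [CommRing S'] [Algebra Fq S']

open TensorProduct in
-- The tensor product S ⊗_R S'. It makes equivalence, which is defined after a flat cover,
-- transitive and stable under base change.
lemma exists_common_cover (f : R →ₐ[Fq] S) {i : R →ₐ[Fq] S'} (hi : (i : R →+* S').FaithfullyFlat) :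
    ∃ (T : Type u) (_ : CommRing T) (_ : Algebra Fq T) (a : S →ₐ[Fq] T) (b : S' →ₐ[Fq] T),
      a.comp f = b.comp i ∧ (a : S →+* T).FaithfullyFlat := by
  let _ : Algebra R S := (f : R →+* S).toAlgebra
  let _ : Algebra R S' := (i : R →+* S').toAlgebra
  have : Module.FaithfullyFlat R S' := hi
  have : IsScalarTower Fq R S := .of_algebraMap_eq fun r => (f.commutes r).symm
  have : IsScalarTower Fq R S' := .of_algebraMap_eq fun r => (i.commutes r).symm
  let g₁ : S →ₐ[R] S ⊗[R] S' := Algebra.TensorProduct.includeLeft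
  let g₂ : S' →ₐ[R] S ⊗[R] S' := Algebra.TensorProduct.includeRight
  refine ⟨S ⊗[R] S', inferInstance, inferInstance, g₁.restrictScalars Fq, g₂.restrictScalars Fq,
    AlgHom.ext fun r => (g₁.commutes r).trans (g₂.commutes r).symm, ?_⟩
  have : (algebraMap S (S ⊗[R] S')).FaithfullyFlat := by
    rw [RingHom.faithfullyFlat_algebraMap_iff]
    infer_instance
  exact this

end CommonCover

section Lawful

variable {Fq : Type v} [Field Fq] [Fintype Fq] {j k : ℕ} {N : Fq[X]}
variable {R : Type u} [CommRing R] [Algebra Fq R] {S : Type u} [CommRing S] [Algebra Fq S]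
  {T : Type u} [CommRing T] [Algebra Fq T]

namespace DrinfeldModule

lemma map_id (φ : DrinfeldModule Fq j k R) : φ.map (AlgHom.id Fq R) = φ := by
  ext <;> simp [map]

lemma map_injective {i : R →ₐ[Fq] S} (hi : Function.Injective i) :
    Function.Injective (fun φ : DrinfeldModule Fq j k R => φ.map i) := by
  intro φ ψ h
  ext
  · exact hi (congrArg (fun ρ : DrinfeldModule Fq j k S => (ρ.gm : S)) h)
  · exact hi (congrArg DrinfeldModule.gj h)

lemma IsIsom.map {φ ψ : DrinfeldModule Fq j k R} {c : Rˣ} (h : φ.IsIsom ψ c) (f : R →ₐ[Fq] S) :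
    (φ.map f).IsIsom (ψ.map f) (Units.map (f : R →* S) c) := by
  constructor
  · simpa [DrinfeldModule.map] using congrArg f h.1
  · simpa [DrinfeldModule.map] using congrArg f h.2

lemma IsIsom.one (φ : DrinfeldModule Fq j k R) : φ.IsIsom φ 1 := by
  constructor <;> simp

lemma IsIsom.inv {φ ψ : DrinfeldModule Fq j k R} {c : Rˣ} (h : φ.IsIsom ψ c) :
    ψ.IsIsom φ c⁻¹ := by
  have key : ∀ (i : ℕ) (a b : R), (c : R) * a = b * (c : R) ^ i →
      ((c⁻¹ : Rˣ) : R) * b = a * ((c⁻¹ : Rˣ) : R) ^ i := by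
    intro i a b h
    have h1 : ((c⁻¹ : Rˣ) : R) * c = 1 := Units.inv_mul c
    have h2 : ((c⁻¹ : Rˣ) : R) ^ i * (c : R) ^ i = 1 := by rw [← mul_pow, h1, one_pow]
    generalize ((c⁻¹ : Rˣ) : R) ^ i = d at *
    generalize (c : R) ^ i = e at *
    linear_combination (-(((c⁻¹ : Rˣ) : R) * d)) * h - ((c⁻¹ : Rˣ) : R) * b * h2 + a * d * h1
  exact ⟨key _ _ _ h.1, key _ _ _ h.2⟩

lemma IsIsom.mul {φ ψ χ : DrinfeldModule Fq j k R} {c d : Rˣ} (h : φ.IsIsom ψ c)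
    (h' : ψ.IsIsom χ d) : φ.IsIsom χ (d * c) := by
  constructor
  · rw [Units.val_mul, mul_pow]
    linear_combination (d : R) * h.1 + (c : R) ^ Fintype.card Fq ^ (j + k) * h'.1
  · rw [Units.val_mul, mul_pow]
    linear_combination (d : R) * h.2 + (c : R) ^ Fintype.card Fq ^ j * h'.2

lemma IsIsom.phiT_mul {φ ψ : DrinfeldModule Fq j k R} {c : Rˣ} (h : φ.IsIsom ψ c) (z : R) :
    ψ.phiT (c * z) = c * φ.phiT z := by
  rw [phiT_apply, phiT_apply, mul_pow, mul_pow]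
  linear_combination -z ^ Fintype.card Fq ^ (j + k) * h.1 - z ^ Fintype.card Fq ^ j * h.2

lemma IsIsom.act_mul {φ ψ : DrinfeldModule Fq j k R} {c : Rˣ} (h : φ.IsIsom ψ c) (a : Fq[X])
    (z : R) : ψ.act a (c * z) = c * φ.act a z := by
  induction a using Polynomial.induction_on generalizing z with
  | C r => simp [act]
  | add p r hp hr => simp only [map_add, LinearMap.add_apply, hp, hr, mul_add]
  | monomial i r ih =>
    rw [pow_succ, ← mul_assoc, DrinfeldModule.act_mul ψ, DrinfeldModule.act_mul φ, act_X, act_X,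
      h.phiT_mul, ih]

/-- Hence the condition `normalizable` of `PtX` holds for every φ as soon as j ≥ 1. -/
lemma exists_normalized {Ω : Type u} [Field Ω] [IsAlgClosed Ω] [Algebra Fq Ω] (hj : 1 ≤ j)
    (φ : DrinfeldModule Fq j k Ω) :
    ∃ (ψ : DrinfeldModule Fq j k Ω) (c : Ωˣ), ψ.IsNormalized ∧ φ.IsIsom ψ c := by
  have hq : 1 < Fintype.card Fq ^ (j + k) := Nat.one_lt_pow (by omega) (one_lt_card Fq)
  -- The equation to solve is c g_m = -c^(q^m).
  obtain ⟨c, hc⟩ := IsAlgClosed.exists_pow_nat_eq (-(φ.gm : Ω))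
    (by omega : 0 < Fintype.card Fq ^ (j + k) - 1)
  have hc0 : c ≠ 0 := by
    rintro rfl
    rw [zero_pow (by omega), eq_comm, neg_eq_zero] at hc
    exact φ.gm.ne_zero hc
  refine ⟨⟨-1, c * φ.gj / c ^ Fintype.card Fq ^ j⟩, Units.mk0 c hc0, rfl, ?_, ?_⟩
  · rw [Units.val_mk0, ← Nat.sub_add_cancel hq.le, pow_succ, hc]
    simp [mul_comm]
  · rw [Units.val_mk0, div_mul_cancel₀ _ (pow_ne_zero _ hc0)]

end DrinfeldModule

lemma Polynomial.map_algHom_map (f : R →ₐ[Fq] S) (g : S →ₐ[Fq] T) (P : R[X]) :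
    (P.map (f : R →+* S)).map (g : S →+* T) = P.map ((g.comp f : R →ₐ[Fq] T) : R →+* T) := by
  rw [Polynomial.map_map]; rfl

lemma lawful_moduliDDot : (moduliDDot.{v, u} Fq j k N).Lawful where
  refl _ := rfl
  symm h := Eq.symm h
  trans h h' := Eq.trans h h'
  pull_id t := PtDDot.ext (DrinfeldModule.map_id _) Polynomial.map_id (Units.ext rfl)
  pull_pull f g t := PtDDot.ext (DrinfeldModule.map_map _ _ _) (Polynomial.map_algHom_map _ _ _)
    (Units.ext rfl)
  pull_equiv f _ _ h := congrArg (PtDDot.pull f) h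
  descend i t t' hi h := by
    have hi' : Function.Injective i := hi.injective
    exact PtDDot.ext (DrinfeldModule.map_injective hi' (congrArg PtDDot.φ h))
      (Polynomial.map_injective _ hi' (congrArg PtDDot.P h))
      (Units.ext (hi' (congrArg Units.val (PtDDot.ext_iff.1 h).2.2)))

lemma lawful_moduliDot : (moduliDot.{v, u} Fq j k N).Lawful where
  refl _ := rfl
  symm h := Eq.symm h
  trans h h' := Eq.trans h h'
  pull_id t := PtDot.ext (DrinfeldModule.map_id _) Polynomial.map_id
  pull_pull f g t := PtDot.ext (DrinfeldModule.map_map _ _ _) (Polynomial.map_algHom_map _ _ _)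
  pull_equiv f _ _ h := congrArg (PtDot.pull f) h
  descend i t t' hi h := by
    have hi' : Function.Injective i := hi.injective
    exact PtDot.ext (DrinfeldModule.map_injective hi' (congrArg PtDot.φ h))
      (Polynomial.map_injective _ hi' (congrArg PtDot.P h))

namespace PtX

/-- The scalar `c` is an isomorphism of pairs `(φ, G)` over the base ring itself. -/
def StrictIso (t t' : PtX Fq j k N R) (c : Rˣ) : Prop :=
  t.φ.IsIsom t'.φ c ∧
    ∀ (Ω : Type u) [Field Ω] [IsAlgClosed Ω] [Algebra Fq Ω] (s : R →ₐ[Fq] Ω) (z : Ω),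
      t.P.eval₂ (s : R →+* Ω) z = 0 ↔ t'.P.eval₂ (s : R →+* Ω) (s c * z) = 0

lemma equivalent_iff (t t' : PtX Fq j k N R) : t.Equivalent t' ↔
    ∃ (S : Type u) (_ : CommRing S) (_ : Algebra Fq S) (i : R →ₐ[Fq] S) (c : Sˣ),
      (i : R →+* S).FaithfullyFlat ∧ (t.pull i).StrictIso (t'.pull i) c := by
  have key : ∀ {S : Type u} [CommRing S] [Algebra Fq S] {Ω : Type u} [Field Ω] [Algebra Fq Ω]
      (i : R →ₐ[Fq] S) (s : S →ₐ[Fq] Ω) (P : R[X]) (z : Ω),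
      (P.map (i : R →+* S)).eval₂ (s : S →+* Ω) z =
        P.eval₂ ((s.comp i : R →ₐ[Fq] Ω) : R →+* Ω) z := fun i s P z => by
    rw [eval₂_map]; rfl
  constructor
  · rintro ⟨S, _, _, i, c, hi, h, h'⟩
    refine ⟨S, _, _, i, c, hi, h, fun Ω _ _ _ s z => ?_⟩
    change (t.P.map (i : R →+* S)).eval₂ _ _ = 0 ↔ (t'.P.map (i : R →+* S)).eval₂ _ _ = 0
    rw [key, key]
    exact h' Ω s z
  · rintro ⟨S, _, _, i, c, hi, h, h'⟩
    refine ⟨S, _, _, i, c, hi, h, fun Ω _ _ _ s z => ?_⟩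
    rw [← key, ← key]
    exact h' Ω s z

lemma StrictIso.pull {t t' : PtX Fq j k N R} {c : Rˣ} (h : t.StrictIso t' c) (f : R →ₐ[Fq] S) :
    (t.pull f).StrictIso (t'.pull f) (Units.map (f : R →* S) c) := by
  refine ⟨h.1.map f, fun Ω _ _ _ s z => ?_⟩
  change (t.P.map (f : R →+* S)).eval₂ _ _ = 0 ↔ (t'.P.map (f : R →+* S)).eval₂ _ _ = 0
  rw [eval₂_map, eval₂_map]
  exact h.2 Ω (s.comp f) z

lemma StrictIso.one (t : PtX Fq j k N R) : t.StrictIso t 1 :=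
  ⟨.one _, fun Ω _ _ _ s z => by simp⟩

lemma StrictIso.inv {t t' : PtX Fq j k N R} {c : Rˣ} (h : t.StrictIso t' c) :
    t'.StrictIso t c⁻¹ := by
  refine ⟨h.1.inv, fun Ω _ _ _ s z => ?_⟩
  rw [h.2 Ω s, ← mul_assoc, ← map_mul, Units.mul_inv, map_one, one_mul]

lemma StrictIso.mul {t t' t'' : PtX Fq j k N R} {c d : Rˣ} (h : t.StrictIso t' c)
    (h' : t'.StrictIso t'' d) : t.StrictIso t'' (d * c) := by
  refine ⟨h.1.mul h'.1, fun Ω _ _ _ s z => ?_⟩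
  rw [h.2 Ω s, h'.2 Ω s, Units.val_mul, map_mul, mul_assoc]

lemma pull_pull (f : R →ₐ[Fq] S) (g : S →ₐ[Fq] T) (t : PtX Fq j k N R) :
    (t.pull f).pull g = t.pull (g.comp f) :=
  PtX.ext (DrinfeldModule.map_map _ _ _) (Polynomial.map_algHom_map _ _ _)

namespace Equivalent

lemma refl (t : PtX Fq j k N R) : t.Equivalent t :=
  (equivalent_iff t t).2
    ⟨R, _, _, AlgHom.id Fq R, 1, .of_bijective Function.bijective_id, .one _⟩

lemma symm {t t' : PtX Fq j k N R} (h : t.Equivalent t') : t'.Equivalent t := by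
  obtain ⟨S, _, _, i, c, hi, h⟩ := (equivalent_iff t t').1 h
  exact (equivalent_iff t' t).2 ⟨S, _, _, i, c⁻¹, hi, h.inv⟩

lemma trans {t t' t'' : PtX Fq j k N R} (h : t.Equivalent t') (h' : t'.Equivalent t'') :
    t.Equivalent t'' := by
  obtain ⟨S, _, _, i, c, hi, h⟩ := (equivalent_iff t t').1 h
  obtain ⟨S', _, _, i', c', hi', h'⟩ := (equivalent_iff t' t'').1 h'
  obtain ⟨T, _, _, a, b, hab, ha⟩ := exists_common_cover i hi'
  have h1 := h.pull a
  have h2 := h'.pull b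
  rw [pull_pull, pull_pull] at h1 h2
  rw [← hab] at h2
  exact (equivalent_iff t t'').2 ⟨T, _, _, a.comp i, _,
    RingHom.FaithfullyFlat.stableUnderComposition _ _ hi ha, h1.mul h2⟩

lemma pull (f : R →ₐ[Fq] S) {t t' : PtX Fq j k N R} (h : t.Equivalent t') :
    (t.pull f).Equivalent (t'.pull f) := by
  obtain ⟨S', _, _, i, c, hi, h⟩ := (equivalent_iff t t').1 h
  obtain ⟨T, _, _, a, b, hab, ha⟩ := exists_common_cover f hi
  have h1 := h.pull b
  rw [pull_pull, pull_pull, ← hab, ← pull_pull, ← pull_pull] at h1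
  exact (equivalent_iff (t.pull f) (t'.pull f)).2 ⟨T, _, _, a, _, ha, h1⟩

lemma descend (i : R →ₐ[Fq] S) {t t' : PtX Fq j k N R} (hi : (i : R →+* S).FaithfullyFlat)
    (h : (t.pull i).Equivalent (t'.pull i)) : t.Equivalent t' := by
  obtain ⟨S', _, _, i', c, hi', h⟩ := (equivalent_iff (t.pull i) (t'.pull i)).1 h
  rw [pull_pull, pull_pull] at h
  exact (equivalent_iff t t').2 ⟨S', _, _, i'.comp i, c,
    RingHom.FaithfullyFlat.stableUnderComposition _ _ hi hi', h⟩

end Equivalent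

end PtX

lemma lawful_moduliX : (moduliX.{v, u} Fq j k N).Lawful where
  refl t := PtX.Equivalent.refl t
  symm h := PtX.Equivalent.symm h
  trans h h' := PtX.Equivalent.trans h h'
  pull_id _ := PtX.ext (DrinfeldModule.map_id _) Polynomial.map_id
  pull_pull f g t := PtX.pull_pull f g t
  pull_equiv f _ _ h := PtX.Equivalent.pull f h
  descend i _ _ hi h := PtX.Equivalent.descend i hi h

/-! ### The covering relations -/

section Covers

variable {n : ℕ}

lemma PtDDot.exists_covers (hj : 1 ≤ j) (hk : 1 ≤ k) (t : PtDDot Fq j k (X ^ (n + 2)) R) :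
    ∃ t' : PtDDot Fq j k (X ^ (n + 1)) R, t.Covers t' := by
  obtain ⟨Q, hQ, h, hx⟩ := t.level.exists_image hj hk
  exact ⟨⟨t.φ, Q, t.x, t.normalized, hQ, hx _ t.x.isUnit t.mem t.torsion, t.torsion⟩, rfl, h, rfl⟩

lemma PtDot.exists_covers (hj : 1 ≤ j) (hk : 1 ≤ k) (t : PtDot Fq j k (X ^ (n + 2)) R) :
    ∃ t' : PtDot Fq j k (X ^ (n + 1)) R, t.Covers t' := by
  obtain ⟨Q, hQ, h, -⟩ := t.level.exists_image hj hk
  exact ⟨⟨t.φ, Q, t.normalized, hQ⟩, rfl, h⟩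

lemma PtX.exists_covers (hj : 1 ≤ j) (hk : 1 ≤ k) (t : PtX Fq j k (X ^ (n + 2)) R) :
    ∃ t' : PtX Fq j k (X ^ (n + 1)) R, t.Covers t' := by
  obtain ⟨Q, hQ, h, -⟩ := t.level.exists_image hj hk
  exact ⟨⟨t.φ, Q, t.normalizable, hQ⟩, rfl, h⟩

variable {N' : Fq[X]}

lemma PtDDot.Covers.pull (f : R →ₐ[Fq] S) {t : PtDDot Fq j k N' R} {t' : PtDDot Fq j k N R}
    (h : t.Covers t') : (t.pull f).Covers (t'.pull f) :=
  ⟨congrArg (DrinfeldModule.map · f) h.1, h.2.1.map f, congrArg (Units.map (f : R →* S)) h.2.2⟩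

lemma PtDot.Covers.pull (f : R →ₐ[Fq] S) {t : PtDot Fq j k N' R} {t' : PtDot Fq j k N R}
    (h : t.Covers t') : (t.pull f).Covers (t'.pull f) :=
  ⟨congrArg (DrinfeldModule.map · f) h.1, h.2.map f⟩

lemma PtX.Covers.pull (f : R →ₐ[Fq] S) {t : PtX Fq j k N' R} {t' : PtX Fq j k N R}
    (h : t.Covers t') : (t.pull f).Covers (t'.pull f) :=
  ⟨congrArg (DrinfeldModule.map · f) h.1, h.2.map f⟩

lemma PtDDot.Covers.unique (hj : 1 ≤ j) {t : PtDDot Fq j k N' R} {t₁ t₂ : PtDDot Fq j k (X ^ n) R}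
    (h₁ : t.Covers t₁) (h₂ : t.Covers t₂) : t₁ = t₂ :=
  PtDDot.ext (h₁.1.trans h₂.1.symm) (DrinfeldModule.IsImage.unique hj t₁.level.1 t₂.level.1
    (h₁.1 ▸ t₁.level.2.1) (h₂.1 ▸ t₂.level.2.1) h₁.2.1 h₂.2.1) (h₁.2.2.trans h₂.2.2.symm)

lemma PtDot.Covers.unique (hj : 1 ≤ j) {t : PtDot Fq j k N' R} {t₁ t₂ : PtDot Fq j k (X ^ n) R}
    (h₁ : t.Covers t₁) (h₂ : t.Covers t₂) : t₁ = t₂ :=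
  PtDot.ext (h₁.1.trans h₂.1.symm) (DrinfeldModule.IsImage.unique hj t₁.level.1 t₂.level.1
    (h₁.1 ▸ t₁.level.2.1) (h₂.1 ▸ t₂.level.2.1) h₁.2 h₂.2)

lemma PtX.Covers.strictIso {t s : PtX Fq j k N' R} {t₁ s₁ : PtX Fq j k N R} {c : Rˣ}
    (ht : t.Covers t₁) (h : t.StrictIso s c) (hs : s.Covers s₁) : t₁.StrictIso s₁ c := by
  refine ⟨by rw [ht.1, hs.1]; exact h.1, fun Ω _ _ _ f z => ?_⟩
  have hc : (f c : Ω) ≠ 0 := (c.isUnit.map f).ne_zero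
  have hiso := h.1.map f
  rw [ht.2 Ω f, hs.2 Ω f]
  constructor
  · rintro ⟨w, hw, rfl⟩
    exact ⟨f c * w, (h.2 Ω f w).1 hw, hiso.phiT_mul w⟩
  · rintro ⟨w, hw, hwz⟩
    obtain ⟨w, rfl⟩ : ∃ w', w = f c * w' := ⟨(f c)⁻¹ * w, by rw [mul_inv_cancel_left₀ hc]⟩
    exact ⟨w, (h.2 Ω f w).2 hw, mul_left_cancel₀ hc ((hiso.phiT_mul w).symm.trans hwz)⟩

lemma PtX.Covers.equivalent {t s : PtX Fq j k N' R} {t₁ s₁ : PtX Fq j k N R}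
    (h : t.Equivalent s) (ht : t.Covers t₁) (hs : s.Covers s₁) : t₁.Equivalent s₁ := by
  obtain ⟨S, _, _, i, c, hi, h⟩ := (PtX.equivalent_iff t s).1 h
  exact (PtX.equivalent_iff t₁ s₁).2 ⟨S, _, _, i, c, hi, (ht.pull i).strictIso h (hs.pull i)⟩

end Covers

end Lawful

/-! ### Towers over the base curve -/

namespace DrinfeldModule

variable {Fq : Type v} [Field Fq] [Fintype Fq] {j k : ℕ}

section OfLine

variable {R : Type u} [CommRing R] [Algebra Fq R] {S : Type u} [CommRing S] [Algebra Fq S]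

variable (Fq j k) in
/-- The Drinfeld module with leading coefficient `γ` and with `Y ^ q - μ Y` in the kernel of
`φ_T`. -/
def ofLine (γ μ : Rˣ) : DrinfeldModule Fq j k R where
  gm := γ
  gj := -(1 + γ * (μ : R) ^ geomExp Fq (j + k)) * ((μ⁻¹ : Rˣ) : R) ^ geomExp Fq j

lemma lineValue_ofLine (γ μ : Rˣ) : (ofLine Fq j k γ μ).lineValue (μ : R) = 0 := by
  have h : ((μ⁻¹ : Rˣ) : R) ^ geomExp Fq j * (μ : R) ^ geomExp Fq j = 1 := by
    rw [← mul_pow, Units.inv_mul, one_pow]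
  rw [lineValue, ofLine]
  linear_combination (-(1 + γ * (μ : R) ^ geomExp Fq (j + k))) * h

/-- `lineValue μ` is affine in g_j with the unit μ^(1 + q + ⋯ + q^(j-1)) as coefficient, so g_m and
the line determine g_j. -/
lemma eq_of_lineValue_eq_zero {φ ψ : DrinfeldModule Fq j k R} {μ : R} (hμ : IsUnit μ)
    (h : φ.gm = ψ.gm) (hφ : φ.lineValue μ = 0) (hψ : ψ.lineValue μ = 0) : φ = ψ := by
  ext
  · rw [h]
  · refine (hμ.pow (geomExp Fq j)).mul_left_injective ?_
    rw [lineValue, h] at hφ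
    rw [lineValue] at hψ
    dsimp only
    linear_combination hφ - hψ

lemma exists_isIsom (φ : DrinfeldModule Fq j k R) (c : Rˣ) :
    ∃ ψ : DrinfeldModule Fq j k R, ψ.IsIsom φ c := by
  refine ⟨⟨c⁻¹ * φ.gm * c ^ Fintype.card Fq ^ (j + k),
    ((c⁻¹ : Rˣ) : R) * φ.gj * (c : R) ^ Fintype.card Fq ^ j⟩, ?_, ?_⟩
  · simp [← mul_assoc]
  · simp [← mul_assoc]

end OfLine

namespace Tower

section Curve

variable {K : Type u} [Field K] [Algebra Fq K] {φ₁ : DrinfeldModule Fq j k (BaseRing K)}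
  {u : (BaseRing K)ˣ} {n : ℕ}

instance (t : Tower Fq φ₁ u n) : Algebra K t.A :=
  ((algebraMap (BaseRing K) t.A).comp (algebraMap K (BaseRing K))).toAlgebra

instance (t : Tower Fq φ₁ u n) : IsScalarTower K (BaseRing K) t.A := .of_algebraMap_eq fun _ => rfl

instance (t : Tower Fq φ₁ u n) : IsScalarTower Fq K t.A := .of_algebraMap_eq fun r => by
  rw [IsScalarTower.algebraMap_apply K (BaseRing K) t.A, ← IsScalarTower.algebraMap_apply Fq K,
    ← IsScalarTower.algebraMap_apply Fq (BaseRing K) t.A]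

/-- The tower is étale over K[s, 1/s], hence étale over K[s]. -/
lemma isSmoothCurve (t : Tower Fq φ₁ u n) [Nontrivial t.A] : IsSmoothCurve K t.A := by
  let _ : Algebra K[X] t.A :=
    ((algebraMap (BaseRing K) t.A).comp (algebraMap K[X] (BaseRing K))).toAlgebra
  have : IsScalarTower K[X] (BaseRing K) t.A := .of_algebraMap_eq fun _ => rfl
  have : IsScalarTower K K[X] t.A := .of_algebraMap_eq fun r => by
    rw [IsScalarTower.algebraMap_apply K (BaseRing K) t.A,
      IsScalarTower.algebraMap_apply K[X] (BaseRing K) t.A, ← IsScalarTower.algebraMap_apply K K[X]]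
  have := t.etale
  have : Algebra.Etale K[X] (BaseRing K) := .of_isLocalizationAway (X : K[X])
  have : Algebra.Etale K[X] t.A := .comp K[X] (BaseRing K) t.A
  exact isSmoothCurve_of_etale

/-- The Drinfeld module over a tower. -/
abbrev module (t : Tower Fq φ₁ u n) : DrinfeldModule Fq j k t.A :=
  φ₁.map (IsScalarTower.toAlgHom Fq (BaseRing K) t.A)

/-- The coordinate of the base curve. -/
def s (t : Tower Fq φ₁ u n) : t.Aˣ :=
  Units.map (algebraMap (BaseRing K) t.A : BaseRing K →* t.A) (BaseRing.s K)

section Ext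

variable (t : Tower Fq φ₁ u n) {R : Type u} [CommRing R] [Algebra Fq R] {f g : t.A →ₐ[Fq] R}
  (h : ∀ a, f (algebraMap K t.A a) = g (algebraMap K t.A a)) (hs : f t.s = g t.s)
include h hs

lemma comp_toAlgHom_eq : f.comp (IsScalarTower.toAlgHom Fq (BaseRing K) t.A) =
    g.comp (IsScalarTower.toAlgHom Fq (BaseRing K) t.A) :=
  BaseRing.hom_ext h hs

lemma module_map_eq : t.module.map f = t.module.map g := by
  rw [module, map_map, map_map, t.comp_toAlgHom_eq h hs]

lemma algHom_ext (hP : t.st.P.map (f : t.A →+* R) = t.st.P.map (g : t.A →+* R)) : f = g :=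
  t.hom_ext R f g (DFunLike.congr_fun (t.comp_toAlgHom_eq h hs)) hP

end Ext

/-- The local existence step common to the three problems: a generator y of a level structure and a
value s' of the coordinate give a map out of the tower, provided that s ↦ s' sends γ to g_m and μ to
the parameter of the line through φ_{T^n}(y). -/
theorem exists_algHom {γ μ : (BaseRing K)ˣ} (t : Tower Fq (ofLine Fq j k γ μ) μ n)
    {S : Type u} [CommRing S] [Algebra Fq S] (κ : K →ₐ[Fq] S) {ψ : DrinfeldModule Fq j k S} {y : S}
    (hu : IsUnit (ψ.act (X ^ n) y)) (hT : ψ.phiT (ψ.act (X ^ n) y) = 0) {s' : S}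
    (hs' : IsUnit s') (hγ : ∀ f : BaseRing K →ₐ[Fq] S, f (BaseRing.s K) = s' → f γ = ψ.gm)
    (hμ : ∀ f : BaseRing K →ₐ[Fq] S, f (BaseRing.s K) = s' →
      f μ = ψ.act (X ^ n) y ^ (Fintype.card Fq - 1)) :
    ∃ f : t.A →ₐ[Fq] S, (∀ a, f (algebraMap K t.A a) = κ a) ∧ f t.s = s' ∧ t.module.map f = ψ ∧
      t.st.P.eval₂ (f : t.A →+* S) y = 0 := by
  obtain ⟨f₁, hK, hs⟩ := BaseRing.exists_lift κ hs'
  have hψ : (ofLine Fq j k γ μ).map f₁ = ψ := by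
    refine eq_of_lineValue_eq_zero (μ := f₁ μ) (μ.isUnit.map f₁) (Units.ext (hγ f₁ hs)) ?_ ?_
    · rw [map_lineValue, lineValue_ofLine, map_zero]
    · rw [hμ f₁ hs, lineValue_eq_zero ψ hu hT]
  obtain ⟨f, hf, hy⟩ := t.exists_lift S f₁ y _ hu (by rw [hψ]) (hμ f₁ hs).symm
  refine ⟨f, fun a => (hf _).trans (hK a), (hf _).trans hs, ?_, hy⟩
  rw [module, map_map, ← hψ]
  congr 1
  exact AlgHom.ext hf

/-- Passage from universal families over towers to the moduli curves and their morphisms. -/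
theorem hasModuliCurve_and_inducesDegree (hj : 1 ≤ j) (hk : 1 ≤ k)
    (hu : φ₁.lineValue (u : BaseRing K) = 0) {M M' : ModuliProblem.{v, u} Fq} (hM : M.Lawful)
    (hM' : M'.Lawful) (pt : ∀ t : Tower Fq φ₁ u n, M.Pt t.A)
    (pt' : ∀ t : Tower Fq φ₁ u (n + 1), M'.Pt t.A)
    (hpt : ∀ t, Parametrizes K M t.A (pt t)) (hpt' : ∀ t, Parametrizes K M' t.A (pt' t))
    (cov : ∀ {R : Type u} [CommRing R] [Algebra Fq R], M'.Pt R → M.Pt R → Prop)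
    (exists_cov : ∀ {R : Type u} [CommRing R] [Algebra Fq R] (t' : M'.Pt R), ∃ t, cov t' t)
    (cov_pull : ∀ {R : Type u} [CommRing R] [Algebra Fq R] {S : Type u} [CommRing S] [Algebra Fq S]
      (f : R →ₐ[Fq] S) {t' : M'.Pt R} {t : M.Pt R}, cov t' t → cov (M'.pull f t') (M.pull f t))
    (cov_equiv : ∀ {R : Type u} [CommRing R] [Algebra Fq R] {t' s' : M'.Pt R} {t s : M.Pt R},
      M'.equiv t' s' → cov t' t → cov s' s → M.equiv t s)
    (cov_pt : ∀ (t : Tower Fq φ₁ u n) (t' : Tower Fq φ₁ u (n + 1)) (i : t.A →ₐ[Fq] t'.A),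
      t.module.map i = t'.module → i t.s = t'.s →
      t'.module.IsImage t'.st.P (t.st.P.map (i : t.A →+* t'.A)) →
      cov (pt' t') (M.pull i (pt t))) :
    HasModuliCurve K M ∧ InducesDegree K M' M cov (Fintype.card Fq ^ (j + k - 1)) := by
  obtain ⟨t, ht⟩ := exists_nontrivial (n := n) hj hk hu
  have ht := ht inferInstance
  refine ⟨⟨t.A, _, _, _, inferInstance, pt t, t.isSmoothCurve, hpt t⟩, ?_⟩
  obtain ⟨t', i, hi, hP, hfree⟩ := t.exists_next hj hk
  refine hM.inducesDegree hM' cov exists_cov cov_pull cov_equiv (hpt t) (hpt' t')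
    ({ i with commutes' := fun a => hi _ } : t.A →ₐ[K] t'.A)
    ⟨M.pull i (pt t), cov_pt t t' i ?_ (hi _) (hP ▸ t'.st.isImage hj), hM.refl _⟩ (hfree ht)
  rw [module, map_map]
  congr 1
  exact AlgHom.ext hi

end Curve

end Tower

end DrinfeldModule

/-! ### The universal families -/

namespace DrinfeldModule

variable {Fq : Type v} [Field Fq] [Fintype Fq] {j k : ℕ} {n : ℕ}

section General

variable {R : Type u} [CommRing R] [Algebra Fq R] {S : Type u} [CommRing S] [Algebra Fq S]

lemma IsNormalized.coe_gm {φ : DrinfeldModule Fq j k R} (h : φ.IsNormalized) :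
    (φ.gm : R) = -1 := by
  rw [show φ.gm = -1 from h, Units.val_neg, Units.val_one]

lemma IsNormalized.map {φ : DrinfeldModule Fq j k R} (h : φ.IsNormalized) (f : R →ₐ[Fq] S) :
    (φ.map f).IsNormalized :=
  Units.ext (by
    change f φ.gm = _
    rw [h.coe_gm, map_neg, map_one, Units.val_neg, Units.val_one])

lemma isNormalized_ofLine (μ : Rˣ) : (ofLine Fq j k (-1) μ).IsNormalized := rfl

lemma eval₂_eq_zero_of_eval {P : R[X]} {y : R} (h : P.eval y = 0) (s : R →ₐ[Fq] S) :
    P.eval₂ (s : R →+* S) (s y) = 0 := by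
  have := Polynomial.eval₂_at_apply (p := P) (s : R →+* S) y
  rw [h, map_zero] at this
  exact this

lemma IsLevel.eval₂_act {φ : DrinfeldModule Fq j k R} {N : Fq[X]} {P : R[X]} (h : φ.IsLevel N P)
    {y : R} (hy : P.eval y = 0) (a : Fq[X]) {Ω : Type u} [Field Ω] [IsAlgClosed Ω] [Algebra Fq Ω]
    (s : R →ₐ[Fq] Ω) : P.eval₂ (s : R →+* Ω) (s (φ.act a y)) = 0 := by
  rw [map_act]
  exact h.act_mem s (eval₂_eq_zero_of_eval hy s) a

end General

namespace Tower

variable {K : Type u} [Field K] [Algebra Fq K] {γ μ : (BaseRing K)ˣ}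

lemma lineValue_module (t : Tower Fq (ofLine Fq j k γ μ) μ n) :
    t.module.lineValue (algebraMap (BaseRing K) t.A μ) = 0 := by
  have h := map_lineValue (ofLine Fq j k γ μ) (IsScalarTower.toAlgHom Fq (BaseRing K) t.A) μ
  rw [lineValue_ofLine, map_zero] at h
  exact h

lemma isLevel (hj : 1 ≤ j) (t : Tower Fq (ofLine Fq j k γ μ) μ n) :
    t.module.IsLevel (X ^ (n + 1)) t.st.P := t.st.isLevel hj

end Tower

end DrinfeldModule

open DrinfeldModule

variable {Fq : Type v} [Field Fq] [Fintype Fq] {j k n : ℕ} {K : Type u} [Field K] [Algebra Fq K]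

section DDot

variable (Fq K) in
/-- The parameter `μ = s ^ (q - 1)`, for which the line is generated by `s`. -/
abbrev lineDDot : (BaseRing K)ˣ := BaseRing.s K ^ (Fintype.card Fq - 1)

/-- The universal triple `(φ, G, x)`. -/
def PtDDot.univ (hj : 1 ≤ j) (t : Tower Fq (ofLine Fq j k (-1) (lineDDot Fq K)) (lineDDot Fq K) n) :
    PtDDot Fq j k (X ^ (n + 1)) t.A where
  φ := t.module
  P := t.st.P
  x := t.s
  normalized := (isNormalized_ofLine _).map _
  level := t.isLevel hj
  mem := by
    refine t.line_mem t.A (AlgHom.id Fq t.A) t.s ?_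
    rw [← mul_pow_card_sub_one Fq, mul_comm]
    simp [Tower.s]
  torsion := by
    rw [← mul_lineValue]
    have h := t.lineValue_module
    rw [Units.val_pow_eq_pow_val, map_pow] at h
    exact mul_eq_zero_of_right _ h

/-- The coordinate s is the marked point x itself. It has the same (q-1)-st power as φ_{T^n}(y) for
a local generator y, so it prescribes the right line. -/
theorem PtDDot.parametrizes_univ (hj : 1 ≤ j) (hk : 1 ≤ k)
    (t : Tower Fq (ofLine Fq j k (-1) (lineDDot Fq K)) (lineDDot Fq K) n) :
    Parametrizes K (moduliDDot Fq j k (X ^ (n + 1))) t.A (PtDDot.univ hj t) := by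
  refine lawful_moduliDDot.parametrizes t.A (PtDDot.univ hj t) (fun R _ _ f g hK h => ?_)
    fun R _ _ _ _ p => ?_
  · exact t.algHom_ext hK (congrArg Units.val (PtDDot.ext_iff.1 h).2.2) (PtDDot.ext_iff.1 h).2.1
  · obtain ⟨S, _, _, i, y, hi, hy, hu, -⟩ := p.level.exists_cover
    have hl := p.level.map i
    have hp := (p.pull i).torsion
    have hx := hl.pow_eq_pow hj hk hu (p.x.isUnit.map i) (fun Ω _ _ _ s =>
      ⟨hl.eval₂_act hy _ s, eval₂_eq_zero_of_eval (p.pull i).mem s⟩) (hl.phiT_act hy) hp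
    obtain ⟨f, hfK, hfs, hfφ, hfy⟩ := t.exists_algHom (i.comp (IsScalarTower.toAlgHom Fq K R)) hu
      (hl.phiT_act hy) (p.x.isUnit.map i)
      (fun f₁ _ => by rw [(p.normalized.map i).coe_gm]; simp)
      (fun f₁ h₁ => by rw [hx, Units.val_pow_eq_pow_val, map_pow, h₁])
    refine ⟨S, _, _, i, f, hi, hfK, PtDDot.ext hfφ ?_ (Units.ext hfs)⟩
    have hlf := (t.isLevel hj).map f
    rw [hfφ] at hlf
    exact hlf.eq_of_generator hj hl (by rw [eval_map]; exact hfy) hy hu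

end DDot

section Dot

/-- The universal pair `(φ, G)` with `φ` normalized. -/
def PtDot.univ (hj : 1 ≤ j) (t : Tower Fq (ofLine Fq j k (-1) (BaseRing.s K)) (BaseRing.s K) n) :
    PtDot Fq j k (X ^ (n + 1)) t.A where
  φ := t.module
  P := t.st.P
  normalized := (isNormalized_ofLine _).map _
  level := t.isLevel hj

/-- Here s is the parameter of the line G ∩ Ker φ_T. It is recovered from (φ, G): for a local
generator y, the unit w = φ_{T^n}(y) satisfies w^q = s w. -/
theorem PtDot.parametrizes_univ (hj : 1 ≤ j)
    (t : Tower Fq (ofLine Fq j k (-1) (BaseRing.s K)) (BaseRing.s K) n) :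
    Parametrizes K (moduliDot Fq j k (X ^ (n + 1))) t.A (PtDot.univ hj t) := by
  refine lawful_moduliDot.parametrizes t.A (PtDot.univ hj t) (fun R _ _ f g hK h => ?_)
    fun R _ _ _ _ p => ?_
  · have hP : t.st.P.map (f : t.A →+* R) = t.st.P.map (g : t.A →+* R) := (PtDot.ext_iff.1 h).2
    have hφ : t.module.map f = t.module.map g := (PtDot.ext_iff.1 h).1
    obtain ⟨S, _, _, i, y, hi, hy, hu, -⟩ := ((t.isLevel hj).map f).exists_cover
    refine t.algHom_ext hK (hi.injective ?_) hP
    have hy₁ : ∀ h : t.A →ₐ[Fq] R, (t.st.P.map (h : t.A →+* R)).map (i : R →+* S) =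
        t.st.P.map ((i.comp h : t.A →ₐ[Fq] S) : t.A →+* S) := fun h => map_algHom_map h i _
    have hF := t.act_pow S (i.comp f) y (by rw [← eval_map, ← hy₁]; exact hy)
    have hG := t.act_pow S (i.comp g) y (by rw [← eval_map, ← hy₁, ← hP]; exact hy)
    have e : t.module.map (i.comp f) = t.module.map (i.comp g) := by
      rw [← DrinfeldModule.map_map, ← DrinfeldModule.map_map, hφ]
    rw [DrinfeldModule.map_map] at hu
    change (t.module.map _).act _ _ ^ _ = _ * (t.module.map _).act _ _ at hF hG
    rw [← e, hF] at hG
    exact hu.mul_left_injective hG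
  · obtain ⟨S, _, _, i, y, hi, hy, hu, -⟩ := p.level.exists_cover
    have hl := p.level.map i
    obtain ⟨f, hfK, hfs, hfφ, hfy⟩ := t.exists_algHom (i.comp (IsScalarTower.toAlgHom Fq K R)) hu
      (hl.phiT_act hy) (hu.pow (Fintype.card Fq - 1))
      (fun f₁ _ => by rw [(p.normalized.map i).coe_gm]; simp) (fun f₁ h₁ => h₁)
    refine ⟨S, _, _, i, f, hi, hfK, PtDot.ext hfφ ?_⟩
    have hlf := (t.isLevel hj).map f
    rw [hfφ] at hlf
    exact hlf.eq_of_generator hj hl (by rw [eval_map]; exact hfy) hy hu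

end Dot

section X

/-- The universal pair `(φ, G)` up to isomorphism. -/
def PtX.univ (hj : 1 ≤ j) (t : Tower Fq (ofLine Fq j k (BaseRing.s K) 1) (1 : (BaseRing K)ˣ) n) :
    PtX Fq j k (X ^ (n + 1)) t.A where
  φ := t.module
  P := t.st.P
  normalizable _ _ _ _ _ := exists_normalized hj _
  level := t.isLevel hj

variable {N : Fq[X]} {R : Type u} [CommRing R] [Algebra Fq R]

lemma PtX.StrictIso.equivalent {t t' : PtX Fq j k N R} {c : Rˣ} (h : t.StrictIso t' c) :
    t.Equivalent t' :=
  (equivalent_iff t t').2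
    ⟨R, _, _, AlgHom.id Fq R, _, .of_bijective Function.bijective_id, h.pull _⟩

/-- Isomorphic pull-backs of the universal pair come from the same map. -/
lemma PtX.eq_of_strictIso (hj : 1 ≤ j) (hk : 1 ≤ k)
    (t : Tower Fq (ofLine Fq j k (BaseRing.s K) 1) (1 : (BaseRing K)ˣ) n) {f g : t.A →ₐ[Fq] R}
    (hK : ∀ a, f (algebraMap K t.A a) = g (algebraMap K t.A a)) {c : Rˣ}
    (h : ((PtX.univ hj t).pull f).StrictIso ((PtX.univ hj t).pull g) c) : f = g := by
  have hone : ∀ {S : Type u} [CommRing S] [Algebra Fq S] (f : t.A →ₐ[Fq] S),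
      t.st.P.eval₂ (f : t.A →+* S) 1 = 0 := fun f => t.line_mem _ f 1 (by simp)
  have hT : ∀ f : t.A →ₐ[Fq] R, (t.module.map f).phiT 1 = 0 := fun f => by
    have h1 := t.lineValue_module
    rw [Units.val_one, map_one] at h1
    have h2 := map_phiT t.module f 1
    rw [← mul_lineValue, one_pow, h1, mul_zero, map_zero, map_one] at h2
    exact h2.symm
  have hP : ∀ (Ω : Type u) [Field Ω] [IsAlgClosed Ω] [Algebra Fq Ω] (s : R →ₐ[Fq] Ω) (z : Ω),
      (t.st.P.map (f : t.A →+* R)).eval₂ (s : R →+* Ω) z = 0 ↔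
        (t.st.P.map (g : t.A →+* R)).eval₂ (s : R →+* Ω) (s c * z) = 0 := h.2
  have hiso : (t.module.map f).IsIsom (t.module.map g) c := h.1
  have hlev := fun f : t.A →ₐ[Fq] R => (t.isLevel hj).map f
  -- The point 1 is T-torsion in both groups, and c carries it to c, so c^(q-1) = 1. Such a scalar
  -- changes neither g_m nor, by P(c z) = c P(z), the zeros of P.
  have hc : (c : R) ^ (Fintype.card Fq - 1) = 1 ^ (Fintype.card Fq - 1) := by
    refine (hlev g).pow_eq_pow hj hk c.isUnit isUnit_one (fun Ω _ _ _ s => ?_) ?_ (hT g)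
    · have h1 : ∀ f : t.A →ₐ[Fq] R, (t.st.P.map (f : t.A →+* R)).eval₂ (s : R →+* Ω) 1 = 0 :=
        fun f => by
          rw [eval₂_map]
          exact hone (s.comp f)
      refine ⟨?_, by rw [map_one]; exact h1 g⟩
      have h2 := (hP Ω s 1).1 (h1 f)
      rwa [mul_one] at h2
    · have h1 := hiso.phiT_mul 1
      rwa [hT f, mul_zero, mul_one] at h1
  have hc' : (c : R) ^ Fintype.card Fq = c := by
    rw [← mul_pow_card_sub_one Fq, hc, one_pow, mul_one]
  have hs : f t.s = g t.s := by
    have h1 := hiso.1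
    rw [pow_card_pow_of_pow_card Fq hc', mul_comm] at h1
    exact c.isUnit.mul_left_injective h1
  refine t.algHom_ext hK hs ?_
  refine eq_of_geometric (Fq := Fq) (derivative_poly (t.module.map f) hj (n + 1)) (hlev f).2.1 ?_
    (hlev f).1 (hlev g).1 fun Ω _ _ _ s z => ?_
  · rw [t.module_map_eq hK hs]
    exact (hlev g).2.1
  · rw [hP Ω s z, eval₂_map]
    have h1 := t.st.mul (s.comp g) (s c) z (by rw [← map_pow, hc'])
    have h2 : t.st.P.eval₂ ((s : R →+* Ω).comp (g : t.A →+* R)) (s c * z) =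
      s c * t.st.P.eval₂ ((s : R →+* Ω).comp (g : t.A →+* R)) z := h1
    rw [h2, (c.isUnit.map s).mul_right_eq_zero, eval₂_map]

/-- Locally a generator can be rescaled so that φ_{T^n}(y) = 1. The line becomes Y^q - Y, and g_m is
the only remaining coordinate. -/
theorem PtX.parametrizes_univ (hj : 1 ≤ j) (hk : 1 ≤ k)
    (t : Tower Fq (ofLine Fq j k (BaseRing.s K) 1) (1 : (BaseRing K)ˣ) n) :
    Parametrizes K (moduliX Fq j k (X ^ (n + 1))) t.A (PtX.univ hj t) := by
  refine lawful_moduliX.parametrizes t.A (PtX.univ hj t) (fun R _ _ f g hK h => ?_)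
    fun R _ _ _ _ p => ?_
  · obtain ⟨S, _, _, i, c, hi, h⟩ := (PtX.equivalent_iff _ _).1 h
    change (((PtX.univ hj t).pull f).pull i).StrictIso (((PtX.univ hj t).pull g).pull i) c at h
    rw [PtX.pull_pull, PtX.pull_pull] at h
    have e := PtX.eq_of_strictIso hj hk t (fun a => congrArg i (hK a)) h
    exact AlgHom.ext fun a => hi.injective (DFunLike.congr_fun e a)
  · obtain ⟨S, _, _, i, y, hi, hy, hu, -⟩ := p.level.exists_cover
    have hl := p.level.map i
    obtain ⟨x, hx⟩ := hu
    -- With x = φ_{T^n}(y), the transported module ψ has the generator y' = x⁻¹ y, for which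
    -- ψ_{T^n}(y') = 1.
    obtain ⟨ψ, hψ⟩ := exists_isIsom (p.φ.map i) x
    have hy' : (x : S) * (((x⁻¹ : Sˣ) : S) * y) = y := by rw [← mul_assoc, Units.mul_inv, one_mul]
    set y' := ((x⁻¹ : Sˣ) : S) * y with hy'_def
    have hone : ψ.act (X ^ n) y' = 1 := by
      have h1 := hψ.act_mul (X ^ n) y'
      rw [hy', ← hx] at h1
      exact x.isUnit.mul_right_injective (h1.symm.trans (mul_one _).symm)
    have hT : ψ.phiT (ψ.act (X ^ n) y') = 0 := by
      have h1 := hψ.phiT_mul (ψ.act (X ^ n) y')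
      rw [hone, mul_one, (congrArg _ hx).trans (hl.phiT_act hy)] at h1
      rw [hone]
      exact x.isUnit.mul_right_eq_zero.1 h1.symm
    obtain ⟨f, hfK, hfs, hfφ, hfy⟩ := t.exists_algHom (i.comp (IsScalarTower.toAlgHom Fq K R))
      (by rw [hone]; exact isUnit_one) hT ψ.gm.isUnit (fun f₁ h₁ => h₁)
      (fun f₁ _ => by rw [hone, one_pow, Units.val_one, map_one])
    refine ⟨S, _, _, i, f, hi, hfK, PtX.StrictIso.equivalent (c := x) ⟨?_, fun Ω _ _ _ s z => ?_⟩⟩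
    · change (t.module.map f).IsIsom (p.φ.map i) x
      rw [hfφ]; exact hψ
    · change (t.st.P.map (f : t.A →+* S)).eval₂ (s : S →+* Ω) z = 0 ↔
        (p.P.map (i : R →+* S)).eval₂ (s : S →+* Ω) (s x * z) = 0
      have hlf := (t.isLevel hj).map f
      rw [hfφ] at hlf
      -- Both fibres are generated by a single element, y' and y = x y', so multiplication by x
      -- identifies them termwise in a.
      rw [hlf.exists_act_eq_iff s (y := s y')
          (eval₂_eq_zero_of_eval (by rw [eval_map]; exact hfy) s)
          (by rw [← map_act, hone, map_one]; exact one_ne_zero),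
        hl.exists_act_eq_iff s (y := s y) (eval₂_eq_zero_of_eval hy s)
          (by rw [← map_act, ← hx]; exact (x.isUnit.map s).ne_zero)]
      refine exists_congr fun a => ?_
      have h1 := (hψ.map s).act_mul a (s y')
      have h2 : ((Units.map (s : S →* Ω) x : Ωˣ) : Ω) * s y' = s y := by
        exact (map_mul s (x : S) y').symm.trans (congrArg s hy')
      rw [h2] at h1
      rw [h1]
      exact (mul_right_injective₀ (x.isUnit.map s).ne_zero).eq_iff.symm

end X

end

theorem mainTheorem8 {Fq : Type*} [Field Fq] [Fintype Fq] {K : Type*} [Field K] [Algebra Fq K]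
    (j k : ℕ) (hj : 1 ≤ j) (hk : 1 ≤ k) (hjk : Nat.Coprime j k)
    (hK : Module.finrank Fq K = j + k) (n : ℕ) (hn : 1 ≤ n) :
    (HasModuliCurve K (moduliDDot Fq j k (X ^ n)) ∧
      HasModuliCurve K (moduliDot Fq j k (X ^ n)) ∧
      HasModuliCurve K (moduliX Fq j k (X ^ n))) ∧
    InducesDegree K (moduliDDot Fq j k (X ^ (n + 1))) (moduliDDot Fq j k (X ^ n))
      (fun t t' => PtDDot.Covers t t') (Fintype.card Fq ^ (j + k - 1)) ∧
    InducesDegree K (moduliDot Fq j k (X ^ (n + 1))) (moduliDot Fq j k (X ^ n))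
      (fun t t' => PtDot.Covers t t') (Fintype.card Fq ^ (j + k - 1)) ∧
    InducesDegree K (moduliX Fq j k (X ^ (n + 1))) (moduliX Fq j k (X ^ n))
      (fun t t' => PtX.Covers t t') (Fintype.card Fq ^ (j + k - 1)) := by
  -- The tower of index n parametrizes level T^(n+1), so level T^n corresponds to index n - 1.
  obtain ⟨n, rfl⟩ : ∃ n', n = n' + 1 := ⟨n - 1, by omega⟩
  have hDDot := DrinfeldModule.Tower.hasModuliCurve_and_inducesDegree (Fq := Fq)
    (j := j) (k := k) (n := n) hj hk
    (DrinfeldModule.lineValue_ofLine (-1) (lineDDot Fq K)) lawful_moduliDDot lawful_moduliDDot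
    (PtDDot.univ hj) (PtDDot.univ hj) (PtDDot.parametrizes_univ hj hk)
    (PtDDot.parametrizes_univ hj hk) (fun t t' => PtDDot.Covers t t')
    (fun t => PtDDot.exists_covers hj hk t) (fun f _ _ h => PtDDot.Covers.pull f h)
    (fun h h₁ h₂ => PtDDot.Covers.unique hj h₁ (h ▸ h₂))
    (fun t t' i hi hs hP => ⟨hi, hP, Units.ext hs⟩)
  have hDot := DrinfeldModule.Tower.hasModuliCurve_and_inducesDegree (Fq := Fq)
    (j := j) (k := k) (n := n) hj hk
    (DrinfeldModule.lineValue_ofLine (-1) (BaseRing.s K)) lawful_moduliDot lawful_moduliDot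
    (PtDot.univ hj) (PtDot.univ hj) (PtDot.parametrizes_univ hj)
    (PtDot.parametrizes_univ hj) (fun t t' => PtDot.Covers t t')
    (fun t => PtDot.exists_covers hj hk t) (fun f _ _ h => PtDot.Covers.pull f h)
    (fun h h₁ h₂ => PtDot.Covers.unique hj h₁ (h ▸ h₂))
    (fun t t' i hi _ hP => ⟨hi, hP⟩)
  have hX := DrinfeldModule.Tower.hasModuliCurve_and_inducesDegree (Fq := Fq)
    (j := j) (k := k) (n := n) hj hk
    (DrinfeldModule.lineValue_ofLine (BaseRing.s K) 1) lawful_moduliX lawful_moduliX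
    (PtX.univ hj) (PtX.univ hj) (PtX.parametrizes_univ hj hk)
    (PtX.parametrizes_univ hj hk) (fun t t' => PtX.Covers t t')
    (fun t => PtX.exists_covers hj hk t) (fun f _ _ h => PtX.Covers.pull f h)
    (fun h h₁ h₂ => PtX.Covers.equivalent h h₁ h₂)
    (fun t t' i hi _ hP => ⟨hi, hP⟩)
  exact ⟨⟨hDDot.1, hDot.1, hX.1⟩, hDDot.2, hDot.2, hX.2⟩
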